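/- Let $k$ be a field of characteristic different from $2$, and let $\lambda$ be a partition, $d=|\lambda|$, with conjugate $\lambda'$. **Setting.** For $r=0,1$ let $\mathcal C_r$ be the Clifford superalgebra ($\mathcal C_0=k$; $\mathcal C_1$ has one odd generator $c$ with $c^2=1$). Let $\mathrm{smod}\,\mathcal C_r$ be the category of finite dimensional right $\mathcal C_r$-supermodules with all (not only even) $\mathcal C_r$-linear maps; for $r=0$ this is the category $\mathrm{svec}$ of finite dimensional vector superspaces. For a superspace $M$ let $\Gamma^dM\subseteq M^{\otimes d}$ be the invariants of the symmetric group $\mathfrak S_d$, acting with the usual signs. The category $\Gamma^d(\mathrm{smod}\,\mathcal C_r)$ has the same objects as $\mathrm{smod}\,\mathcal C_r$ and morphism superspaces $\Gamma^d\mathrm{Hom}_{\mathcal C_r}(V,W)$, with the composition induced by that of $\mathrm{smod}\,\mathcal C_r$. A homogeneous polynomial superfunctor of degree $d$ and of type I (resp. II) is an even $k$-linear functor $\Gamma^d(\mathrm{smod}\,\mathcal C_r)\to\mathrm{svec}$ with $r=0$ (resp. $r=1$). Restriction from type I to type II is composition with the functor forgetting the action of $\mathcal C_1$. **Schur superfunctors.**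 Let $\Pi$ denote parity change. For a superspace $M$ put $\Gamma_\Pi^{\lambda'}M=\Gamma^{\lambda'_1}(\Pi M)\otimes\Gamma^{\lambda'_2}(\Pi M)\otimes\cdots$ and $S^\lambda M=S^{\lambda_1}M\otimes S^{\lambda_2}M\otimes\cdots$. Let $\widehat\theta_\lambda$ be the composite $$\Gamma_\Pi^{\lambda'}M\hookrightarrow(\Pi M)^{\otimes d}\xrightarrow{\ 1^{\otimes d}\ }M^{\otimes d}\xrightarrow{\ \sigma_\lambda\ }M^{\otimes d}\twoheadrightarrow S^\lambda M,$$ where $\sigma_\lambda\in\mathfrak S_d$ sends the number of each box of the diagram of $\lambda$ in the numbering along successive rows to its number in the numbering along successive columns. The Schur superfunctor of type I is $\widehat S^{\mathsf I}_\lambda(M)=\widehat S_\lambda(M)=\operatorname{Im}\widehat\theta_\lambda\subseteq S^\lambda M$, and $\widehat S^{\mathsf{II}}_\lambda$ is its restriction to type II. **Formal characters.** Let $S(m|n,d)=\Gamma^d\mathrm{End}(k^{m|n})$ and $Q(n,d)=\Gamma^d\mathrm{End}_{\mathcal C_1}(V_n)$, where $V_n=(\mathcal C_1)^n$ is the free right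 $\mathcal C_1$-supermodule of rank $n$. As a superspace $V_n=k^{n|n}$, with basis $X_1,\dots,X_n$ (even) and $X_1c,\dots,X_nc$ (odd). For $1\le i\le m+n$ let $E_{i,i}$ be the diagonal matrix units of $\mathrm{End}(k^{m|n})$, and for $1\le i\le n$ put $E_{0;i,i}=E_{i,i}+E_{n+i,n+i}\in\mathrm{End}_{\mathcal C_1}(V_n)$. For a composition $\mu$ of $d$ with $m+n$ (resp. $n$) parts $\ge 0$, the weight idempotent of weight $\mu$ in $S(m|n,d)$ (resp. $Q(n,d)$) is $\sum e_{i_1}\otimes\cdots\otimes e_{i_d}$ with $e_i=E_{i,i}$ (resp. $e_i=E_{0;i,i}$), summed over all words $i_1\cdots i_d$ in which each letter $s$ occurs exactly $\mu_s$ times. The weight space $W_\mu$ of a finite dimensional supermodule $W$ is the image of this idempotent, and the formal character is $$\mathrm{ch}(W)=\sum_\mu\dim(W_\mu)\,z^\mu .$$ It is a polynomial in $z=(x_1,\dots,x_m,y_1,\dots,y_n)$ for $S(m|n,d)$ and in $z=(x_1,\dots,x_n)$ for $Q(n,d)$. Let $X(\infty,d)$ (resp. $Z(\infty|\infty,d)$)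 be the inverse limit of the groups of homogeneous polynomials of degree $d$ over $\mathbb Z$ in $x_1,\dots,x_n$ (resp. in $x_1,\dots,x_m,y_1,\dots,y_n$) with respect to the maps setting the additional variables equal to $0$. For $T$ of type I (resp. II) the families $\mathrm{ch}(T(k^{m|n}))$, $m,n\ge0$ (resp. $\mathrm{ch}(T(V_n))$, $n\ge0$) are compatible with these maps. Let $$\mathrm{ch}^{\mathsf I}(T)=\varprojlim\mathrm{ch}(T(k^{m|n}))\in Z(\infty|\infty,d)\quad\text{and}\quad\mathrm{ch}^{\mathsf{II}}(T)=\varprojlim\mathrm{ch}(T(V_n))\in X(\infty,d).$$ **Symmetric functions.** With $s_\mu$ and $s_{\lambda/\mu}$ the (skew) Schur functions, the hook Schur function is $$hs_\lambda(x_1,\dots,x_m;y_1,\dots,y_n)=\sum_{\mu\subseteq\lambda}s_\mu(x_1,\dots,x_m)\,s_{\lambda'/\mu'}(y_1,\dots,y_n),$$ and the Hall–Littlewood symmetric function is $$S_\lambda(x_1,\dots,x_n)=hs_\lambda(x_1,\dots,x_n;x_1,\dots,x_n).$$ Both families are compatible with setting additional variables equal to $0$; their inverse limits are denoted by $hs_\lambda(x;y)\in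 Z(\infty|\infty,d)$ and $S_\lambda(x)\in X(\infty,d)$. **Theorem.** For every $n\ge0$, the formal character of the $Q(n,d)$-supermodule $\widehat S^{\mathsf{II}}_\lambda(V_n)$ is $$\mathrm{ch}\bigl(\widehat S^{\mathsf{II}}_\lambda(V_n)\bigr)=S_\lambda(x_1,\dots,x_n).$$ Moreover, $$\mathrm{ch}^{\mathsf I}(\widehat S^{\mathsf I}_\lambda)=hs_\lambda(x;y)\qquad\text{and}\qquad\mathrm{ch}^{\mathsf{II}}(\widehat S^{\mathsf{II}}_\lambda)=S_\lambda(x).$$ -/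

import Mathlib

open scoped TensorProduct

noncomputable section

namespace SchurSuper

universe u

/-! ### Vector superspaces -/

/-- A vector superspace `M = M₀ ⊕ M₁` over `k`.  The `ℤ/2`-grading is recorded by the two
projections `proj ε` of `M` onto its homogeneous components `M_ε = {v | proj ε v = v}`. -/
class SuperSpace (k : Type u) [Field k] (M : Type u) [AddCommMonoid M] [Module k M] where
  proj : ZMod 2 → M →ₗ[k] M
  proj_proj : ∀ (ε δ : ZMod 2) (v : M), proj ε (proj δ v) = if ε = δ then proj δ v else 0
  proj_add : ∀ v : M, proj 0 v + proj 1 v = v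

/-- The projection of a superspace onto its component of degree `ε`. -/
abbrev pr (k : Type u) [Field k] {M : Type u} [AddCommMonoid M] [Module k M] [SuperSpace k M]
    (ε : ZMod 2) : M →ₗ[k] M := SuperSpace.proj ε

theorem zmod2_cases (ε : ZMod 2) : ε = 0 ∨ ε = 1 := by revert ε; decide

theorem sum_zmod2 {A : Type*} [AddCommMonoid A] (f : ZMod 2 → A) : ∑ ε, f ε = f 0 + f 1 :=
  Fin.sum_univ_two f

/-- The sign `(-1)^a`. -/
def koszul (k : Type u) [Field k] (a : ZMod 2) : k := if a = 0 then 1 else -1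

theorem koszul_zero (k : Type u) [Field k] : koszul k 0 = 1 := by simp [koszul]

theorem koszul_add (k : Type u) [Field k] (a b : ZMod 2) :
    koszul k (a + b) = koszul k a * koszul k b := by
  rcases zmod2_cases a with rfl | rfl <;> rcases zmod2_cases b with rfl | rfl <;>
    simp [koszul, show (1 + 1 : ZMod 2) = 0 from rfl]

theorem koszul_mul_self (k : Type u) [Field k] (a : ZMod 2) : koszul k a * koszul k a = 1 := by
  rw [← koszul_add, CharTwo.add_self_eq_zero, koszul_zero]

section SuperSpace

variable {k : Type u} [Field k] {M N : Type u} [AddCommGroup M] [Module k M] [SuperSpace k M]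
  [AddCommGroup N] [Module k N] [SuperSpace k N]

theorem pr_pr (ε δ : ZMod 2) (v : M) :
    (pr k ε (pr k δ v : M) : M) = if ε = δ then (pr k δ v : M) else 0 := SuperSpace.proj_proj ε δ v

theorem pr_self (ε : ZMod 2) (v : M) : (pr k ε (pr k ε v : M) : M) = pr k ε v := by
  rw [pr_pr, if_pos rfl]

theorem pr_add (v : M) : (pr k 0 v + pr k 1 v : M) = v := SuperSpace.proj_add v

theorem sum_pr (v : M) : ∑ ε, (pr k ε v : M) = v := by
  rw [sum_zmod2, pr_add]

theorem pr_of_homog {δ : ZMod 2} {v : M} (h : pr k δ v = v) (ε : ZMod 2) :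
    pr k ε v = if ε = δ then v else 0 := by
  conv_lhs => rw [← h]
  rw [pr_pr, h]

/-- A subsuperspace: `N = (N ∩ M₀) ⊕ (N ∩ M₁)`. -/
def IsGraded (N : Submodule k M) : Prop := ∀ ε : ZMod 2, ∀ v ∈ N, (pr k ε v : M) ∈ N

/-- The superspace structure on a subsuperspace. -/
@[reducible] def SuperSpace.sub (N : Submodule k M) (h : IsGraded N) : SuperSpace k N where
  proj ε := (pr k ε : M →ₗ[k] M).restrict (h ε)
  proj_proj ε δ v := by
    ext
    have := pr_pr (k := k) ε δ (v : M)
    split_ifs at this ⊢ <;> simpa using this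
  proj_add v := by
    ext
    exact pr_add (k := k) (v : M)

/-- The superspace structure on the quotient by a subsuperspace. -/
@[reducible] def SuperSpace.quot (N : Submodule k M) (h : IsGraded N) : SuperSpace k (M ⧸ N) where
  proj ε := N.mapQ N (pr k ε) (h ε)
  proj_proj ε δ v := by
    obtain ⟨v, rfl⟩ := N.mkQ_surjective v
    have := congrArg N.mkQ (pr_pr (k := k) ε δ v)
    split_ifs at this ⊢ <;> simpa using this
  proj_add v := by
    obtain ⟨v, rfl⟩ := N.mkQ_surjective v
    simpa using congrArg N.mkQ (pr_add (k := k) v)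

/-- The superspace of all linear maps `M → N`; a map `f` is homogeneous of degree `ε` when
`f(M_δ) ⊆ N_(ε+δ)` for all `δ`. -/
instance homSuperSpace : SuperSpace k (M →ₗ[k] N) where
  proj ε := ∑ δ, (LinearMap.compRight k (pr k (ε + δ) : N →ₗ[k] N)) ∘ₗ
    (pr k δ : M →ₗ[k] M).lcomp k N
  proj_proj ε δ f := by
    ext v
    rcases zmod2_cases ε with rfl | rfl <;> rcases zmod2_cases δ with rfl | rfl <;>
    simp [sum_zmod2, pr_pr, show (1 + 1 : ZMod 2) = 0 from rfl]
  proj_add f := by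
    ext v
    conv_rhs => rw [← pr_add (k := k) v, map_add, ← pr_add (k := k) (f (pr k 0 v)),
      ← pr_add (k := k) (f (pr k 1 v))]
    simp [sum_zmod2, show (1 + 1 : ZMod 2) = 0 from rfl]
    abel

theorem pr_hom_apply (ε : ZMod 2) (f : M →ₗ[k] N) (v : M) :
    (pr k ε f : M →ₗ[k] N) v = ∑ δ, (pr k (ε + δ) (f (pr k δ v)) : N) := by
  simp [pr, SuperSpace.proj]

end SuperSpace

/-! ### Tensor powers, the signed action of the symmetric group, and the rule of signs -/

/-- The tensor power `M^{⊗d}`. -/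
abbrev TPow (k : Type u) [Field k] (M : Type u) [AddCommMonoid M] [Module k M] (d : ℕ) : Type u :=
  ⨂[k] _ : Fin d, M

section Tensor

variable {k : Type u} [Field k] {d : ℕ}
  {M A B C D E F : Type u}
  [AddCommGroup M] [Module k M] [SuperSpace k M]
  [AddCommGroup A] [Module k A] [SuperSpace k A] [AddCommGroup B] [Module k B] [SuperSpace k B]
  [AddCommGroup C] [Module k C] [SuperSpace k C] [AddCommGroup D] [Module k D] [SuperSpace k D]
  [AddCommGroup E] [Module k E] [SuperSpace k E] [AddCommGroup F] [Module k F] [SuperSpace k F]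
  {A' B' C' : Type u}
  [AddCommGroup A'] [Module k A'] [SuperSpace k A'] [AddCommGroup B'] [Module k B']
  [SuperSpace k B'] [AddCommGroup C'] [Module k C'] [SuperSpace k C']

/-- `∑ φ_t ε_s` over `s < t`: the exponent of the sign in
`(f₁ ⊗ ⋯ ⊗ f_d)(v₁ ⊗ ⋯ ⊗ v_d) = ± f₁(v₁) ⊗ ⋯ ⊗ f_d(v_d)`, where `|f_t| = φ_t`, `|v_s| = ε_s`. -/
def charge (φ ε : Fin d → ZMod 2) : ZMod 2 := ∑ s, ∑ t, if s < t then φ t * ε s else 0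

/-- `∑ ε_s ε_t` over all `s < t` with `σ⁻¹ s > σ⁻¹ t`. -/
def invCharge (ε : Fin d → ZMod 2) (σ : Equiv.Perm (Fin d)) : ZMod 2 :=
  ∑ s, ∑ t, if s < t ∧ σ.symm t < σ.symm s then ε s * ε t else 0

theorem charge_perm (φ ε : Fin d → ZMod 2) (σ : Equiv.Perm (Fin d)) :
    charge φ ε + invCharge (φ + ε) σ = invCharge φ σ + invCharge ε σ + charge (φ ∘ σ) (ε ∘ σ) := by
  have h1 : charge (φ ∘ σ) (ε ∘ σ)
      = ∑ s, ∑ t, if σ.symm s < σ.symm t then φ t * ε s else 0 := by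
    rw [charge, ← Equiv.sum_comp σ (fun s => ∑ t, if σ.symm s < σ.symm t then φ t * ε s else 0)]
    refine Finset.sum_congr rfl fun s _ => ?_
    rw [← Equiv.sum_comp σ (fun t => if σ.symm (σ s) < σ.symm t then φ t * ε (σ s) else 0)]
    simp
  have h2 : invCharge (φ + ε) σ = invCharge φ σ + invCharge ε σ +
      ((∑ s, ∑ t, if t < s ∧ σ.symm s < σ.symm t then φ t * ε s else 0) +
       ∑ s, ∑ t, if s < t ∧ σ.symm t < σ.symm s then φ t * ε s else 0) := by
    rw [Finset.sum_comm (f := fun s t => if t < s ∧ σ.symm s < σ.symm t then φ t * ε s else 0)]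
    simp only [invCharge, ← Finset.sum_add_distrib]
    refine Finset.sum_congr rfl fun s _ => Finset.sum_congr rfl fun t _ => ?_
    split_ifs
    · simp only [Pi.add_apply]; ring
    · simp
  have h3 : charge φ ε + (∑ s, ∑ t, if σ.symm s < σ.symm t then φ t * ε s else 0) +
      ((∑ s, ∑ t, if t < s ∧ σ.symm s < σ.symm t then φ t * ε s else 0) +
       ∑ s, ∑ t, if s < t ∧ σ.symm t < σ.symm s then φ t * ε s else 0) = 0 := by
    simp only [charge, ← Finset.sum_add_distrib]
    refine Finset.sum_eq_zero fun s _ => Finset.sum_eq_zero fun t _ => ?_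
    have e : ∀ a : ZMod 2, a + a = 0 := CharTwo.add_self_eq_zero
    rcases lt_trichotomy s t with h | rfl | h
    · have hne : σ.symm s ≠ σ.symm t := fun h' => h.ne (σ.symm.injective h')
      rcases lt_or_gt_of_ne hne with h' | h' <;> simp [h, h', h.not_gt, h'.not_gt, e]
    · simp
    · have hne : σ.symm s ≠ σ.symm t := fun h' => h.ne' (σ.symm.injective h')
      rcases lt_or_gt_of_ne hne with h' | h' <;> simp [h, h', h.not_gt, h'.not_gt, e]
  rw [h1, h2]
  have e : ∀ a b c : ZMod 2, a + b + c = 0 → a + c = b := by decide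
  have := e _ _ _ h3
  linear_combination this

/-- The projection of `M^{⊗d}` onto `M_(δ₁) ⊗ ⋯ ⊗ M_(δ_d)`. -/
def multiProj (δ : Fin d → ZMod 2) :
    TPow k M d →ₗ[k] TPow k M d :=
  PiTensorProduct.map fun i => pr k (δ i)

theorem multiProj_tprod {ε : Fin d → ZMod 2} {v : Fin d → M}
    (h : ∀ i, pr k (ε i) (v i) = v i) (δ : Fin d → ZMod 2) :
    multiProj δ (PiTensorProduct.tprod k v) = if δ = ε then PiTensorProduct.tprod k v else 0 := by
  rw [multiProj, PiTensorProduct.map_tprod]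
  split_ifs with hδ
  · subst hδ; simp [h]
  · obtain ⟨i, hi⟩ := Function.ne_iff.1 hδ
    exact MultilinearMap.map_coord_zero _ i (by rw [pr_of_homog (h i), if_neg hi])

/-- Linear maps out of a tensor power are determined on tensors of homogeneous vectors. -/
theorem homog_ext {G : Type*} [AddCommGroup G] [Module k G]
    {f g : TPow k M d →ₗ[k] G}
    (h : ∀ (ε : Fin d → ZMod 2) (v : Fin d → M), (∀ i, pr k (ε i) (v i) = v i) →
      f (PiTensorProduct.tprod k v) = g (PiTensorProduct.tprod k v)) : f = g := by
  refine PiTensorProduct.ext (MultilinearMap.ext fun v => ?_)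
  have hv : v = fun i => ∑ ε, pr k ε (v i) := funext fun i => (sum_pr (v i)).symm
  simp only [LinearMap.compMultilinearMap_apply]
  rw [hv, MultilinearMap.map_sum, map_sum, map_sum]
  exact Finset.sum_congr rfl fun ε _ => h ε _ fun i => pr_self _ _

/-- The superspace `M^{⊗d}`; a tensor of homogeneous vectors has degree the sum of the degrees. -/
instance tpowSuperSpace : SuperSpace k (TPow k M d) where
  proj ε := ∑ δ : Fin d → ZMod 2, if ∑ i, δ i = ε then multiProj δ else 0
  proj_proj ε δ v := by
    have key : ∀ (ε : ZMod 2) (α : Fin d → ZMod 2) (v : Fin d → M),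
        (∀ i, pr k (α i) (v i) = v i) →
        (∑ δ : Fin d → ZMod 2, if ∑ i, δ i = ε then multiProj δ else 0 :
          TPow k M d →ₗ[k] TPow k M d) (PiTensorProduct.tprod k v) = if ε = ∑ i, α i then PiTensorProduct.tprod k v else 0 := by
      intro ε α v h
      rw [LinearMap.sum_apply, Finset.sum_eq_single α]
      · by_cases hh : ∑ i, α i = ε
        · simp [hh, multiProj_tprod h]
        · simp [hh, Ne.symm hh]
      · intro β _ hβ
        split_ifs
        · rw [multiProj_tprod h, if_neg hβ]
        · rfl
      · simp
    have : (∑ δ : Fin d → ZMod 2, if ∑ i, δ i = ε then multiProj δ else 0 :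
          TPow k M d →ₗ[k] TPow k M d) ∘ₗ
        (∑ δ' : Fin d → ZMod 2, if ∑ i, δ' i = δ then multiProj δ' else 0) =
        if ε = δ then (∑ δ' : Fin d → ZMod 2, if ∑ i, δ' i = δ then multiProj δ' else 0)
        else 0 := by
      refine homog_ext fun α v h => ?_
      rw [LinearMap.comp_apply, key δ α v h]
      by_cases h1 : δ = ∑ i, α i
      · rw [if_pos h1, key ε α v h]
        by_cases h2 : ε = δ
        · rw [if_pos (h2.trans h1), if_pos h2, key δ α v h, if_pos h1]
        · rw [if_neg (h1 ▸ h2), if_neg h2]; rfl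
      · rw [if_neg h1, map_zero]
        split_ifs
        · rw [key δ α v h, if_neg h1]
        · rfl
    have := LinearMap.congr_fun this v
    split_ifs at this ⊢ <;> exact this
  proj_add v := by
    have : (∑ δ : Fin d → ZMod 2, if ∑ i, δ i = 0 then multiProj δ else 0) +
        (∑ δ : Fin d → ZMod 2, if ∑ i, δ i = 1 then multiProj δ else 0) =
        (LinearMap.id : TPow k M d →ₗ[k] TPow k M d) := by
      refine homog_ext fun α v h => ?_
      rw [← Finset.sum_add_distrib, LinearMap.sum_apply, Finset.sum_eq_single α]
      · rcases zmod2_cases (∑ i, α i) with hh | hh <;> simp [hh, multiProj_tprod h]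
      · intro β _ hβ
        rcases zmod2_cases (∑ i, β i) with hh | hh <;> simp [hh, multiProj_tprod h, hβ]
      · simp
    exact LinearMap.congr_fun this v

theorem pr_tprod {α : Fin d → ZMod 2} {v : Fin d → M}
    (h : ∀ i, pr k (α i) (v i) = v i) (ε : ZMod 2) :
    pr k ε (PiTensorProduct.tprod k v) =
      if ε = ∑ i, α i then PiTensorProduct.tprod k v else 0 := by
  change (∑ δ : Fin d → ZMod 2, if ∑ i, δ i = ε then multiProj δ else 0 : TPow k M d →ₗ[k] TPow k M d)
      (PiTensorProduct.tprod k v) = _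
  rw [LinearMap.sum_apply, Finset.sum_eq_single α]
  · by_cases hh : ∑ i, α i = ε
    · simp [hh, multiProj_tprod h]
    · simp [hh, Ne.symm hh]
  · intro β _ hβ
    split_ifs
    · rw [multiProj_tprod h, if_neg hβ]
    · rfl
  · simp

/-- The right action of `σ ∈ 𝔖_d` on `M^{⊗d}`: for homogeneous `v_i`,
`(v₁ ⊗ ⋯ ⊗ v_d).σ = sgn(|v|, σ) v_(σ 1) ⊗ ⋯ ⊗ v_(σ d)`. -/
def tperm (σ : Equiv.Perm (Fin d)) : TPow k M d →ₗ[k] TPow k M d :=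
  ∑ ε : Fin d → ZMod 2, koszul k (invCharge ε σ) •
    ((PiTensorProduct.reindex k (fun _ => M) σ.symm).toLinearMap ∘ₗ multiProj ε)

theorem tperm_tprod (σ : Equiv.Perm (Fin d)) {ε : Fin d → ZMod 2} {v : Fin d → M}
    (h : ∀ i, pr k (ε i) (v i) = v i) :
    tperm σ (PiTensorProduct.tprod k v) =
      koszul k (invCharge ε σ) • PiTensorProduct.tprod k (v ∘ σ) := by
  rw [tperm, LinearMap.sum_apply, Finset.sum_eq_single ε]
  · rw [LinearMap.smul_apply, LinearMap.comp_apply, multiProj_tprod h, if_pos rfl]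
    congr 1
    exact PiTensorProduct.reindex_tprod _ _
  · intro β _ hβ
    rw [LinearMap.smul_apply, LinearMap.comp_apply, multiProj_tprod h, if_neg hβ, map_zero,
      smul_zero]
  · simp

theorem pr_tperm (σ : Equiv.Perm (Fin d)) (ε : ZMod 2) (x : TPow k M d) :
    pr k ε (tperm σ x) = tperm σ (pr k ε x) := by
  refine LinearMap.congr_fun (f := pr k ε ∘ₗ tperm σ)
    (g := tperm σ ∘ₗ pr k ε) (homog_ext fun α v h => ?_) x
  have h' : ∀ i, pr k ((α ∘ σ) i) ((v ∘ σ) i) = (v ∘ σ) i := fun i => h (σ i)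
  rw [LinearMap.comp_apply, LinearMap.comp_apply, tperm_tprod σ h, map_smul,
    pr_tprod h', pr_tprod h]
  have : ∑ i, (α ∘ σ) i = ∑ i, α i := Equiv.sum_comp σ α
  rw [this]
  split_ifs
  · rw [tperm_tprod σ h]
  · simp

/-- An even bilinear map `A × B → C` of superspaces. -/
def IsEvenBilin (β : A →ₗ[k] B →ₗ[k] C) : Prop :=
  ∀ (ε δ : ZMod 2) (a : A) (b : B), pr k ε a = a → pr k δ b = b →
    pr k (ε + δ) (β a b) = β a b

/-- The map `A^{⊗d} × B^{⊗d} → C^{⊗d}` induced by an even bilinear map `β` through the rule of signs: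
`(a₁ ⊗ ⋯ ⊗ a_d, b₁ ⊗ ⋯ ⊗ b_d) ↦ ∏_{s<t} (-1)^(|a_t||b_s|) β(a₁,b₁) ⊗ ⋯ ⊗ β(a_d,b_d)`. -/
def tbilin (β : A →ₗ[k] B →ₗ[k] C) (d : ℕ) :
    TPow k A d →ₗ[k] TPow k B d →ₗ[k] TPow k C d :=
  ∑ φ : Fin d → ZMod 2, ∑ ε : Fin d → ZMod 2, koszul k (charge φ ε) •
    (PiTensorProduct.map₂ fun _ : Fin d => β).compl₁₂ (multiProj φ) (multiProj ε)

theorem tbilin_tprod (β : A →ₗ[k] B →ₗ[k] C)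
    {φ ε : Fin d → ZMod 2} {a : Fin d → A} {b : Fin d → B}
    (ha : ∀ i, pr k (φ i) (a i) = a i) (hb : ∀ i, pr k (ε i) (b i) = b i) :
    tbilin β d (PiTensorProduct.tprod k a) (PiTensorProduct.tprod k b) =
      koszul k (charge φ ε) • PiTensorProduct.tprod k fun i => β (a i) (b i) := by
  rw [tbilin]
  simp only [LinearMap.sum_apply, LinearMap.smul_apply, LinearMap.compl₁₂_apply]
  rw [Finset.sum_eq_single φ, Finset.sum_eq_single ε]
  · rw [multiProj_tprod ha, multiProj_tprod hb, if_pos rfl, if_pos rfl,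
      PiTensorProduct.map₂_tprod_tprod]
  · intro β' _ hβ
    rw [multiProj_tprod hb, if_neg hβ, map_zero, smul_zero]
  · simp
  · intro β' _ hβ
    refine Finset.sum_eq_zero fun _ _ => ?_
    rw [multiProj_tprod ha, if_neg hβ, map_zero, LinearMap.zero_apply, smul_zero]
  · simp

/-- Bilinear maps out of tensor powers are determined on tensors of homogeneous vectors. -/
theorem homog_ext₂ {e : ℕ} {G : Type*} [AddCommGroup G] [Module k G]
    {f g : TPow k A d →ₗ[k] TPow k B e →ₗ[k] G}
    (h : ∀ (φ : Fin d → ZMod 2) (ε : Fin e → ZMod 2) (a : Fin d → A) (b : Fin e → B),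
      (∀ i, pr k (φ i) (a i) = a i) → (∀ i, pr k (ε i) (b i) = b i) →
      f (PiTensorProduct.tprod k a) (PiTensorProduct.tprod k b) =
        g (PiTensorProduct.tprod k a) (PiTensorProduct.tprod k b)) : f = g :=
  homog_ext fun φ a ha => homog_ext fun ε b hb => h φ ε a b ha hb

theorem tbilin_tperm {β : A →ₗ[k] B →ₗ[k] C} (hβ : IsEvenBilin β)
    (σ : Equiv.Perm (Fin d)) (x : TPow k A d) (y : TPow k B d) :
    tperm σ (tbilin β d x y) = tbilin β d (tperm σ x) (tperm σ y) := by
  have : (tbilin β d).compr₂ (tperm σ) = (tbilin β d).compl₁₂ (tperm σ) (tperm σ) := by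
    refine homog_ext₂ fun φ ε a b ha hb => ?_
    have ha' : ∀ i, pr k ((φ ∘ σ) i) ((a ∘ σ) i) = (a ∘ σ) i := fun i => ha (σ i)
    have hb' : ∀ i, pr k ((ε ∘ σ) i) ((b ∘ σ) i) = (b ∘ σ) i := fun i => hb (σ i)
    have hc : ∀ i, pr k ((φ + ε) i) (β (a i) (b i)) = β (a i) (b i) :=
      fun i => hβ _ _ _ _ (ha i) (hb i)
    rw [LinearMap.compr₂_apply, LinearMap.compl₁₂_apply, tbilin_tprod β ha hb, map_smul,
      tperm_tprod σ hc, tperm_tprod σ ha, tperm_tprod σ hb, map_smul, map_smul,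
      LinearMap.smul_apply, tbilin_tprod β ha' hb', smul_smul, smul_smul, smul_smul, ← koszul_add,
      ← koszul_add, ← koszul_add, charge_perm,
      add_comm (invCharge φ σ)]
    rfl
  exact LinearMap.congr_fun₂ this x y

theorem pr_tbilin {β : A →ₗ[k] B →ₗ[k] C} (hβ : IsEvenBilin β)
    (ε : ZMod 2) (x : TPow k A d) (y : TPow k B d) :
    pr k ε (tbilin β d x y) =
      ∑ δ, tbilin β d (pr k (ε + δ) x) (pr k δ y) := by
  have : (tbilin β d).compr₂ (pr k ε) =
      ∑ δ, (tbilin β d).compl₁₂ (pr k (ε + δ)) (pr k δ) := by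
    refine homog_ext₂ fun φ α a b ha hb => ?_
    have hc : ∀ i, pr k ((φ + α) i) (β (a i) (b i)) = β (a i) (b i) :=
      fun i => hβ _ _ _ _ (ha i) (hb i)
    simp only [LinearMap.sum_apply, LinearMap.compr₂_apply, LinearMap.compl₁₂_apply]
    rw [tbilin_tprod β ha hb, map_smul, pr_tprod hc, Finset.sum_eq_single (∑ i, α i)]
    · rw [pr_tprod ha, pr_tprod hb, if_pos rfl]
      have e : ∀ a b c : ZMod 2, (a = b + c ↔ a + c = b) := by decide
      have e' : (ε = ∑ i, (φ + α) i) ↔ (ε + ∑ i, α i = ∑ i, φ i) := by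
        rw [← e]; simp [Finset.sum_add_distrib]
      by_cases h : ε = ∑ i, (φ + α) i
      · rw [if_pos h, if_pos (e'.1 h), tbilin_tprod β ha hb]
      · rw [if_neg h, if_neg (fun h' => h (e'.2 h'))]; simp
    · intro β' _ hβ'
      rw [pr_tprod hb, if_neg hβ', map_zero]
    · simp
  have := LinearMap.congr_fun₂ this x y
  simpa [LinearMap.sum_apply] using this

theorem charge_assoc (φ ψ ε : Fin d → ZMod 2) :
    charge φ ψ + charge (φ + ψ) ε = charge ψ ε + charge φ (ψ + ε) := by
  simp only [charge, ← Finset.sum_add_distrib]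
  refine Finset.sum_congr rfl fun s _ => Finset.sum_congr rfl fun t _ => ?_
  split_ifs
  · simp only [Pi.add_apply]; ring
  · simp

theorem tbilin_assoc
    {β₁ : A →ₗ[k] B →ₗ[k] D} {β₂ : D →ₗ[k] C →ₗ[k] F}
    {β₃ : B →ₗ[k] C →ₗ[k] E} {β₄ : A →ₗ[k] E →ₗ[k] F}
    (h₁ : IsEvenBilin β₁) (h₃ : IsEvenBilin β₃)
    (h : ∀ a b c, β₂ (β₁ a b) c = β₄ a (β₃ b c)) (x : TPow k A d) (y : TPow k B d) (z : TPow k C d) :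
    tbilin β₂ d (tbilin β₁ d x y) z = tbilin β₄ d x (tbilin β₃ d y z) := by
  have : (tbilin β₁ d).compr₂ (tbilin β₂ d) =
      ((LinearMap.llcomp k (TPow k B d) (TPow k C d →ₗ[k] TPow k E d) (TPow k C d →ₗ[k] TPow k F d)).flip
        (tbilin β₃ d)) ∘ₗ (LinearMap.llcomp k (TPow k C d) (TPow k E d) (TPow k F d)) ∘ₗ tbilin β₄ d := by
    refine homog_ext₂ fun φ ψ a b ha hb => homog_ext fun ε c hc => ?_
    have h1 : ∀ i, pr k ((φ + ψ) i) (β₁ (a i) (b i)) = β₁ (a i) (b i) :=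
      fun i => h₁ _ _ _ _ (ha i) (hb i)
    have h3 : ∀ i, pr k ((ψ + ε) i) (β₃ (b i) (c i)) = β₃ (b i) (c i) :=
      fun i => h₃ _ _ _ _ (hb i) (hc i)
    simp only [LinearMap.compr₂_apply, LinearMap.comp_apply, LinearMap.flip_apply,
      LinearMap.llcomp_apply]
    rw [tbilin_tprod β₁ ha hb, tbilin_tprod β₃ hb hc, map_smul, map_smul, LinearMap.smul_apply,
      tbilin_tprod β₂ h1 hc, tbilin_tprod β₄ ha h3, smul_smul, smul_smul, ← koszul_add,
      ← koszul_add, charge_assoc]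
    simp only [h]
  exact LinearMap.congr_fun (LinearMap.congr_fun₂ this x y) z

/-- The map `A^{⊗d} → B^{⊗d}` induced by an even map `A → B`. -/
def tmap (f : A →ₗ[k] B) (d : ℕ) : TPow k A d →ₗ[k] TPow k B d :=
  PiTensorProduct.map fun _ => f

theorem tmap_tperm {f : A →ₗ[k] B} (hf : ∀ ε a, pr k ε (f a) = f (pr k ε a))
    (σ : Equiv.Perm (Fin d)) (x : TPow k A d) :
    tperm σ (tmap f d x) = tmap f d (tperm σ x) := by
  refine LinearMap.congr_fun (f := tperm σ ∘ₗ tmap f d) (g := tmap f d ∘ₗ tperm σ)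
    (homog_ext fun α v h => ?_) x
  have h' : ∀ i, pr k (α i) (f (v i)) = f (v i) := fun i => by rw [hf, h]
  rw [LinearMap.comp_apply, LinearMap.comp_apply, tperm_tprod σ h, map_smul, tmap,
    PiTensorProduct.map_tprod, PiTensorProduct.map_tprod, tperm_tprod σ h']
  rfl

theorem pr_tmap {f : A →ₗ[k] B} (hf : ∀ ε a, pr k ε (f a) = f (pr k ε a))
    (ε : ZMod 2) (x : TPow k A d) :
    pr k ε (tmap f d x) = tmap f d (pr k ε x) := by
  refine LinearMap.congr_fun (f := pr k ε ∘ₗ tmap f d)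
    (g := tmap f d ∘ₗ pr k ε) (homog_ext fun α v h => ?_) x
  have h' : ∀ i, pr k (α i) (f (v i)) = f (v i) := fun i => by rw [hf, h]
  rw [LinearMap.comp_apply, LinearMap.comp_apply, pr_tprod h, tmap,
    PiTensorProduct.map_tprod, pr_tprod h']
  split_ifs
  · rw [PiTensorProduct.map_tprod]
  · rw [map_zero]

theorem tmap_tbilin {β : A →ₗ[k] B →ₗ[k] C} {β' : A' →ₗ[k] B' →ₗ[k] C'}
    {f : A →ₗ[k] A'} {g : B →ₗ[k] B'} {h : C →ₗ[k] C'}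
    (hf : ∀ ε a, pr k ε (f a) = f (pr k ε a)) (hg : ∀ ε a, pr k ε (g a) = g (pr k ε a))
    (H : ∀ a b, β' (f a) (g b) = h (β a b)) (x : TPow k A d) (y : TPow k B d) :
    tbilin β' d (tmap f d x) (tmap g d y) = tmap h d (tbilin β d x y) := by
  have : (tbilin β' d).compl₁₂ (tmap f d) (tmap g d) = (tbilin β d).compr₂ (tmap h d) := by
    refine homog_ext₂ fun φ ε a b ha hb => ?_
    have ha' : ∀ i, pr k (φ i) (f (a i)) = f (a i) := fun i => by rw [hf, ha]
    have hb' : ∀ i, pr k (ε i) (g (b i)) = g (b i) := fun i => by rw [hg, hb]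
    rw [LinearMap.compr₂_apply, LinearMap.compl₁₂_apply, tbilin_tprod β ha hb, map_smul, tmap, tmap,
      tmap, PiTensorProduct.map_tprod, PiTensorProduct.map_tprod, PiTensorProduct.map_tprod,
      tbilin_tprod β' ha' hb']
    simp only [H]
  exact LinearMap.congr_fun₂ this x y

end Tensor

/-! ### Divided powers and the categories of supermodules -/

/-- The divided power `Γ^d M`, realised as the subsuperspace of `𝔖_d`-invariants of `M^{⊗d}`. -/
def gammaSub (k : Type u) [Field k] (M : Type u) [AddCommGroup M] [Module k M] [SuperSpace k M]
    (d : ℕ) : Submodule k (TPow k M d) where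
  carrier := {x | ∀ σ : Equiv.Perm (Fin d), tperm σ x = x}
  add_mem' hx hy σ := by rw [map_add, hx, hy]
  zero_mem' σ := map_zero _
  smul_mem' c x hx σ := by rw [map_smul, hx]

/-- `Γ^d M` as a type. -/
abbrev Gam (k : Type u) [Field k] (M : Type u) [AddCommGroup M] [Module k M] [SuperSpace k M]
    (d : ℕ) : Type u := gammaSub k M d

instance gamSuperSpace (k : Type u) [Field k] (M : Type u) [AddCommGroup M] [Module k M]
    [SuperSpace k M] (d : ℕ) : SuperSpace k (Gam k M d) :=
  SuperSpace.sub _ fun ε x hx σ => by rw [← pr_tperm, hx]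

/-- The category `svec` of finite dimensional vector superspaces; its morphisms are all linear
maps. -/
structure SVec (k : Type u) [Field k] where
  carrier : Type u
  [addCommGroup : AddCommGroup carrier]
  [module : Module k carrier]
  [finite : Module.Finite k carrier]
  [superSpace : SuperSpace k carrier]

attribute [instance] SVec.addCommGroup SVec.module SVec.finite SVec.superSpace

/-- The category `smod 𝒞_r` of finite dimensional right supermodules over the Clifford superalgebra
`𝒞_r`, which is generated by odd elements `c_1, …, c_r` with `c_i² = 1` and `c_i c_j = -c_j c_i` for
`i ≠ j`; here `c i` is the right action of `c_i`.  As `𝒞_0 = k`, the case `r = 0` is `svec`. -/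
structure CliffMod (k : Type u) [Field k] (r : ℕ) where
  carrier : Type u
  [addCommGroup : AddCommGroup carrier]
  [module : Module k carrier]
  [finite : Module.Finite k carrier]
  [superSpace : SuperSpace k carrier]
  c : Fin r → carrier →ₗ[k] carrier
  c_odd : ∀ (i : Fin r) (ε : ZMod 2) (v : carrier), c i (pr k ε v) = pr k (ε + 1) (c i v)
  c_sq : ∀ (i : Fin r) (v : carrier), c i (c i v) = v
  c_anticomm : ∀ i j : Fin r, i ≠ j → ∀ v : carrier, c i (c j v) = -c j (c i v)

attribute [instance] CliffMod.addCommGroup CliffMod.module CliffMod.finite CliffMod.superSpace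

section Cliff

variable {k : Type u} [Field k] {r d : ℕ}

/-- `Hom_{𝒞_r}(V, W)`: the linear maps, even or odd or mixed, with `f(vc) = f(v)c`. -/
def cliffHom (V W : CliffMod k r) : Submodule k (V.carrier →ₗ[k] W.carrier) where
  carrier := {f | ∀ i v, f (V.c i v) = W.c i (f v)}
  add_mem' hf hg i v := by simp [hf i v, hg i v]
  zero_mem' i v := by simp
  smul_mem' a f hf i v := by simp [hf i v]

/-- `Hom_{𝒞_r}(V, W)` as a type. -/
abbrev CHom (V W : CliffMod k r) : Type u := cliffHom V W

theorem isGraded_cliffHom (V W : CliffMod k r) : IsGraded (cliffHom V W) := by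
  intro ε f hf i v
  have e : ∀ δ : ZMod 2, (pr k (ε + δ) (f (pr k δ (V.c i v))) : W.carrier) =
      W.c i (pr k (ε + (δ + 1)) (f (pr k (δ + 1) v))) := by
    intro δ
    have h2 : ∀ δ : ZMod 2, δ + 1 + 1 = δ := by decide
    rw [W.c_odd, ← hf i, V.c_odd, h2, add_assoc, h2]
  rw [pr_hom_apply, pr_hom_apply, map_sum]
  simp only [e]
  exact Equiv.sum_comp (Equiv.addRight (1 : ZMod 2))
    fun δ => W.c i (pr k (ε + δ) (f (pr k δ v)))

instance cliffHomSuperSpace (V W : CliffMod k r) : SuperSpace k (CHom V W) :=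
  SuperSpace.sub _ (isGraded_cliffHom V W)

/-- The evaluation `Hom_{𝒞_r}(V, W) × V → W`. -/
def cliffEval (V W : CliffMod k r) : CHom V W →ₗ[k] V.carrier →ₗ[k] W.carrier :=
  (cliffHom V W).subtype

/-- Composition `Hom_{𝒞_r}(V, W) × Hom_{𝒞_r}(U, V) → Hom_{𝒞_r}(U, W)`. -/
def cliffComp (U V W : CliffMod k r) : CHom V W →ₗ[k] CHom U V →ₗ[k] CHom U W :=
  LinearMap.mk₂ k (fun f g => ⟨f.1 ∘ₗ g.1, fun i v => by
      rw [LinearMap.comp_apply, LinearMap.comp_apply, g.2, f.2]⟩)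
    (fun _ _ _ => rfl) (fun _ _ _ => rfl)
    (fun f g h => Subtype.ext (LinearMap.comp_add _ _ _))
    (fun a f g => Subtype.ext (LinearMap.comp_smul _ _ _))

/-- The identity of `V`. -/
def cliffId (V : CliffMod k r) : CHom V V := ⟨LinearMap.id, fun _ _ => rfl⟩

theorem coe_pr_cliffHom {V W : CliffMod k r} (ε : ZMod 2) (f : CHom V W) :
    ((pr k ε f : CHom V W) : V.carrier →ₗ[k] W.carrier) = pr k ε f.1 := rfl

theorem pr_apply_of_homog {M N : Type u} [AddCommGroup M] [Module k M] [SuperSpace k M]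
    [AddCommGroup N] [Module k N] [SuperSpace k N] {ε δ : ZMod 2} {f : M →ₗ[k] N} {v : M}
    (hf : pr k ε f = f) (hv : pr k δ v = v) : pr k (ε + δ) (f v) = f v := by
  rw [← hf, pr_hom_apply, Finset.sum_eq_single δ]
  · rw [hv, pr_self]
  · intro β _ hβ
    rw [pr_of_homog hv, if_neg hβ, map_zero, map_zero]
  · simp

theorem isEvenBilin_eval {M N : Type u} [AddCommGroup M] [Module k M] [SuperSpace k M]
    [AddCommGroup N] [Module k N] [SuperSpace k N] :
    IsEvenBilin (LinearMap.id : (M →ₗ[k] N) →ₗ[k] M →ₗ[k] N) :=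
  fun _ _ _ _ hf hv => pr_apply_of_homog hf hv

theorem isEvenBilin_cliffEval (V W : CliffMod k r) : IsEvenBilin (cliffEval V W) :=
  fun _ _ _ _ hf hv => pr_apply_of_homog (congrArg Subtype.val hf) hv

theorem isEvenBilin_cliffComp (U V W : CliffMod k r) : IsEvenBilin (cliffComp U V W) := by
  intro ε δ f g hf hg
  refine Subtype.ext (LinearMap.ext fun v => ?_)
  have hf' : pr k ε f.1 = f.1 := congrArg Subtype.val hf
  have hg' : pr k δ g.1 = g.1 := congrArg Subtype.val hg
  have key : ∀ α : ZMod 2, (pr k (ε + δ + α) (f.1 (g.1 (pr k α v))) : W.carrier) =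
      f.1 (g.1 (pr k α v)) := by
    intro α
    rw [add_assoc]
    exact pr_apply_of_homog hf' (pr_apply_of_homog hg' (pr_self α v))
  rw [coe_pr_cliffHom, pr_hom_apply]
  change ∑ α, (pr k (ε + δ + α) (f.1 (g.1 (pr k α v))) : W.carrier) = f.1 (g.1 v)
  simp only [key]
  rw [← map_sum, ← map_sum, sum_pr]

theorem pr_cliffId (V : CliffMod k r) : pr k 0 (cliffId V) = cliffId V := by
  refine Subtype.ext (LinearMap.ext fun v => ?_)
  rw [coe_pr_cliffHom, pr_hom_apply]
  change ∑ δ, (pr k (0 + δ) (pr k δ v) : V.carrier) = v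
  simp only [zero_add, pr_self]
  exact sum_pr v

/-- A tensor power of one even vector is `𝔖_d`-invariant, and so are symmetric sums of tensors of
even vectors. -/
theorem tperm_tprod_even {M : Type u} [AddCommGroup M] [Module k M] [SuperSpace k M]
    (σ : Equiv.Perm (Fin d)) {v : Fin d → M} (h : ∀ i, pr k 0 (v i) = v i) :
    tperm σ (PiTensorProduct.tprod k v) = PiTensorProduct.tprod k (v ∘ σ) := by
  rw [tperm_tprod σ (ε := fun _ => 0) h]
  simp [invCharge, koszul_zero]

/-- The identity of `V` in `Γ^d(smod 𝒞_r)`, as an element of `Γ^d Hom_{𝒞_r}(V, V)`. -/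
def gamId (V : CliffMod k r) (d : ℕ) : Gam k (CHom V V) d :=
  ⟨PiTensorProduct.tprod k fun _ => cliffId V,
    fun σ => tperm_tprod_even σ fun _ => pr_cliffId V⟩

/-- Composition in `Γ^d(smod 𝒞_r)`, induced by composition of `𝒞_r`-homomorphisms through the rule
of signs. -/
def gamComp {U V W : CliffMod k r} (f : Gam k (CHom V W) d) (g : Gam k (CHom U V) d) :
    Gam k (CHom U W) d :=
  ⟨tbilin (cliffComp U V W) d f.1 g.1, fun σ => by
    rw [tbilin_tperm (isEvenBilin_cliffComp U V W), f.2, g.2]⟩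

/-- The vector superspace underlying a right `𝒞_r`-supermodule. -/
abbrev CliffMod.forget (V : CliffMod k r) : CliffMod k 0 where
  carrier := V.carrier
  c := Fin.elim0
  c_odd i := i.elim0
  c_sq i := i.elim0
  c_anticomm i := i.elim0

/-- The inclusion `Hom_{𝒞_r}(V, W) ⊆ Hom(V, W)`. -/
def forgetHom (V W : CliffMod k r) : CHom V W →ₗ[k] CHom V.forget W.forget where
  toFun f := ⟨f.1, fun i => i.elim0⟩
  map_add' _ _ := rfl
  map_smul' _ _ := rfl

theorem pr_forgetHom {V W : CliffMod k r} (ε : ZMod 2) (f : CHom V W) :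
    pr k ε (forgetHom V W f) = forgetHom V W (pr k ε f) := rfl

/-- The forgetful functor `Γ^d(smod 𝒞_r) → Γ^d(svec)` on morphisms. -/
def forgetGam (V W : CliffMod k r) (d : ℕ) :
    Gam k (CHom V W) d →ₗ[k] Gam k (CHom V.forget W.forget) d :=
  (tmap (forgetHom V W) d).restrict fun x hx σ => by
    rw [tmap_tperm pr_forgetHom, hx]

theorem forgetGam_id (V : CliffMod k r) : forgetGam V V d (gamId V d) = gamId V.forget d :=
  Subtype.ext (PiTensorProduct.map_tprod _ _)

theorem forgetGam_comp {U V W : CliffMod k r} (f : Gam k (CHom V W) d) (g : Gam k (CHom U V) d) :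
    forgetGam U W d (gamComp f g) = gamComp (forgetGam V W d f) (forgetGam U V d g) :=
  Subtype.ext (tmap_tbilin pr_forgetHom pr_forgetHom (fun _ _ => rfl) f.1 g.1).symm

theorem pr_forgetGam {V W : CliffMod k r} (ε : ZMod 2) (f : Gam k (CHom V W) d) :
    pr k ε (forgetGam V W d f) = forgetGam V W d (pr k ε f) :=
  Subtype.ext (pr_tmap pr_forgetHom ε f.1)

end Cliff

/-! ### Polynomial superfunctors and supermodules over Schur superalgebras -/

/-- A strict polynomial superfunctor, homogeneous of degree `d`: an even `k`-linear functor
`Γ^d(smod 𝒞_r) → svec`.  It is of type I for `r = 0` and of type II for `r = 1`. -/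
structure PolFunctor (k : Type u) [Field k] (r d : ℕ) where
  obj : CliffMod k r → SVec k
  map : ∀ V W : CliffMod k r,
    Gam k (CHom V W) d →ₗ[k] ((obj V).carrier →ₗ[k] (obj W).carrier)
  map_even : ∀ (V W : CliffMod k r) (ε : ZMod 2) (f : Gam k (CHom V W) d),
    map V W (pr k ε f) = pr k ε (map V W f)
  map_id : ∀ V : CliffMod k r, map V V (gamId V d) = LinearMap.id
  map_comp : ∀ (U V W : CliffMod k r) (f : Gam k (CHom V W) d) (g : Gam k (CHom U V) d),
    map U W (gamComp f g) = map V W f ∘ₗ map U V g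

/-- The restriction functor from superfunctors of type I to type II: composition with the functor
forgetting the action of the Clifford superalgebra. -/
def PolFunctor.res {k : Type u} [Field k] {d : ℕ} (T : PolFunctor k 0 d) (r : ℕ) :
    PolFunctor k r d where
  obj V := T.obj V.forget
  map V W := T.map V.forget W.forget ∘ₗ forgetGam V W d
  map_even V W ε f := by
    rw [LinearMap.comp_apply, LinearMap.comp_apply, ← pr_forgetGam, T.map_even]
  map_id V := by rw [LinearMap.comp_apply, forgetGam_id, T.map_id]
  map_comp U V W f g := by
    rw [LinearMap.comp_apply, LinearMap.comp_apply, LinearMap.comp_apply, forgetGam_comp,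
      T.map_comp]

/-- A finite dimensional left supermodule over the superalgebra `Γ^d End_{𝒞_r}(V)`. -/
structure SchurMod {k : Type u} [Field k] {r : ℕ} (V : CliffMod k r) (d : ℕ) extends SVec k where
  act : Gam k (CHom V V) d →ₗ[k] (carrier →ₗ[k] carrier)
  act_even : ∀ (ε : ZMod 2) (f : Gam k (CHom V V) d), act (pr k ε f) = pr k ε (act f)
  act_one : act (gamId V d) = LinearMap.id
  act_mul : ∀ f g : Gam k (CHom V V) d, act (gamComp f g) = act f ∘ₗ act g

/-- The evaluation `T(V)` of a polynomial superfunctor, with its structure of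
`Γ^d End_{𝒞_r}(V)`-supermodule. -/
def PolFunctor.ev {k : Type u} [Field k] {r d : ℕ} (T : PolFunctor k r d) (V : CliffMod k r) :
    SchurMod V d where
  toSVec := T.obj V
  act := T.map V V
  act_even := T.map_even V V
  act_one := T.map_id V
  act_mul := T.map_comp V V V

/-! ### Schur superfunctors -/

/-- The parity change `ΠM`: the same vector space with the opposite grading. -/
def Par (M : Type u) : Type u := M

section Par

variable (k : Type u) [Field k] (M : Type u) [AddCommGroup M] [Module k M]

instance : AddCommGroup (Par M) := inferInstanceAs (AddCommGroup M)

instance : Module k (Par M) := inferInstanceAs (Module k M)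

/-- The identity map `ΠM → M`. -/
def parTo : Par M →ₗ[k] M := LinearMap.id

/-- The identity map `M → ΠM`. -/
def toPar : M →ₗ[k] Par M := LinearMap.id

variable [SuperSpace k M]

instance parSuperSpace : SuperSpace k (Par M) where
  proj ε := toPar k M ∘ₗ pr k (ε + 1) ∘ₗ parTo k M
  proj_proj ε δ v := by
    change (pr k (ε + 1) (pr k (δ + 1) (parTo k M v)) : M) = _
    rw [pr_pr]
    simp only [add_left_inj]
    rfl
  proj_add v := by
    change (pr k (0 + 1) (parTo k M v) + pr k (1 + 1) (parTo k M v) : M) = _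
    rw [add_comm]
    exact pr_add (parTo k M v)

theorem pr_par (ε : ZMod 2) (v : Par M) : parTo k M (pr k ε v) = pr k (ε + 1) (parTo k M v) := rfl

theorem pr_parTo : pr k 1 (parTo k M) = parTo k M := by
  ext v
  have h : ∀ δ : ZMod 2, 1 + δ = δ + 1 := by decide
  rw [pr_hom_apply]
  simp only [pr_par, h, pr_self]
  exact Equiv.sum_comp (Equiv.addRight (1 : ZMod 2)) (fun δ => (pr k δ (parTo k M v) : M)) |>.trans
    (sum_pr _)

theorem pr_toPar : pr k 1 (toPar k M) = toPar k M := by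
  ext v
  have h : ∀ δ : ZMod 2, 1 + δ + 1 = δ := by decide
  rw [pr_hom_apply]
  change ∑ δ, (pr k (1 + δ + 1) (pr k δ v) : M) = v
  simp only [h, pr_self]
  exact sum_pr v

end Par

section Schur

/-- The numbering of the boxes of a Young diagram along the rows: from left to right in each row,
and from the top row to the bottom row.  (Boxes are pairs (row, column).) -/
def rowBox (lam : YoungDiagram) : Fin lam.card ≃ lam.cells :=
  (Finset.orderIsoOfFin (lam.cells.map (toLex : ℕ × ℕ ≃ ℕ ×ₗ ℕ).toEmbedding)
    (Finset.card_map _)).toEquiv.trans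
  ((toLex : ℕ × ℕ ≃ ℕ ×ₗ ℕ).subtypeEquiv fun _ => by simp).symm

/-- The numbering of the boxes of a Young diagram along the columns: from top to bottom in each
column, and from the leftmost column to the rightmost column. -/
def colBox (lam : YoungDiagram) : Fin lam.card ≃ lam.cells :=
  (Finset.orderIsoOfFin
    (lam.cells.map ((Equiv.prodComm ℕ ℕ).trans (toLex : ℕ × ℕ ≃ ℕ ×ₗ ℕ)).toEmbedding)
    (Finset.card_map _)).toEquiv.trans
  (((Equiv.prodComm ℕ ℕ).trans (toLex : ℕ × ℕ ≃ ℕ ×ₗ ℕ)).subtypeEquiv fun _ => by simp).symm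

/-- The permutation `σ_λ`, sending the number of a box along the rows to its number along the
columns. -/
def sigmaPerm (lam : YoungDiagram) : Equiv.Perm (Fin lam.card) :=
  (rowBox lam).trans (colBox lam).symm

/-- The Young subgroup `𝔖_(λ₁) × 𝔖_(λ₂) × ⋯`. -/
def IsRowPerm (lam : YoungDiagram) (σ : Equiv.Perm (Fin lam.card)) : Prop :=
  ∀ s, (rowBox lam (σ s)).1.1 = (rowBox lam s).1.1

/-- The Young subgroup `𝔖_(λ'₁) × 𝔖_(λ'₂) × ⋯`. -/
def IsColPerm (lam : YoungDiagram) (σ : Equiv.Perm (Fin lam.card)) : Prop :=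
  ∀ s, (colBox lam (σ s)).1.2 = (colBox lam s).1.2

variable (k : Type u) [Field k] (lam : YoungDiagram)
  (M : Type u) [AddCommGroup M] [Module k M] [SuperSpace k M]

/-- The kernel of the multiplication `m : M^{⊗d} → S^λ M = S^(λ₁) M ⊗ S^(λ₂) M ⊗ ⋯`. -/
def symKer : Submodule k (TPow k M lam.card) :=
  Submodule.span k {y | ∃ σ x, IsRowPerm lam σ ∧ y = tperm σ x - x}

/-- `S^λ M = S^(λ₁) M ⊗ S^(λ₂) M ⊗ ⋯`, the coinvariants of the Young subgroup of `λ`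
in `M^{⊗d}`. -/
abbrev SymPow : Type u := TPow k M lam.card ⧸ symKer k lam M

/-- `Γ_Π^λ' M = Γ^(λ'₁)(ΠM) ⊗ Γ^(λ'₂)(ΠM) ⊗ ⋯`, the invariants of the Young subgroup of `λ'`
in `(ΠM)^{⊗d}`. -/
def divPowPar : Submodule k (TPow k (Par M) lam.card) where
  carrier := {x | ∀ σ, IsColPerm lam σ → tperm σ x = x}
  add_mem' hx hy σ h := by rw [map_add, hx σ h, hy σ h]
  zero_mem' σ _ := map_zero _
  smul_mem' c x hx σ h := by rw [map_smul, hx σ h]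

/-- The `d`-th tensor power, formed with the rule of signs, of a linear map `f : M → N` which need
not be even. -/
def signedPow {k M} [Field k] [AddCommGroup M] [Module k M] [SuperSpace k M] {N : Type u}
    [AddCommGroup N] [Module k N] [SuperSpace k N] (f : M →ₗ[k] N) (d : ℕ) :
    TPow k M d →ₗ[k] TPow k N d :=
  tbilin (LinearMap.id : (M →ₗ[k] N) →ₗ[k] M →ₗ[k] N) d (PiTensorProduct.tprod k fun _ => f)

/-- The map `θ̂_λ : Γ_Π^λ' M → S^λ M`, the composite of the inclusion of `Γ_Π^λ' M` in `(ΠM)^{⊗d}`,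
the map `1^{⊗d} : (ΠM)^{⊗d} → M^{⊗d}`, the action of `σ_λ` and multiplication. -/
def theta : divPowPar k lam M →ₗ[k] SymPow k lam M :=
  (symKer k lam M).mkQ ∘ₗ tperm (sigmaPerm lam) ∘ₗ signedPow (parTo k M) lam.card ∘ₗ
    (divPowPar k lam M).subtype

/-- `Ŝ_λ(M)`, the image of `θ̂_λ` in `S^λ M`. -/
def schurSub : Submodule k (SymPow k lam M) := LinearMap.range (theta k lam M)

variable {k lam M}

theorem isGraded_symKer : IsGraded (symKer k lam M) := by
  intro ε x hx
  induction hx using Submodule.span_induction with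
  | mem x h =>
    obtain ⟨σ, y, hσ, rfl⟩ := h
    exact Submodule.subset_span ⟨σ, pr k ε y, hσ, by rw [map_sub, pr_tperm]⟩
  | zero => rw [map_zero]; exact zero_mem _
  | add x y _ _ h1 h2 => rw [map_add]; exact add_mem h1 h2
  | smul a x _ h => rw [map_smul]; exact Submodule.smul_mem _ _ h

instance symPowSuperSpace : SuperSpace k (SymPow k lam M) :=
  SuperSpace.quot _ isGraded_symKer

theorem pr_mkQ (ε : ZMod 2) (x : TPow k M lam.card) :
    (pr k ε ((symKer k lam M).mkQ x) : SymPow k lam M) = (symKer k lam M).mkQ (pr k ε x) := rfl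

theorem mem_schurSub {y : SymPow k lam M} : y ∈ schurSub k lam M ↔
    ∃ x ∈ divPowPar k lam M, (symKer k lam M).mkQ
      (tperm (sigmaPerm lam) (signedPow (parTo k M) lam.card x)) = y := by
  constructor
  · rintro ⟨x, rfl⟩
    exact ⟨x.1, x.2, rfl⟩
  · rintro ⟨x, hx, rfl⟩
    exact ⟨⟨x, hx⟩, rfl⟩

variable {d : ℕ} {N : Type u} [AddCommGroup N] [Module k N] [SuperSpace k N]

/-- The tensor power of a homogeneous vector is homogeneous. -/
theorem pr_tprod_const {δ : ZMod 2} {v : M} (h : pr k δ v = v) (ε : ZMod 2) :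
    (pr k ε (PiTensorProduct.tprod k fun _ : Fin d => v) : TPow k M d) =
      if ε = ∑ _i : Fin d, δ then PiTensorProduct.tprod k fun _ : Fin d => v else 0 :=
  pr_tprod (α := fun _ => δ) (fun _ => h) ε

theorem pr_signedPow {δ : ZMod 2} {f : M →ₗ[k] N} (h : pr k δ f = f) (ε : ZMod 2)
    (x : TPow k M d) :
    (pr k (ε + ∑ _i : Fin d, δ) (signedPow f d x) : TPow k N d) = signedPow f d (pr k ε x) := by
  rw [signedPow, pr_tbilin isEvenBilin_eval, Finset.sum_eq_single ε]
  · have e : ∀ a b : ZMod 2, a + b + a = b := by decide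
    rw [pr_tprod_const h, e, if_pos rfl]
  · intro β _ hβ
    have e : ∀ a b c : ZMod 2, a + b + c = b → c = a := by decide
    rw [pr_tprod_const h, if_neg (fun h' => hβ (e _ _ _ h')), map_zero, LinearMap.zero_apply]
  · simp

/-- The tensor power of an odd map commutes with permutations up to the sign of the permutation. -/
theorem tperm_signedPow {f : M →ₗ[k] N} (h : pr k 1 f = f) (σ : Equiv.Perm (Fin d))
    (x : TPow k M d) :
    tperm σ (signedPow f d x) =
      koszul k (invCharge (fun _ => 1) σ) • signedPow f d (tperm σ x) := by
  rw [signedPow, tbilin_tperm isEvenBilin_eval, tperm_tprod σ (ε := fun _ => 1) fun _ => h,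
    map_smul]
  rfl

theorem isGraded_schurSub : IsGraded (schurSub k lam M) := by
  intro ε y hy
  obtain ⟨x, hx, rfl⟩ := mem_schurSub.1 hy
  have e : ∀ a b : ZMod 2, a = a + b + b := by decide
  rw [pr_mkQ, pr_tperm, e ε (∑ _i : Fin lam.card, 1), pr_signedPow (pr_parTo k M)]
  exact mem_schurSub.2 ⟨_, fun σ hσ => by rw [← pr_tperm, hx σ hσ], rfl⟩

instance schurSuperSpace : SuperSpace k (schurSub k lam M) :=
  SuperSpace.sub _ isGraded_schurSub

theorem signedPow_toPar_parTo (x : TPow k M d) :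
    signedPow (parTo k M) d (signedPow (toPar k M) d x) =
      koszul k (charge (d := d) (fun _ => 1) (fun _ => 1)) • x := by
  refine LinearMap.congr_fun (f := signedPow (parTo k M) d ∘ₗ signedPow (toPar k M) d)
    (g := koszul k (charge (d := d) (fun _ => 1) (fun _ => 1)) • LinearMap.id)
    (homog_ext fun ε v h => ?_) x
  have h1 : ∀ i, pr k (((fun _ => 1 : Fin d → ZMod 2) + ε) i) (toPar k M (v i)) = toPar k M (v i) :=
    fun i => pr_apply_of_homog (pr_toPar k M) (h i)
  have h2 : (fun _ : Fin d => (1 : ZMod 2)) + ((fun _ => 1) + ε) = ε := by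
    funext i
    have e : ∀ a : ZMod 2, 1 + (1 + a) = a := by decide
    exact e _
  rw [LinearMap.comp_apply, signedPow, signedPow,
    tbilin_tprod _ (φ := fun _ => 1) (fun _ => pr_toPar k M) h, map_smul]
  simp only [LinearMap.id_apply]
  rw [tbilin_tprod (LinearMap.id : (Par M →ₗ[k] M) →ₗ[k] Par M →ₗ[k] M) (φ := fun _ => 1)
      (fun _ => pr_parTo k M) h1, smul_smul, ← koszul_add,
    ← charge_assoc]
  have h3 : charge ((fun _ : Fin d => (1 : ZMod 2)) + fun _ => 1) ε = 0 := by
    have e : (1 + 1 : ZMod 2) = 0 := rfl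
    simp [charge, e]
  rw [h3, add_zero]
  rfl

variable {V W : CliffMod k 0}

/-- The action of `Γ^d Hom(V, W)` on tensors. -/
def gamAct (d : ℕ) (f : Gam k (CHom V W) d) : TPow k V.carrier d →ₗ[k] TPow k W.carrier d :=
  tbilin (cliffEval V W) d f.1

theorem tperm_gamAct (f : Gam k (CHom V W) d) (σ : Equiv.Perm (Fin d)) (x : TPow k V.carrier d) :
    tperm σ (gamAct d f x) = gamAct d f (tperm σ x) := by
  rw [gamAct, tbilin_tperm (isEvenBilin_cliffEval V W), f.2]

theorem coe_pr_gam (ε : ZMod 2) (f : Gam k M d) :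
    ((pr k ε f : Gam k M d) : TPow k M d) = pr k ε f.1 := rfl

theorem pr_gamAct (f : Gam k (CHom V W) d) (ε δ : ZMod 2) (x : TPow k V.carrier d) :
    (pr k (ε + δ) (gamAct d f (pr k δ x)) : TPow k W.carrier d) =
      gamAct d (pr k ε f) (pr k δ x) := by
  rw [gamAct, gamAct, pr_tbilin (isEvenBilin_cliffEval V W), Finset.sum_eq_single δ]
  · have e : ε + δ + δ = ε := by revert ε δ; decide
    rw [pr_self, e, coe_pr_gam]
  · intro β _ hβ
    rw [pr_pr, if_neg hβ, map_zero]
  · simp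

theorem gamAct_id (x : TPow k V.carrier d) : gamAct d (gamId V d) x = x := by
  refine LinearMap.congr_fun (f := gamAct d (gamId V d)) (g := LinearMap.id)
    (homog_ext fun ε v h => ?_) x
  rw [gamAct, gamId, tbilin_tprod _ (φ := fun _ => 0) (fun _ => pr_cliffId V) h]
  simp [charge, koszul_zero, cliffEval, cliffId]

theorem gamAct_comp {U : CliffMod k 0} (f : Gam k (CHom V W) d) (g : Gam k (CHom U V) d)
    (x : TPow k U.carrier d) : gamAct d (gamComp f g) x = gamAct d f (gamAct d g x) :=
  tbilin_assoc (isEvenBilin_cliffComp U V W) (isEvenBilin_cliffEval U V)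
    (fun _ _ _ => rfl) f.1 g.1 x

theorem gamAct_symKer (f : Gam k (CHom V W) lam.card) :
    symKer k lam V.carrier ≤ (symKer k lam W.carrier).comap (gamAct lam.card f) := by
  rw [symKer, Submodule.span_le]
  rintro _ ⟨σ, x, hσ, rfl⟩
  exact Submodule.subset_span ⟨σ, gamAct _ f x, hσ, by rw [map_sub, tperm_gamAct]⟩

/-- The action of `Γ^d Hom(V, W)` on the symmetric powers. -/
def symAct (lam : YoungDiagram) (f : Gam k (CHom V W) lam.card) :
    SymPow k lam V.carrier →ₗ[k] SymPow k lam W.carrier :=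
  (symKer k lam V.carrier).mapQ (symKer k lam W.carrier) (gamAct lam.card f) (gamAct_symKer f)

theorem symAct_mkQ (f : Gam k (CHom V W) lam.card) (x : TPow k V.carrier lam.card) :
    symAct lam f ((symKer k lam V.carrier).mkQ x) =
      (symKer k lam W.carrier).mkQ (gamAct lam.card f x) := rfl

theorem symAct_id (y : SymPow k lam V.carrier) : symAct lam (gamId V lam.card) y = y := by
  obtain ⟨x, rfl⟩ := (symKer k lam V.carrier).mkQ_surjective y
  rw [symAct_mkQ, gamAct_id]

theorem symAct_comp {U : CliffMod k 0} (f : Gam k (CHom V W) lam.card)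
    (g : Gam k (CHom U V) lam.card) (y : SymPow k lam U.carrier) :
    symAct lam (gamComp f g) y = symAct lam f (symAct lam g y) := by
  obtain ⟨x, rfl⟩ := (symKer k lam U.carrier).mkQ_surjective y
  rw [symAct_mkQ, symAct_mkQ, symAct_mkQ, gamAct_comp]

theorem symAct_schurSub (f : Gam k (CHom V W) lam.card) :
    ∀ y ∈ schurSub k lam V.carrier, symAct lam f y ∈ schurSub k lam W.carrier := by
  intro y hy
  obtain ⟨x, hx, rfl⟩ := mem_schurSub.1 hy
  set z := gamAct lam.card f (signedPow (parTo k V.carrier) lam.card x) with hz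
  refine mem_schurSub.2
    ⟨koszul k (charge (d := lam.card) (fun _ => 1) (fun _ => 1)) •
      signedPow (toPar k W.carrier) lam.card z, fun σ hσ => ?_, ?_⟩
  · rw [map_smul, tperm_signedPow (pr_toPar k _), hz, tperm_gamAct,
      tperm_signedPow (pr_parTo k _), hx σ hσ, map_smul, map_smul,
      smul_smul (koszul k (invCharge _ σ)), koszul_mul_self, one_smul]
  · rw [map_smul, signedPow_toPar_parTo, smul_smul, koszul_mul_self, one_smul, symAct_mkQ,
      ← tperm_gamAct]

end Schur

/-- The Schur superfunctor `Ŝ_λ` of type I. -/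
def schurI (k : Type u) [Field k] (lam : YoungDiagram) : PolFunctor k 0 lam.card where
  obj V := { carrier := schurSub k lam V.carrier }
  map V W :=
    { toFun := fun f => (symAct lam f).restrict (symAct_schurSub f)
      map_add' := fun f g => by
        ext ⟨y, hy⟩
        obtain ⟨x, rfl⟩ := (symKer k lam V.carrier).mkQ_surjective y
        change (symKer k lam W.carrier).mkQ (gamAct _ (f + g) x) =
          (symKer k lam W.carrier).mkQ (gamAct _ f x) + (symKer k lam W.carrier).mkQ (gamAct _ g x)
        rw [← map_add]
        simp [gamAct]
      map_smul' := fun a f => by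
        ext ⟨y, hy⟩
        obtain ⟨x, rfl⟩ := (symKer k lam V.carrier).mkQ_surjective y
        change (symKer k lam W.carrier).mkQ (gamAct _ (a • f) x) =
          a • (symKer k lam W.carrier).mkQ (gamAct _ f x)
        rw [← map_smul]
        simp [gamAct] }
  map_even V W ε f := by
    ext ⟨y, hy⟩
    rw [pr_hom_apply]
    obtain ⟨x, rfl⟩ := (symKer k lam V.carrier).mkQ_surjective y
    rw [AddSubmonoidClass.coe_finsetSum]
    change (symKer k lam W.carrier).mkQ (gamAct _ (pr k ε f) x) =
      ∑ δ, (symKer k lam W.carrier).mkQ (pr k (ε + δ) (gamAct _ f (pr k δ x)))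
    rw [← map_sum]
    congr 1
    simp only [pr_gamAct]
    rw [← map_sum, sum_pr]
  map_id V := LinearMap.ext fun y => Subtype.ext (symAct_id y.1)
  map_comp U V W f g := LinearMap.ext fun y => Subtype.ext (symAct_comp f g y.1)

/-- The Schur superfunctor `Ŝ_λ^II` of type II. -/
def schurII (k : Type u) [Field k] (lam : YoungDiagram) : PolFunctor k 1 lam.card :=
  (schurI k lam).res 1

/-! ### The supermodules `k^(m|n)` and `V_n`, weight idempotents, formal characters -/

section Characters

/-- The space of families `ι → k` with the grading in which the `i`-th basis vector has degree
`p i`. -/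
@[reducible] def piSuperSpace (k : Type u) [Field k] {ι : Type} (p : ι → ZMod 2) :
    SuperSpace k (ι → k) where
  proj ε := LinearMap.pi fun i => if p i = ε then LinearMap.proj i else 0
  proj_proj ε δ v := by
    funext i
    by_cases h1 : p i = ε <;> by_cases h2 : p i = δ <;> by_cases h3 : ε = δ <;> simp_all
  proj_add v := by
    funext i
    rcases zmod2_cases (p i) with h | h <;> simp [h]

theorem piSuperSpace_apply (k : Type u) [Field k] {ι : Type} (p : ι → ZMod 2) (ε : ZMod 2)
    (v : ι → k) (i : ι) : (piSuperSpace k p).proj ε v i = if p i = ε then v i else 0 := by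
  change (if p i = ε then LinearMap.proj i else 0 : (ι → k) →ₗ[k] k) v = _
  split_ifs <;> rfl

/-- The parity of the basis `X_1, …, X_m, Y_1, …, Y_n` of `k^(m|n)`. -/
def parity (m n : ℕ) : Fin m ⊕ Fin n → ZMod 2 := Sum.elim (fun _ => 0) fun _ => 1

/-- The superspace `k^(m|n)`. -/
def kmn (k : Type u) [Field k] (m n : ℕ) : CliffMod k 0 where
  carrier := Fin m ⊕ Fin n → k
  superSpace := piSuperSpace k (parity m n)
  c := Fin.elim0
  c_odd i := i.elim0
  c_sq i := i.elim0
  c_anticomm i := i.elim0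

/-- The right `𝒞_1`-supermodule `V_n = (𝒞_1)^n`: the superspace `k^(n|n)`, with
`X_i c = Y_i` and `Y_i c = X_i`. -/
def Vn (k : Type u) [Field k] (n : ℕ) : CliffMod k 1 where
  carrier := Fin n ⊕ Fin n → k
  superSpace := piSuperSpace k (parity n n)
  c _ := LinearMap.funLeft k k Sum.swap
  c_odd _ ε v := by
    funext i
    rw [LinearMap.funLeft_apply]
    refine (piSuperSpace_apply k _ _ _ _).trans (Eq.trans ?_ (piSuperSpace_apply k _ _ _ _).symm)
    rcases i with i | i <;> rcases zmod2_cases ε with rfl | rfl <;>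
      simp [parity, LinearMap.funLeft_apply, show (1 + 1 : ZMod 2) = 0 from rfl]
  c_sq _ v := by
    funext i
    simp [LinearMap.funLeft_apply]
  c_anticomm i j h := absurd (Subsingleton.elim i j) h

variable {k : Type u} [Field k]

/-- The matrix unit `E_(i,i)`. -/
def matUnit (k : Type u) [Field k] {ι : Type} [DecidableEq ι] (i : ι) : (ι → k) →ₗ[k] ι → k :=
  LinearMap.single k (fun _ => k) i ∘ₗ LinearMap.proj i

/-- `E_(i,i) ∈ End(k^(m|n))`. -/
def unitS (k : Type u) [Field k] {m n : ℕ} (i : Fin m ⊕ Fin n) : CHom (kmn k m n) (kmn k m n) :=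
  ⟨matUnit k i, fun j => j.elim0⟩

theorem matUnit_swap {n : ℕ} (i : Fin n) (v : Fin n ⊕ Fin n → k) :
    (matUnit k (Sum.inl i) + matUnit k (Sum.inr i) :
        (Fin n ⊕ Fin n → k) →ₗ[k] Fin n ⊕ Fin n → k) (LinearMap.funLeft k k Sum.swap v) =
      LinearMap.funLeft k k Sum.swap ((matUnit k (Sum.inl i) + matUnit k (Sum.inr i) :
        (Fin n ⊕ Fin n → k) →ₗ[k] Fin n ⊕ Fin n → k) v) := by
  funext j
  rcases j with j | j <;> simp [matUnit, LinearMap.funLeft_apply, Pi.single_apply]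

/-- `E_(0;i,i) = E_(i,i) + E_(n+i,n+i) ∈ End_{𝒞_1}(V_n)`. -/
def unitQ (k : Type u) [Field k] {n : ℕ} (i : Fin n) : CHom (Vn k n) (Vn k n) :=
  ⟨matUnit k (Sum.inl i) + matUnit k (Sum.inr i), fun _ v => matUnit_swap i v⟩

/-- The weight of a word `i : Fin d → ι`; `wordWeight i s` is the number of times that `s` occurs
in `i`. -/
def wordWeight {ι : Type} {d : ℕ} (i : Fin d → ι) : ι →₀ ℕ := ∑ s, Finsupp.single (i s) 1

theorem wordWeight_perm {ι : Type} {d : ℕ} (i : Fin d → ι) (σ : Equiv.Perm (Fin d)) :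
    wordWeight (i ∘ σ) = wordWeight i :=
  Equiv.sum_comp σ fun s => Finsupp.single (i s) 1

variable {r d : ℕ}

open scoped Classical in
/-- The weight idempotent of weight `μ` for a family `e` of even endomorphisms of `V`:
the sum of `e_(i₁) ⊗ ⋯ ⊗ e_(i_d)` over all words `i` of weight `μ`. -/
def weightIdem {V : CliffMod k r} {ι : Type} [Fintype ι] (e : ι → CHom V V)
    (he : ∀ i, pr k 0 (e i) = e i) (d : ℕ) (μ : ι →₀ ℕ) : Gam k (CHom V V) d :=
  ⟨∑ i : Fin d → ι with wordWeight i = μ, PiTensorProduct.tprod k fun s => e (i s), fun σ => by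
    rw [map_sum]
    simp only [tperm_tprod_even σ fun s => he _]
    refine Finset.sum_equiv (Equiv.arrowCongr σ.symm (Equiv.refl ι)) (fun i => ?_) fun i _ => rfl
    simp only [Finset.mem_filter, Finset.mem_univ, true_and]
    rw [← wordWeight_perm i σ]
    rfl⟩

/-- The formal character `∑_μ dim(W_μ) z^μ` of a supermodule `W` over `Γ^d End_{𝒞_r}(V)`, where `μ`
runs over the weights with `|μ| = d`, and `W_μ` is the image of the weight idempotent of
weight `μ`. -/
def formalCh {V : CliffMod k r} {ι : Type} [Fintype ι] [DecidableEq ι] (e : ι → CHom V V)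
    (he : ∀ i, pr k 0 (e i) = e i) (W : SchurMod V d) : MvPolynomial ι ℤ :=
  ∑ μ ∈ Finset.univ.finsuppAntidiag d, MvPolynomial.monomial μ
    (Module.finrank k (LinearMap.range (W.act (weightIdem e he d μ))) : ℤ)

theorem pr_piSuperSpace_matUnit {ι : Type} [DecidableEq ι] (p : ι → ZMod 2) (i : ι) :
    letI := piSuperSpace k p
    pr k 0 (matUnit k i) = matUnit k i := by
  let _ := piSuperSpace k p
  refine LinearMap.ext fun v => ?_
  rw [pr_hom_apply]
  funext j
  rw [sum_zmod2, Pi.add_apply, piSuperSpace_apply, piSuperSpace_apply]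
  by_cases h : j = i
  · subst h
    rcases zmod2_cases (p j) with h' | h' <;> simp [piSuperSpace_apply, matUnit, h']
  · rcases zmod2_cases (p j) with h' | h' <;> simp [matUnit, h', h]

theorem pr_unitS {m n : ℕ} (i : Fin m ⊕ Fin n) : pr k 0 (unitS k i) = unitS k i :=
  Subtype.ext (pr_piSuperSpace_matUnit (parity m n) i)

theorem pr_piSuperSpace_add {ι : Type} (p : ι → ZMod 2) (f g : (ι → k) →ₗ[k] ι → k)
    (hf : (let _ := piSuperSpace k p; pr k 0 f = f)) (hg : (let _ := piSuperSpace k p; pr k 0 g = g)) :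
    let _ := piSuperSpace k p
    pr k 0 (f + g) = f + g := by
  let _ := piSuperSpace k p
  change pr k 0 (f + g) = f + g
  rw [map_add]
  exact congrArg₂ (· + ·) hf hg

theorem pr_unitQ {n : ℕ} (i : Fin n) : pr k 0 (unitQ k i) = unitQ k i :=
  Subtype.ext (pr_piSuperSpace_add (parity n n) (matUnit k (Sum.inl i)) (matUnit k (Sum.inr i))
    (pr_piSuperSpace_matUnit _ _) (pr_piSuperSpace_matUnit _ _))

/-- The formal character of a supermodule over the Schur superalgebra
`S(m|n,d) = Γ^d End(k^(m|n))`, a polynomial in `x_1, …, x_m` and `y_1, …, y_n`. -/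
def chS {m n : ℕ} (W : SchurMod (kmn k m n) d) : MvPolynomial (Fin m ⊕ Fin n) ℤ :=
  formalCh (unitS k) pr_unitS W

/-- The formal character of a supermodule over the Schur superalgebra
`Q(n,d) = Γ^d End_{𝒞_1}(V_n)`, a polynomial in `x_1, …, x_n`. -/
def chQ {n : ℕ} (W : SchurMod (Vn k n) d) : MvPolynomial (Fin n) ℤ :=
  formalCh (unitQ k) pr_unitQ W

theorem coeff_formalCh {V : CliffMod k r} {ι : Type} [Fintype ι] [DecidableEq ι]
    (e : ι → CHom V V) (he : ∀ i, pr k 0 (e i) = e i) (W : SchurMod V d) (μ : ι →₀ ℕ) :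
    (formalCh e he W).coeff μ = if μ.degree = d then
      (Module.finrank k (LinearMap.range (W.act (weightIdem e he d μ))) : ℤ) else 0 := by
  rw [formalCh, MvPolynomial.coeff_sum]
  simp only [MvPolynomial.coeff_monomial]
  rw [Finset.sum_ite_eq' (Finset.univ.finsuppAntidiag d) μ]
  have : μ ∈ Finset.univ.finsuppAntidiag d ↔ μ.degree = d := by
    rw [Finset.mem_finsuppAntidiag, Finsupp.degree_eq_sum]
    simp
  simp only [this]

theorem isHomogeneous_formalCh {V : CliffMod k r} {ι : Type} [Fintype ι] [DecidableEq ι]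
    (e : ι → CHom V V) (he : ∀ i, pr k 0 (e i) = e i) (W : SchurMod V d) :
    (formalCh e he W).IsHomogeneous d := by
  intro μ hμ
  rw [coeff_formalCh] at hμ
  change Finsupp.weight (fun _ => 1) μ = d
  rw [← Finsupp.degree_eq_weight_one]
  by_contra h
  exact hμ (if_neg h)

theorem degree_mapDomain_eq {ι ι' : Type} (j : ι → ι') (μ : ι →₀ ℕ) :
    (μ.mapDomain j).degree = μ.degree := by
  simp only [Finsupp.degree_eq_weight_one, Finsupp.weight_apply]
  rw [Finsupp.sum_mapDomain_index] <;> simp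

theorem wordWeight_comp {ι ι' : Type} (j : ι → ι') (i : Fin d → ι) :
    wordWeight (j ∘ i) = (wordWeight i).mapDomain j := by
  simp [wordWeight, Finsupp.mapDomain_finsetSum, Finsupp.mapDomain_single]

theorem wordWeight_ne_zero {ι : Type} (i : Fin d → ι) (s : Fin d) : wordWeight i (i s) ≠ 0 := by
  rw [wordWeight, Finsupp.finsetSum_apply]
  intro h
  have := (Finset.sum_eq_zero_iff.1 h) s (Finset.mem_univ s)
  simp at this

theorem gamComp_tprod {U V W : CliffMod k r} {f : Fin d → CHom V W} {g : Fin d → CHom U V}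
    (hf : ∀ i, pr k 0 (f i) = f i) (hg : ∀ i, pr k 0 (g i) = g i) :
    tbilin (cliffComp U V W) d (PiTensorProduct.tprod k f) (PiTensorProduct.tprod k g) =
      PiTensorProduct.tprod k fun i => cliffComp U V W (f i) (g i) := by
  rw [tbilin_tprod _ (φ := fun _ => 0) (ε := fun _ => 0) hf hg]
  simp [charge, koszul_zero]

/-- The `d`-th power of an even homomorphism, as a morphism of `Γ^d(smod 𝒞_r)`. -/
def gamPow {V W : CliffMod k r} (f : CHom V W) (hf : pr k 0 f = f) (d : ℕ) :
    Gam k (CHom V W) d :=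
  ⟨PiTensorProduct.tprod k fun _ => f, fun σ => tperm_tprod_even σ fun _ => hf⟩

theorem weightIdem_conj {V V' : CliffMod k r} {ι ι' : Type} [Fintype ι] [Fintype ι']
    (e : ι → CHom V V) (he : ∀ i, pr k 0 (e i) = e i)
    (e' : ι' → CHom V' V') (he' : ∀ i, pr k 0 (e' i) = e' i) {j : ι → ι'}
    (hj : Function.Injective j) (a : CHom V V') (ha : pr k 0 a = a) (b : CHom V' V)
    (hb : pr k 0 b = b)
    (h : ∀ i, cliffComp V' V V' (cliffComp V V V' a (e i)) b = e' (j i)) (μ : ι →₀ ℕ) :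
    gamComp (gamComp (gamPow a ha d) (weightIdem e he d μ)) (gamPow b hb d) =
      weightIdem e' he' d (μ.mapDomain j) := by
  classical
  refine Subtype.ext ?_
  change tbilin (cliffComp V' V V') d (tbilin (cliffComp V V V') d
    (PiTensorProduct.tprod k fun _ => a)
    (∑ i : Fin d → ι with wordWeight i = μ, PiTensorProduct.tprod k fun s => e (i s)))
    (PiTensorProduct.tprod k fun _ => b) =
    ∑ i : Fin d → ι' with wordWeight i = μ.mapDomain j, PiTensorProduct.tprod k fun s => e' (i s)
  have hae : ∀ i, pr k 0 (cliffComp V V V' a (e i)) = cliffComp V V V' a (e i) :=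
    fun i => isEvenBilin_cliffComp V V V' 0 0 a (e i) ha (he i)
  rw [map_sum, map_sum, LinearMap.sum_apply]
  refine Finset.sum_bij (fun i _ => j ∘ i) ?_ ?_ ?_ ?_
  · intro i hi
    simp only [Finset.mem_filter, Finset.mem_univ, true_and] at hi ⊢
    rw [wordWeight_comp, hi]
  · intro i _ i' _ hii
    funext s
    exact hj (congrFun hii s)
  · intro i' hi'
    simp only [Finset.mem_filter, Finset.mem_univ, true_and] at hi'
    have hr : ∀ s, ∃ i, j i = i' s := by
      intro s
      by_contra hn
      have := wordWeight_ne_zero i' s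
      rw [hi'] at this
      exact this (Finsupp.mapDomain_of_notMem_range _ _ (fun ⟨i, hi⟩ => hn ⟨i, hi⟩))
    choose i hi using hr
    have hi2 : j ∘ i = i' := funext hi
    refine ⟨i, ?_, hi2⟩
    simp only [Finset.mem_filter, Finset.mem_univ, true_and]
    rw [← hi2, wordWeight_comp] at hi'
    exact Finsupp.mapDomain_injective hj hi'
  · intro i _
    rw [gamComp_tprod (fun _ => ha) (fun _ => he _), gamComp_tprod (fun _ => hae _) (fun _ => hb)]
    simp only [h, Function.comp_apply]

theorem finrank_range_conj {A B : Type u} [AddCommGroup A] [Module k A] [AddCommGroup B]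
    [Module k B] (f : A →ₗ[k] B) (g : B →ₗ[k] A) (h : g ∘ₗ f = LinearMap.id) (e : A →ₗ[k] A) :
    Module.finrank k (LinearMap.range ((f ∘ₗ e) ∘ₗ g)) = Module.finrank k (LinearMap.range e) := by
  have h1 : Function.LeftInverse g f := fun x => LinearMap.congr_fun h x
  rw [LinearMap.range_comp_of_range_eq_top _ (LinearMap.range_eq_top.2 h1.surjective),
    LinearMap.range_comp]
  exact (Submodule.equivMapOfInjective f h1.injective _).finrank_eq.symm

theorem killCompl_formalCh (T : PolFunctor k r d) {V V' : CliffMod k r} {ι ι' : Type} [Fintype ι]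
    [Fintype ι'] [DecidableEq ι] [DecidableEq ι']
    (e : ι → CHom V V) (he : ∀ i, pr k 0 (e i) = e i)
    (e' : ι' → CHom V' V') (he' : ∀ i, pr k 0 (e' i) = e' i) {j : ι → ι'}
    (hj : Function.Injective j) (a : CHom V V') (ha : pr k 0 a = a) (b : CHom V' V)
    (hb : pr k 0 b = b) (hba : cliffComp V V' V b a = cliffId V)
    (h : ∀ i, cliffComp V' V V' (cliffComp V V V' a (e i)) b = e' (j i)) :
    MvPolynomial.killCompl hj (formalCh e' he' (T.ev V')) = formalCh e he (T.ev V) := by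
  ext μ
  rw [MvPolynomial.coeff_killCompl, coeff_formalCh, coeff_formalCh, degree_mapDomain_eq]
  congr 2
  change Module.finrank k (LinearMap.range (T.map V' V' (weightIdem e' he' d (μ.mapDomain j)))) =
    Module.finrank k (LinearMap.range (T.map V V (weightIdem e he d μ)))
  rw [← weightIdem_conj e he e' he' hj a ha b hb h, T.map_comp, T.map_comp]
  refine finrank_range_conj _ _ ?_ _
  rw [← T.map_comp, ← T.map_id]
  congr 1
  refine Subtype.ext ?_
  change tbilin (cliffComp V V' V) d (PiTensorProduct.tprod k fun _ => b)
    (PiTensorProduct.tprod k fun _ => a) = PiTensorProduct.tprod k fun _ => cliffId V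
  rw [gamComp_tprod (fun _ => hb) (fun _ => ha), hba]

end Characters

/-! ### Inverse limits and characters of polynomial superfunctors -/

section Limits

variable {k : Type u} [Field k] {d : ℕ}

theorem pr_zero_of_comm {M N : Type u} [AddCommGroup M] [Module k M] [SuperSpace k M]
    [AddCommGroup N] [Module k N] [SuperSpace k N] (f : M →ₗ[k] N)
    (h : ∀ ε v, f (pr k ε v) = pr k ε (f v)) : pr k 0 f = f := by
  refine LinearMap.ext fun v => ?_
  rw [pr_hom_apply]
  simp only [zero_add, h, pr_self]
  exact sum_pr (f v)

theorem funLeft_even {ι ι' : Type} (p : ι → ZMod 2) (p' : ι' → ZMod 2) (j : ι → ι')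
    (hp : ∀ i, p' (j i) = p i) :
    let _ := piSuperSpace k p
    let _ := piSuperSpace k p'
    pr k 0 (LinearMap.funLeft k k j) = LinearMap.funLeft k k j := by
  let _ := piSuperSpace k p
  let _ := piSuperSpace k p'
  refine pr_zero_of_comm _ fun ε v => ?_
  funext i
  rw [LinearMap.funLeft_apply, piSuperSpace_apply, piSuperSpace_apply, hp, LinearMap.funLeft_apply]

theorem extend_even {ι ι' : Type} (p : ι → ZMod 2) (p' : ι' → ZMod 2) {j : ι → ι'}
    (hj : Function.Injective j) (hp : ∀ i, p' (j i) = p i) :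
    let _ := piSuperSpace k p
    let _ := piSuperSpace k p'
    pr k 0 (Function.ExtendByZero.linearMap k j) = Function.ExtendByZero.linearMap k j := by
  let _ := piSuperSpace k p
  let _ := piSuperSpace k p'
  refine pr_zero_of_comm _ fun ε v => ?_
  funext i'
  rw [piSuperSpace_apply]
  change Function.extend j (SuperSpace.proj ε v) 0 i' = if p' i' = ε then Function.extend j v 0 i' else 0
  by_cases h : ∃ i, j i = i'
  · obtain ⟨i, rfl⟩ := h
    rw [hj.extend_apply, hj.extend_apply, piSuperSpace_apply, hp]
  · rw [Function.extend_apply' _ _ _ h, Function.extend_apply' _ _ _ h]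
    simp

theorem funLeft_extend {ι ι' : Type} {j : ι → ι'} (hj : Function.Injective j) :
    LinearMap.funLeft k k j ∘ₗ Function.ExtendByZero.linearMap k j = LinearMap.id := by
  refine LinearMap.ext fun v => funext fun i => ?_
  exact hj.extend_apply v 0 i

theorem extend_matUnit_funLeft {ι ι' : Type} [DecidableEq ι] [DecidableEq ι'] {j : ι → ι'}
    (hj : Function.Injective j) (i : ι) :
    (Function.ExtendByZero.linearMap k j ∘ₗ matUnit k i) ∘ₗ LinearMap.funLeft k k j =
      matUnit k (j i) := by
  refine LinearMap.ext fun v => funext fun i' => ?_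
  change Function.extend j (Pi.single i (v (j i))) 0 i' = (Pi.single (j i) (v (j i)) : ι' → k) i'
  by_cases h : ∃ i, j i = i'
  · obtain ⟨i₂, rfl⟩ := h
    rw [hj.extend_apply, Pi.single_apply, Pi.single_apply]
    simp [hj.eq_iff]
  · rw [Function.extend_apply' _ _ _ h, Pi.single_apply, if_neg fun e => h ⟨i, e.symm⟩]
    rfl

/-- The variables `x_1, …, x_n` among `x_1, …, x_n'`. -/
abbrev jX {n n' : ℕ} (h : n ≤ n') : Fin n → Fin n' := Fin.castLE h

/-- The variables `x_1, …, x_m, y_1, …, y_n` among `x_1, …, x_m', y_1, …, y_n'`. -/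
abbrev jZ {m m' n n' : ℕ} (hm : m ≤ m') (hn : n ≤ n') : Fin m ⊕ Fin n → Fin m' ⊕ Fin n' :=
  Sum.map (Fin.castLE hm) (Fin.castLE hn)

theorem jX_injective {n n' : ℕ} (h : n ≤ n') : Function.Injective (jX h) := Fin.castLE_injective h

theorem jZ_injective {m m' n n' : ℕ} (hm : m ≤ m') (hn : n ≤ n') :
    Function.Injective (jZ hm hn) :=
  (Fin.castLE_injective hm).sumMap (Fin.castLE_injective hn)

theorem parity_jZ {m m' n n' : ℕ} (hm : m ≤ m') (hn : n ≤ n') (i : Fin m ⊕ Fin n) :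
    parity m' n' (jZ hm hn i) = parity m n i := by
  rcases i with i | i <;> rfl

/-- The inverse limit over `n` of the groups of homogeneous polynomials of degree `d` in
`x_1, …, x_n`, with respect to the maps setting the additional variables equal to zero. -/
def XLim (d : ℕ) : Type :=
  {f : ∀ n, MvPolynomial (Fin n) ℤ // (∀ n, (f n).IsHomogeneous d) ∧
    ∀ (n n' : ℕ) (h : n ≤ n'), MvPolynomial.killCompl (jX_injective h) (f n') = f n}

/-- The inverse limit over `m` and `n` of the groups of homogeneous polynomials of degree `d` in
`x_1, …, x_m` and `y_1, …, y_n`, with respect to the maps setting the additional variables equal to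
zero. -/
def ZLim (d : ℕ) : Type :=
  {f : ∀ m n, MvPolynomial (Fin m ⊕ Fin n) ℤ // (∀ m n, (f m n).IsHomogeneous d) ∧
    ∀ (m m' n n' : ℕ) (hm : m ≤ m') (hn : n ≤ n'),
      MvPolynomial.killCompl (jZ_injective hm hn) (f m' n') = f m n}

theorem killCompl_chS (T : PolFunctor k 0 d) {m m' n n' : ℕ} (hm : m ≤ m') (hn : n ≤ n') :
    MvPolynomial.killCompl (jZ_injective hm hn) (chS (T.ev (kmn k m' n'))) =
      chS (T.ev (kmn k m n)) := by
  have hp := parity_jZ hm hn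
  refine killCompl_formalCh T (unitS k) pr_unitS (unitS k) pr_unitS (jZ_injective hm hn)
    ⟨Function.ExtendByZero.linearMap k (jZ hm hn), fun i => i.elim0⟩
    (Subtype.ext (extend_even (parity m n) (parity m' n') (jZ_injective hm hn) hp))
    ⟨LinearMap.funLeft k k (jZ hm hn), fun i => i.elim0⟩
    (Subtype.ext (funLeft_even (parity m n) (parity m' n') (jZ hm hn) hp))
    (Subtype.ext (funLeft_extend (jZ_injective hm hn)))
    fun i => Subtype.ext (extend_matUnit_funLeft (jZ_injective hm hn) i)

theorem extend_swap {n n' : ℕ} (h : n ≤ n') (v : Fin n ⊕ Fin n → k) :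
    Function.ExtendByZero.linearMap k (jZ h h) (LinearMap.funLeft k k Sum.swap v) =
      LinearMap.funLeft k k Sum.swap (Function.ExtendByZero.linearMap k (jZ h h) v) := by
  have hj := jZ_injective h h
  have hs : ∀ i, (jZ h h i).swap = jZ h h i.swap := fun i => by rcases i with i | i <;> rfl
  funext i'
  change Function.extend (jZ h h) (fun i => v i.swap) 0 i' =
    Function.extend (jZ h h) v 0 i'.swap
  by_cases hi : ∃ i, jZ h h i = i'
  · obtain ⟨i, rfl⟩ := hi
    rw [hj.extend_apply, hs, hj.extend_apply]
  · rw [Function.extend_apply' _ _ _ hi, Function.extend_apply' _ _ _]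
    · rfl
    · rintro ⟨i, hi'⟩
      exact hi ⟨i.swap, by rw [← hs, hi', Sum.swap_swap]⟩

theorem killCompl_chQ (T : PolFunctor k 1 d) {n n' : ℕ} (h : n ≤ n') :
    MvPolynomial.killCompl (jX_injective h) (chQ (T.ev (Vn k n'))) = chQ (T.ev (Vn k n)) := by
  have hp := parity_jZ h h
  have hj := jZ_injective h h
  refine killCompl_formalCh T (unitQ k) pr_unitQ (unitQ k) pr_unitQ (jX_injective h)
    ⟨Function.ExtendByZero.linearMap k (jZ h h), fun _ v => extend_swap h v⟩
    (Subtype.ext (extend_even (parity n n) (parity n' n') hj hp))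
    ⟨LinearMap.funLeft k k (jZ h h), fun _ v => ?_⟩
    (Subtype.ext (funLeft_even (parity n n) (parity n' n') (jZ h h) hp))
    (Subtype.ext (funLeft_extend hj))
    fun i => Subtype.ext ?_
  · refine funext fun i => ?_
    rcases i with i | i <;> rfl
  · change (Function.ExtendByZero.linearMap k (jZ h h) ∘ₗ
      (matUnit k (Sum.inl i) + matUnit k (Sum.inr i))) ∘ₗ LinearMap.funLeft k k (jZ h h) =
      matUnit k (Sum.inl (jX h i)) + matUnit k (Sum.inr (jX h i))
    rw [LinearMap.comp_add, LinearMap.add_comp]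
    exact congrArg₂ (· + ·) (extend_matUnit_funLeft hj (Sum.inl i))
      (extend_matUnit_funLeft hj (Sum.inr i))

/-- The formal character of a polynomial superfunctor of type I: the family of the formal
characters of the `S(m|n,d)`-supermodules `T(k^(m|n))`. -/
def chI (T : PolFunctor k 0 d) : ZLim d :=
  ⟨fun m n => chS (T.ev (kmn k m n)), fun _ _ => isHomogeneous_formalCh _ _ _,
    fun _ _ _ _ hm hn => killCompl_chS T hm hn⟩

/-- The formal character of a polynomial superfunctor of type II: the family of the formal
characters of the `Q(n,d)`-supermodules `T(V_n)`. -/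
def chII (T : PolFunctor k 1 d) : XLim d :=
  ⟨fun n => chQ (T.ev (Vn k n)), fun _ => isHomogeneous_formalCh _ _ _,
    fun _ _ h => killCompl_chQ T h⟩

end Limits

/-! ### Schur functions, hook Schur functions and Hall–Littlewood symmetric functions -/

section SymmetricFunctions

/-- The fillings of the skew diagram `λ/μ` by elements of `{1, …, n}` which weakly increase along
rows and strictly increase down columns.  (Boxes are pairs (row, column).) -/
def IsSemistandard (lam mu : YoungDiagram) {n : ℕ} (T : ↥(lam.cells \ mu.cells) → Fin n) : Prop :=
  (∀ b c, b.1.1 = c.1.1 → b.1.2 < c.1.2 → T b ≤ T c) ∧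
    ∀ b c, b.1.2 = c.1.2 → b.1.1 < c.1.1 → T b < T c

open scoped Classical in
/-- The skew Schur function `s_(λ/μ)(x_1, …, x_n)`, for `μ ⊆ λ`. -/
def skewSchur (lam mu : YoungDiagram) (n : ℕ) : MvPolynomial (Fin n) ℤ :=
  ∑ T : ↥(lam.cells \ mu.cells) → Fin n with IsSemistandard lam mu T, ∏ b, MvPolynomial.X (T b)

/-- The Schur function `s_μ(x_1, …, x_n)`. -/
def schur (mu : YoungDiagram) (n : ℕ) : MvPolynomial (Fin n) ℤ := skewSchur mu ⊥ n

theorem finite_subdiagrams (lam : YoungDiagram) : (Set.Iic lam).Finite := by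
  refine Set.Finite.of_injOn (f := YoungDiagram.cells) (t := ↑lam.cells.powerset) ?_ ?_
    (Finset.finite_toSet _)
  · intro mu h
    exact Finset.mem_coe.2 (Finset.mem_powerset.2 h)
  · intro mu _ nu _ h
    exact YoungDiagram.ext h

/-- The partitions `μ ⊆ λ`. -/
def subdiagrams (lam : YoungDiagram) : Finset YoungDiagram := (finite_subdiagrams lam).toFinset

/-- The hook Schur function
`hs_λ(x_1, …, x_m; y_1, …, y_n) = ∑_{μ ⊆ λ} s_μ(x_1, …, x_m) s_(λ'/μ')(y_1, …, y_n)`. -/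
def hookSchur (lam : YoungDiagram) (m n : ℕ) : MvPolynomial (Fin m ⊕ Fin n) ℤ :=
  ∑ mu ∈ subdiagrams lam, MvPolynomial.rename Sum.inl (schur mu m) *
    MvPolynomial.rename Sum.inr (skewSchur lam.transpose mu.transpose n)

/-- The Hall–Littlewood symmetric function
`S_λ(x_1, …, x_n) = hs_λ(x_1, …, x_n; x_1, …, x_n)`. -/
def hallLittlewood (lam : YoungDiagram) (n : ℕ) : MvPolynomial (Fin n) ℤ :=
  MvPolynomial.rename (Sum.elim id id) (hookSchur lam n n)

theorem isHomogeneous_skewSchur (lam mu : YoungDiagram) (n : ℕ) :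
    (skewSchur lam mu n).IsHomogeneous (lam.cells \ mu.cells).card := by
  refine MvPolynomial.IsHomogeneous.sum _ _ _ fun T _ => ?_
  have := MvPolynomial.IsHomogeneous.prod Finset.univ (fun b => MvPolynomial.X (R := ℤ) (T b))
    (fun _ => 1) fun b _ => MvPolynomial.isHomogeneous_X ℤ (T b)
  simpa using this

theorem card_transpose (lam : YoungDiagram) : lam.transpose.card = lam.card := by
  refine Finset.card_bij (fun c _ => c.swap) ?_ ?_ ?_
  · intro c hc
    exact (YoungDiagram.mem_transpose).1 hc
  · intro c _ c' _ h
    exact Prod.swap_injective h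
  · intro c hc
    exact ⟨c.swap, YoungDiagram.mem_transpose.2 (by simpa using hc), Prod.swap_swap c⟩

theorem isHomogeneous_hookSchur (lam : YoungDiagram) (m n : ℕ) :
    (hookSchur lam m n).IsHomogeneous lam.card := by
  refine MvPolynomial.IsHomogeneous.sum _ _ _ fun mu hmu => ?_
  have hle : mu ≤ lam := by simpa [subdiagrams] using hmu
  have h1 := (isHomogeneous_skewSchur mu ⊥ m).rename_isHomogeneous (f := (Sum.inl : _ → Fin m ⊕ Fin n))
  have h2 := (isHomogeneous_skewSchur lam.transpose mu.transpose n).rename_isHomogeneous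
    (f := (Sum.inr : _ → Fin m ⊕ Fin n))
  have h3 : (mu.cells \ (⊥ : YoungDiagram).cells).card +
      (lam.transpose.cells \ mu.transpose.cells).card = lam.card := by
    have e1 : (lam.transpose.cells \ mu.transpose.cells).card = lam.card - mu.card := by
      rw [Finset.card_sdiff_of_subset (YoungDiagram.transpose_le_iff.2 hle)]
      exact congrArg₂ (· - ·) (card_transpose lam) (card_transpose mu)
    have e2 : mu.card ≤ lam.card := Finset.card_le_card hle
    rw [e1, YoungDiagram.cells_bot, Finset.sdiff_empty]
    exact Nat.add_sub_cancel' e2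
  rw [← h3]
  exact h1.mul h2

theorem isHomogeneous_hallLittlewood (lam : YoungDiagram) (n : ℕ) :
    (hallLittlewood lam n).IsHomogeneous lam.card :=
  (isHomogeneous_hookSchur lam n n).rename_isHomogeneous

theorem killCompl_X_range {ι ι' : Type} {j : ι → ι'} (hj : Function.Injective j) (i : ι) :
    MvPolynomial.killCompl hj (MvPolynomial.X (R := ℤ) (j i)) = MvPolynomial.X i := by
  rw [← MvPolynomial.rename_X, MvPolynomial.killCompl_rename_app]

theorem killCompl_X_notMem {ι ι' : Type} {j : ι → ι'} (hj : Function.Injective j) {i' : ι'}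
    (h : i' ∉ Set.range j) :
    MvPolynomial.killCompl hj (MvPolynomial.X (R := ℤ) i') = 0 := by
  classical
  rw [MvPolynomial.killCompl, MvPolynomial.aeval_X, dif_neg h]

theorem killCompl_skewSchur (lam mu : YoungDiagram) {n n' : ℕ} (h : n ≤ n') :
    MvPolynomial.killCompl (jX_injective h) (skewSchur lam mu n') = skewSchur lam mu n := by
  classical
  rw [skewSchur, skewSchur, map_sum]
  symm
  refine Finset.sum_of_injOn (fun T => jX h ∘ T) ?_ ?_ ?_ ?_
  · intro T _ T' _ hT
    funext b
    exact jX_injective h (congrFun hT b)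
  · intro T hT
    simp only [Finset.coe_filter, Finset.mem_univ, true_and, Set.mem_ofPred_eq] at hT ⊢
    exact hT
  · intro T hT hT'
    have : ∃ b, T b ∉ Set.range (jX h) := by
      by_contra hcon
      push Not at hcon
      choose T₀ hT₀ using hcon
      have e : jX h ∘ T₀ = T := funext hT₀
      refine hT' ⟨T₀, ?_, e⟩
      simp only [Finset.mem_filter, Finset.mem_univ, true_and, Finset.coe_filter,
        Set.mem_ofPred_eq] at hT ⊢
      rw [← e] at hT
      exact hT
    obtain ⟨b, hb⟩ := this
    rw [map_prod]
    exact Finset.prod_eq_zero (Finset.mem_univ b) (killCompl_X_notMem _ hb)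
  · intro T _
    rw [map_prod]
    exact Finset.prod_congr rfl fun b _ => (killCompl_X_range (jX_injective h) (T b)).symm

theorem killCompl_rename {ι ι' κ κ' : Type} {j : ι → ι'} (hj : Function.Injective j) {l : κ → κ'}
    (hl : Function.Injective l) (f : ι → κ) (f' : ι' → κ') (h : ∀ i, f' (j i) = l (f i))
    (h' : ∀ i', i' ∉ Set.range j → f' i' ∉ Set.range l) (p : MvPolynomial ι' ℤ) :
    MvPolynomial.killCompl hl (MvPolynomial.rename f' p) =
      MvPolynomial.rename f (MvPolynomial.killCompl hj p) := by
  refine AlgHom.congr_fun (φ₁ := (MvPolynomial.killCompl hl).comp (MvPolynomial.rename f'))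
    (φ₂ := (MvPolynomial.rename f).comp (MvPolynomial.killCompl hj))
    (MvPolynomial.algHom_ext fun i' => ?_) p
  rw [AlgHom.comp_apply, AlgHom.comp_apply, MvPolynomial.rename_X]
  by_cases hi : i' ∈ Set.range j
  · obtain ⟨i, rfl⟩ := hi
    rw [h, killCompl_X_range, killCompl_X_range, MvPolynomial.rename_X]
  · rw [killCompl_X_notMem hj hi, killCompl_X_notMem hl (h' _ hi), map_zero]

theorem killCompl_hookSchur (lam : YoungDiagram) {m m' n n' : ℕ} (hm : m ≤ m') (hn : n ≤ n') :
    MvPolynomial.killCompl (jZ_injective hm hn) (hookSchur lam m' n') = hookSchur lam m n := by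
  rw [hookSchur, hookSchur, map_sum]
  refine Finset.sum_congr rfl fun mu _ => ?_
  rw [map_mul, killCompl_rename (jX_injective hm) (jZ_injective hm hn) Sum.inl Sum.inl
    (fun _ => rfl), killCompl_rename (jX_injective hn) (jZ_injective hm hn) Sum.inr Sum.inr
    (fun _ => rfl), schur, killCompl_skewSchur, killCompl_skewSchur, schur]
  · rintro i' hi' ⟨i | i, hi⟩
    · cases hi
    · exact hi' ⟨i, Sum.inr_injective hi⟩
  · rintro i' hi' ⟨i | i, hi⟩
    · exact hi' ⟨i, Sum.inl_injective hi⟩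
    · cases hi

theorem killCompl_hallLittlewood (lam : YoungDiagram) {n n' : ℕ} (h : n ≤ n') :
    MvPolynomial.killCompl (jX_injective h) (hallLittlewood lam n') = hallLittlewood lam n := by
  rw [hallLittlewood, hallLittlewood, killCompl_rename (jZ_injective h h) (jX_injective h)
    (Sum.elim id id), killCompl_hookSchur]
  · rintro (i | i) <;> rfl
  · rintro (i' | i') hi' ⟨i, hi⟩
    · exact hi' ⟨Sum.inl i, congrArg Sum.inl hi⟩
    · exact hi' ⟨Sum.inr i, congrArg Sum.inr hi⟩

/-- The hook Schur function `hs_λ(x; y)` in infinitely many variables, the inverse limit of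
the polynomials `hs_λ(x_1, …, x_m; y_1, …, y_n)`. -/
def hsLim (lam : YoungDiagram) : ZLim lam.card :=
  ⟨hookSchur lam, isHomogeneous_hookSchur lam, fun _ _ _ _ hm hn => killCompl_hookSchur lam hm hn⟩

/-- The Hall–Littlewood symmetric function `S_λ(x)` in infinitely many variables, the inverse limit
of the polynomials `S_λ(x_1, …, x_n)`. -/
def hallLittlewoodLim (lam : YoungDiagram) : XLim lam.card :=
  ⟨hallLittlewood lam, isHomogeneous_hallLittlewood lam,
    fun _ _ h => killCompl_hallLittlewood lam h⟩

end SymmetricFunctions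

end SchurSuper

end

noncomputable section

namespace SchurSuper

universe u

/-! Let M be a superspace with a homogeneous basis whose letters are ranked injectively. Words in
the letters form a basis of the tensor power, and permutations act on them up to sign. The parity
change twists the action by the sign character, so the Schur superfunctor evaluated at M is the
image, in the coinvariants of the row group, of the tensors that alternate along columns
(`schurSub_eq_map`). A weight idempotent projects onto the span of the words of one weight. The
theorem therefore reduces to two facts: the dimension of such a weight space is the number of
semistandard words of that weight (`finrank_map_schurSub`), and the hook Schur function enumerates
semistandard words (`hookSchur_eq_sum`). Both types use the same count; for type II the weight
merely identifies each letter x_i with y_i.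

The dimension is found by pairing semistandard words T with one another. The functional `rowCoeff`
of T reads the coefficient of the row class of T, and `altSum` antisymmetrizes T along columns.
Stabilizer orders may vanish in the field, so all symmetrizations count each distinct translate once
(`orbitSum`). The ordering parameter is `energy`, the sum of rank times row number, which row
permutations do not change.

Lower bound: by the rearrangement inequality a semistandard word has the greatest energy among its
column permutations, and is the only one attaining it (`IsStd.energy_comp_le`). Hence the matrix of
the functionals `rowCoeff` on the tensors `altSum` is unitriangular.

Upper bound: functionals on the coinvariants are the row-invariant functionals on tensors. A sorted
word that is not semistandard has two adjacent boxes of a column out of order; symmetrizing over the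
Garnir set of these boxes, then over rows, gives a row-invariant functional that vanishes on
column-alternating tensors by the pigeonhole principle and is unitriangular for the energy
(`exists_garnir`). Together with the functionals `rowCoeff`, these control every row-invariant
functional (`invariant_apply_eq_zero`). Both here and for words repeating an odd letter in a row, a
value equals its own negative, and this is where characteristic different from 2 enters. -/

/-! ### Sign exponents of permutations of homogeneous vectors. -/

/-- Gathers ordered pairs into unordered ones; needed because reindexing by a permutation does not
keep the order inside a pair. -/
theorem sum_sum_eq_sum_lt {d : ℕ} (f : Fin d → Fin d → ZMod 2) (hf : ∀ s, f s s = 0) :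
    ∑ s, ∑ t, f s t = ∑ s, ∑ t, if s < t then f s t + f t s else 0 := by
  have h : ∀ s t, f s t = (if s < t then f s t else 0) + if t < s then f s t else 0 := by
    intro s t
    rcases lt_trichotomy s t with h | rfl | h
    · simp [h, h.not_gt]
    · simp [hf]
    · simp [h, h.not_gt]
  calc ∑ s, ∑ t, f s t
      = ∑ s, ∑ t, ((if s < t then f s t else 0) + if t < s then f s t else 0) :=
        Finset.sum_congr rfl fun s _ => Finset.sum_congr rfl fun t _ => h s t
    _ = ∑ s, ∑ t, (if s < t then f s t else 0) + ∑ s, ∑ t, if s < t then f t s else 0 := by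
        simp only [Finset.sum_add_distrib]
        rw [Finset.sum_comm (f := fun s t => if t < s then f s t else 0)]
    _ = _ := by
        simp only [← Finset.sum_add_distrib]
        refine Finset.sum_congr rfl fun s _ => Finset.sum_congr rfl fun t _ => ?_
        split_ifs <;> simp

/-- A pair is inverted by the product exactly when one of the two factors, but not both, inverts it;
pairs inverted twice contribute twice and cancel mod 2. This cocycle identity makes the signed
permutations of tensors an action. -/
theorem invCharge_mul {d : ℕ} (ε : Fin d → ZMod 2) (τ σ : Equiv.Perm (Fin d)) :
    invCharge ε (τ * σ) = invCharge ε τ + invCharge (ε ∘ τ) σ := by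
  have h1 : invCharge (ε ∘ τ) σ = ∑ s, ∑ t, if τ.symm s < τ.symm t ∧
      σ.symm (τ.symm t) < σ.symm (τ.symm s) then ε s * ε t else 0 := by
    rw [invCharge, ← Equiv.sum_comp τ (fun s => ∑ t, if τ.symm s < τ.symm t ∧
      σ.symm (τ.symm t) < σ.symm (τ.symm s) then ε s * ε t else 0)]
    refine Finset.sum_congr rfl fun s _ => ?_
    rw [← Equiv.sum_comp τ (fun t => if τ.symm (τ s) < τ.symm t ∧
      σ.symm (τ.symm t) < σ.symm (τ.symm (τ s)) then ε (τ s) * ε t else 0)]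
    simp
  have h2 : ∀ s, (τ * σ).symm s = σ.symm (τ.symm s) := fun _ => rfl
  rw [h1, sum_sum_eq_sum_lt _ (fun s => by simp)]
  simp only [invCharge, ← Finset.sum_add_distrib, h2]
  refine Finset.sum_congr rfl fun s _ => Finset.sum_congr rfl fun t _ => ?_
  have e : ∀ a : ZMod 2, a + a = 0 := CharTwo.add_self_eq_zero
  by_cases h : s < t
  · have n1 : τ.symm s ≠ τ.symm t := fun h' => h.ne (τ.symm.injective h')
    have n2 : σ.symm (τ.symm s) ≠ σ.symm (τ.symm t) := fun h' => n1 (σ.symm.injective h')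
    rcases lt_or_gt_of_ne n1 with h' | h' <;> rcases lt_or_gt_of_ne n2 with h'' | h'' <;>
      simp [h, h', h'', h'.not_gt, h''.not_gt, mul_comm (ε t), e]
  · simp [h]

theorem invCharge_one {d : ℕ} (ε : Fin d → ZMod 2) : invCharge ε 1 = 0 := by
  refine Finset.sum_eq_zero fun s _ => Finset.sum_eq_zero fun t _ => if_neg fun h => ?_
  exact h.1.not_gt h.2

/-- A permutation fixing the positions of the odd vectors produces no sign. -/
theorem invCharge_eq_zero {d : ℕ} {ε : Fin d → ZMod 2} {σ : Equiv.Perm (Fin d)}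
    (h : ∀ s, ε s ≠ 0 → σ s = s) : invCharge ε σ = 0 := by
  refine Finset.sum_eq_zero fun s _ => Finset.sum_eq_zero fun t _ => ?_
  split_ifs with hst
  · by_contra hne
    have hs : σ.symm s = s := by rw [Equiv.symm_apply_eq, h s (left_ne_zero_of_mul hne)]
    have ht : σ.symm t = t := by rw [Equiv.symm_apply_eq, h t (right_ne_zero_of_mul hne)]
    rw [hs, ht] at hst
    exact hst.1.not_gt hst.2
  · rfl

/-- The transposition of two odd vectors produces a sign. -/
theorem invCharge_swap {d : ℕ} {ε : Fin d → ZMod 2} {p q : Fin d} (hpq : p ≠ q) (hp : ε p = 1)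
    (hq : ε q = 1) : invCharge ε (Equiv.swap p q) = 1 := by
  wlog h : p < q generalizing p q
  · rw [Equiv.swap_comm]
    exact this hpq.symm hq hp (lt_of_le_of_ne (not_lt.1 h) hpq.symm)
  -- The inverted pairs are (p, q) itself, and (p, t) and (s, q) with t, s strictly between. Each
  -- intermediate position occurs once with p and once with q, so only (p, q) survives mod 2.
  have key : ∀ s t, (if s < t ∧ (Equiv.swap p q).symm t < (Equiv.swap p q).symm s
      then ε s * ε t else 0) = (if s = p then if t = q then 1 else 0 else 0) +
      ((if s = p then if p < t ∧ t < q then ε t else 0 else 0) +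
      if t = q then if p < s ∧ s < q then ε s else 0 else 0) := by
    intro s t
    rw [Equiv.symm_swap, Equiv.swap_apply_def, Equiv.swap_apply_def]
    by_cases h1 : s = p <;> by_cases h2 : s = q <;> by_cases h3 : t = p <;> by_cases h4 : t = q
    all_goals simp_all
    all_goals try grind
  simp only [invCharge, key, Finset.sum_add_distrib]
  rw [Finset.sum_comm (f := fun s t => if t = q then if p < s ∧ s < q then ε s else 0 else 0)]
  have e : ∀ a : ZMod 2, 1 + (a + a) = 1 := by decide
  simp [Finset.sum_ite_eq', e]

/-! ### The right action on the basis of words. -/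

section Basis

variable {k : Type u} [Field k] {M : Type u} [AddCommGroup M] [Module k M] [SuperSpace k M] {d : ℕ}

theorem tperm_tperm (σ τ : Equiv.Perm (Fin d)) (x : TPow k M d) :
    tperm σ (tperm τ x) = tperm (τ * σ) x := by
  refine LinearMap.congr_fun (f := tperm σ ∘ₗ tperm τ) (g := tperm (τ * σ))
    (homog_ext fun ε v h => ?_) x
  have h' : ∀ i, pr k ((ε ∘ τ) i) ((v ∘ τ) i) = (v ∘ τ) i := fun i => h (τ i)
  rw [LinearMap.comp_apply, tperm_tprod τ h, map_smul, tperm_tprod σ h', tperm_tprod (τ * σ) h,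
    smul_smul, ← koszul_add, invCharge_mul]
  rfl

theorem tperm_one (x : TPow k M d) : tperm 1 x = x := by
  refine LinearMap.congr_fun (f := tperm 1) (g := LinearMap.id) (homog_ext fun ε v h => ?_) x
  rw [tperm_tprod 1 h, invCharge_one, koszul_zero, one_smul]
  rfl

variable {ι : Type} (e : Module.Basis ι k M) {p : ι → ZMod 2}

/-- The basis of `M^{⊗d}` indexed by words. -/
def wordBasis (d : ℕ) : Module.Basis (Fin d → ι) k (TPow k M d) :=
  _root_.Basis.piTensorProduct fun _ => e

theorem wordBasis_apply (w : Fin d → ι) :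
    wordBasis e d w = PiTensorProduct.tprod k fun s => e (w s) :=
  _root_.Basis.piTensorProduct_apply _ _

variable (he : ∀ i, pr k (p i) (e i) = e i)
include he

theorem tperm_wordBasis (σ : Equiv.Perm (Fin d)) (w : Fin d → ι) :
    tperm σ (wordBasis e d w) = koszul k (invCharge (p ∘ w) σ) • wordBasis e d (w ∘ σ) := by
  rw [wordBasis_apply, wordBasis_apply, tperm_tprod σ (ε := p ∘ w) fun s => he (w s)]
  rfl

end Basis

/-! ### Rows, columns, Young subgroups and the sign character. -/

/-- The row of the box with a given number along the rows. -/
def rowOf (lam : YoungDiagram) (s : Fin lam.card) : ℕ := (rowBox lam s).1.1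

/-- The column of the box with a given number along the rows. -/
def colOf (lam : YoungDiagram) (s : Fin lam.card) : ℕ := (rowBox lam s).1.2

/-- The permutations preserving the fibres of a function. -/
def fiberPerms {d : ℕ} {α : Type*} (f : Fin d → α) : Subgroup (Equiv.Perm (Fin d)) where
  carrier := {σ | ∀ s, f (σ s) = f s}
  mul_mem' ha hb s := by rw [Equiv.Perm.mul_apply, ha, hb]
  one_mem' _ := rfl
  inv_mem' {σ} h s := by
    rw [← h, show σ (σ⁻¹ s) = s from σ.apply_symm_apply s]

theorem mem_fiberPerms {d : ℕ} {α : Type*} {f : Fin d → α} {σ : Equiv.Perm (Fin d)} :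
    σ ∈ fiberPerms f ↔ ∀ s, f (σ s) = f s := Iff.rfl

theorem swap_mem_fiberPerms {d : ℕ} {α : Type*} {f : Fin d → α} {a b : Fin d} (h : f a = f b) :
    Equiv.swap a b ∈ fiberPerms f := by
  intro s
  rw [Equiv.swap_apply_def]
  split_ifs with h1 h2
  · rw [h1, h]
  · rw [h2, h]
  · rfl

/-- The sign of a permutation. -/
def psign (k : Type u) [Field k] {d : ℕ} (σ : Equiv.Perm (Fin d)) : k :=
  koszul k (invCharge (fun _ => 1) σ)

section Sign

variable {k : Type u} [Field k] {d : ℕ}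

theorem psign_mul (σ τ : Equiv.Perm (Fin d)) : psign k (σ * τ) = psign k σ * psign k τ := by
  rw [psign, invCharge_mul, koszul_add]
  rfl

theorem psign_one : psign k (1 : Equiv.Perm (Fin d)) = 1 := by
  rw [psign, invCharge_one, koszul_zero]

theorem psign_swap {a b : Fin d} (h : a ≠ b) : psign k (Equiv.swap a b) = -1 := by
  rw [psign, invCharge_swap h rfl rfl]
  simp [koszul]

theorem psign_mul_self (σ : Equiv.Perm (Fin d)) : psign k σ * psign k σ = 1 := koszul_mul_self k _

end Sign

/-! ### Symmetrization without division: sums over distinct translates. -/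

section Orbit

open scoped Classical in
/-- The sum over the finite set of all values of a function on a group of permutations. -/
def orbitSum {X : Type*} [AddCommMonoid X] {d : ℕ} (H : Subgroup (Equiv.Perm (Fin d)))
    (F : Equiv.Perm (Fin d) → X) : X :=
  ∑ x ∈ (Finset.univ.filter (· ∈ H)).image F, x

/-- An injective map carrying the finite set of values into itself permutes that set, hence fixes
its sum. No stabilizer order occurs, so the argument is independent of the characteristic. -/
theorem map_orbitSum {X : Type*} [AddCommGroup X] {d : ℕ} {H : Subgroup (Equiv.Perm (Fin d))}
    {F : Equiv.Perm (Fin d) → X} (g : X →+ X) (hg : Function.Injective g)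
    (h : ∀ σ ∈ H, ∃ τ ∈ H, g (F σ) = F τ) : g (orbitSum H F) = orbitSum H F := by
  classical
  rw [orbitSum, map_sum]
  have hsub : ((Finset.univ.filter (· ∈ H)).image F).image g ⊆
      (Finset.univ.filter (· ∈ H)).image F := by
    intro x hx
    simp only [Finset.mem_image, Finset.mem_filter, Finset.mem_univ, true_and] at hx ⊢
    obtain ⟨_, ⟨σ, hσ, rfl⟩, rfl⟩ := hx
    obtain ⟨τ, hτ, h'⟩ := h σ hσ
    exact ⟨τ, hτ, h'.symm⟩
  have heq := Finset.eq_of_subset_of_card_le hsub (Finset.card_image_of_injective _ hg).ge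
  conv_rhs => rw [← heq]
  rw [Finset.sum_image fun x _ y _ hxy => hg hxy]

variable {k : Type u} [Field k] {X : Type*} [AddCommGroup X] [Module k X] {d : ℕ}
  {H : Subgroup (Equiv.Perm (Fin d))} {F : Equiv.Perm (Fin d) → X}

theorem exists_of_orbitSum_ne_zero (f : X →ₗ[k] k) (h : f (orbitSum H F) ≠ 0) :
    ∃ σ ∈ H, f (F σ) ≠ 0 := by
  classical
  rw [orbitSum, map_sum] at h
  obtain ⟨x, hx, hx'⟩ := Finset.exists_ne_zero_of_sum_ne_zero h
  simp only [Finset.mem_image, Finset.mem_filter, Finset.mem_univ, true_and] at hx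
  obtain ⟨σ, hσ, rfl⟩ := hx
  exact ⟨σ, hσ, hx'⟩

/-- If every value on which `f` is nonzero coincides with the value at the identity, that one value
is counted once and gives coefficient 1 instead of a stabilizer order. -/
theorem orbitSum_apply_eq (f : X →ₗ[k] k) (h : ∀ σ ∈ H, f (F σ) ≠ 0 → F σ = F 1) :
    f (orbitSum H F) = f (F 1) := by
  classical
  rw [orbitSum, map_sum]
  refine Finset.sum_eq_single (F 1) ?_ ?_
  · intro x hx hne
    simp only [Finset.mem_image, Finset.mem_filter, Finset.mem_univ, true_and] at hx
    obtain ⟨σ, hσ, rfl⟩ := hx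
    by_contra hf
    exact hne (h σ hσ hf)
  · intro hn
    refine absurd ?_ hn
    simp only [Finset.mem_image, Finset.mem_filter, Finset.mem_univ, true_and]
    exact ⟨1, H.one_mem, rfl⟩

variable {M : Type u} [AddCommGroup M] [Module k M] [SuperSpace k M]

theorem tperm_inv_tperm (σ : Equiv.Perm (Fin d)) (x : TPow k M d) :
    tperm σ⁻¹ (tperm σ x) = x := by
  rw [tperm_tperm, mul_inv_cancel, tperm_one]

theorem tperm_tperm_inv (σ : Equiv.Perm (Fin d)) (x : TPow k M d) :
    tperm σ (tperm σ⁻¹ x) = x := by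
  rw [tperm_tperm, inv_mul_cancel, tperm_one]

/-- The sum of the translates of a functional under a group of permutations, each translate being
counted once. -/
def avg (H : Subgroup (Equiv.Perm (Fin d))) (f : TPow k M d →ₗ[k] k) : TPow k M d →ₗ[k] k :=
  orbitSum H fun σ => f ∘ₗ tperm σ

/-- Precomposition with an element of `H` is injective and permutes the translates of `f`, by
multiplication on the left since the action is a right action. -/
theorem avg_tperm (f : TPow k M d →ₗ[k] k) {σ : Equiv.Perm (Fin d)} (hσ : σ ∈ H)
    (x : TPow k M d) : avg H f (tperm σ x) = avg H f x := by
  refine LinearMap.congr_fun (map_orbitSum ((tperm σ).lcomp k k).toAddMonoidHom ?_ ?_) x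
  · intro a b hab
    refine LinearMap.ext fun y => ?_
    rw [← tperm_tperm_inv σ y]
    exact LinearMap.congr_fun hab (tperm σ⁻¹ y)
  · intro τ hτ
    refine ⟨σ * τ, H.mul_mem hσ hτ, LinearMap.ext fun y => ?_⟩
    exact congrArg f (tperm_tperm τ σ y)

theorem exists_of_avg_ne_zero {f : TPow k M d →ₗ[k] k} {x : TPow k M d} (h : avg H f x ≠ 0) :
    ∃ σ ∈ H, f (tperm σ x) ≠ 0 :=
  exists_of_orbitSum_ne_zero (H := H) (F := fun σ => f ∘ₗ tperm σ) (LinearMap.applyₗ (R := k) x) h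

theorem avg_apply_eq {f : TPow k M d →ₗ[k] k} {x : TPow k M d}
    (h : ∀ σ ∈ H, f (tperm σ x) ≠ 0 → f ∘ₗ tperm σ = f) : avg H f x = f x := by
  have h1 : f ∘ₗ tperm 1 = f := LinearMap.ext fun y => congrArg f (tperm_one y)
  refine (orbitSum_apply_eq (H := H) (F := fun σ => f ∘ₗ tperm σ) (LinearMap.applyₗ x)
    fun σ hσ hf => (h σ hσ hf).trans h1.symm).trans ?_
  exact LinearMap.congr_fun h1 x

/-- The tensors that are alternating under the permutations preserving the fibres of `c`. -/
def altSub (k : Type u) [Field k] (M : Type u) [AddCommGroup M] [Module k M] [SuperSpace k M]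
    (c : Fin d → ℕ) : Submodule k (TPow k M d) where
  carrier := {x | ∀ σ ∈ fiberPerms c, tperm σ x = psign k σ • x}
  add_mem' hx hy σ h := by rw [map_add, hx σ h, hy σ h, smul_add]
  zero_mem' σ _ := by rw [map_zero, smul_zero]
  smul_mem' a x hx σ h := by rw [map_smul, hx σ h, smul_comm]

/-- The sum of the signed translates of a tensor, each of them being counted once. -/
def altSum (c : Fin d → ℕ) (x : TPow k M d) : TPow k M d :=
  orbitSum (fiberPerms c) fun σ => psign k σ • tperm σ x

/-- The signed translation by `σ` permutes the signed translates of `x`, so it fixes their sum;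
moving the sign, which squares to 1, to the other side gives the alternating property. -/
theorem altSum_mem (c : Fin d → ℕ) (x : TPow k M d) : altSum c x ∈ altSub k M c := by
  intro σ hσ
  have : psign k σ • tperm σ (altSum c x) = altSum c x := by
    refine map_orbitSum (psign k σ • tperm σ : TPow k M d →ₗ[k] TPow k M d).toAddMonoidHom ?_ ?_
    · intro a b hab
      have h1 : tperm σ a = tperm σ b := by
        have := congrArg (psign k σ • ·) hab
        simpa [smul_smul, psign_mul_self] using this
      rw [← tperm_inv_tperm σ a, h1, tperm_inv_tperm]
    · intro τ hτ
      refine ⟨τ * σ, (fiberPerms c).mul_mem hτ hσ, ?_⟩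
      change psign k σ • tperm σ (psign k τ • tperm τ x) = psign k (τ * σ) • tperm (τ * σ) x
      rw [map_smul, tperm_tperm, smul_smul, psign_mul, mul_comm]
  conv_rhs => rw [← this]
  rw [smul_smul, psign_mul_self, one_smul]

theorem exists_of_altSum_ne_zero {c : Fin d → ℕ} {x : TPow k M d} (f : TPow k M d →ₗ[k] k)
    (h : f (altSum c x) ≠ 0) : ∃ σ ∈ fiberPerms c, f (tperm σ x) ≠ 0 := by
  obtain ⟨σ, hσ, h'⟩ := exists_of_orbitSum_ne_zero f h
  refine ⟨σ, hσ, fun h0 => h' ?_⟩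
  rw [map_smul, h0, smul_zero]

theorem altSum_apply_eq {c : Fin d → ℕ} {x : TPow k M d} (f : TPow k M d →ₗ[k] k)
    (h : ∀ σ ∈ fiberPerms c, f (tperm σ x) ≠ 0 → psign k σ • tperm σ x = x) :
    f (altSum c x) = f x := by
  have h1 : psign k (1 : Equiv.Perm (Fin d)) • tperm 1 x = x := by rw [psign_one, one_smul, tperm_one]
  refine (orbitSum_apply_eq f fun σ hσ hf => ?_).trans (congrArg f h1)
  rw [h1]
  refine h σ hσ fun h0 => hf ?_
  rw [map_smul, h0, smul_zero]

end Orbit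

/-! ### The Schur superfunctor as an image of column-alternating tensors. -/

section Image

variable {k : Type u} [Field k] {M : Type u} [AddCommGroup M] [Module k M] [SuperSpace k M]

theorem colBox_sigmaPerm (lam : YoungDiagram) (s : Fin lam.card) :
    colBox lam (sigmaPerm lam s) = rowBox lam s := by
  simp [sigmaPerm]

/-- The module `Ŝ_λ(M)` as the image of the tensors alternating along the columns. -/
theorem schurSub_eq_map (lam : YoungDiagram) :
    schurSub k lam M = (altSub k M (colOf lam)).map (symKer k lam M).mkQ := by
  set ρ := sigmaPerm lam with hρ
  -- Conjugation by `ρ` passes from the row numbering to the column numbering of the boxes and does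
  -- not change signs. The remaining discrepancy between the invariants on the parity-shifted space
  -- and the alternating tensors on `M` is the sign produced by powers of an odd map.
  have hsign : ∀ σ, psign k (ρ * σ * ρ⁻¹) = psign k σ := by
    intro σ
    have : psign k ρ * psign k ρ⁻¹ = 1 := by rw [← psign_mul, mul_inv_cancel, psign_one]
    rw [psign_mul, psign_mul]
    linear_combination psign k σ * this
  have hcol : ∀ σ, (σ ∈ fiberPerms (colOf lam) ↔ IsColPerm lam (ρ * σ * ρ⁻¹)) := by
    intro σ
    have h1 : ∀ s, (colBox lam (ρ s)).1.2 = colOf lam s := fun s => by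
      rw [hρ, colBox_sigmaPerm]; rfl
    have h2 : ∀ s, (colBox lam s).1.2 = colOf lam (ρ⁻¹ s) := fun s => by
      rw [← h1, show ρ (ρ⁻¹ s) = s from ρ.apply_symm_apply s]
    constructor
    · intro h s
      rw [Equiv.Perm.mul_apply, Equiv.Perm.mul_apply, h1, h, h2]
    · intro h s
      have := h (ρ s)
      rwa [Equiv.Perm.mul_apply, Equiv.Perm.mul_apply,
        show ρ⁻¹ (ρ s) = s from ρ.symm_apply_apply s, h1, h1] at this
  ext y
  rw [mem_schurSub, Submodule.mem_map]
  constructor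
  · rintro ⟨x, hx, rfl⟩
    refine ⟨_, fun σ hσ => ?_, rfl⟩
    have e : ρ * σ = ρ * σ * ρ⁻¹ * ρ := by group
    rw [tperm_tperm, e, ← tperm_tperm ρ, tperm_signedPow (pr_parTo k M), hx _ ((hcol σ).1 hσ),
      map_smul, ← hsign σ]
    rfl
  · rintro ⟨z, hz, rfl⟩
    -- The signed power of `toPar` inverts that of `parTo` up to the scalar of
    -- `signedPow_toPar_parTo`; this scalar is its own inverse, so it is inserted as a correction.
    refine ⟨koszul k (charge (d := lam.card) (fun _ => 1) (fun _ => 1)) •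
      signedPow (toPar k M) lam.card (tperm ρ⁻¹ z), fun τ hτ => ?_, ?_⟩
    · have hσ : τ = ρ * (ρ⁻¹ * τ * ρ) * ρ⁻¹ := by group
      have h1 : ρ⁻¹ * τ = (ρ⁻¹ * τ * ρ) * ρ⁻¹ := by group
      rw [map_smul, tperm_signedPow (pr_toPar k _), tperm_tperm, h1, ← tperm_tperm ρ⁻¹,
        hz _ ((hcol _).2 (hσ ▸ hτ)), map_smul, map_smul, ← hsign, ← hσ, psign, smul_smul (koszul k (invCharge _ τ)),
        koszul_mul_self, one_smul]
    · rw [map_smul, signedPow_toPar_parTo, smul_smul, koszul_mul_self, one_smul, tperm_tperm_inv]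

end Image

/-! ### Semistandard words, row sorting and the energy. -/

section Words

variable {lam : YoungDiagram} {ι : Type}

theorem rowBox_lt_iff {s t : Fin lam.card} :
    s < t ↔ rowOf lam s < rowOf lam t ∨ rowOf lam s = rowOf lam t ∧ colOf lam s < colOf lam t := by
  have h : s < t ↔ toLex (rowBox lam s).1 < toLex (rowBox lam t).1 :=
    ((Finset.orderIsoOfFin (lam.cells.map (toLex : ℕ × ℕ ≃ ℕ ×ₗ ℕ).toEmbedding)
      (Finset.card_map _)).lt_iff_lt (x := s) (y := t)).symm
  rw [h, Prod.Lex.toLex_lt_toLex]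
  rfl

theorem eq_of_rowOf_colOf {s t : Fin lam.card} (h1 : rowOf lam s = rowOf lam t)
    (h2 : colOf lam s = colOf lam t) : s = t :=
  (rowBox lam).injective (Subtype.ext (Prod.ext h1 h2))

theorem rowOf_mono {s t : Fin lam.card} (h : s ≤ t) : rowOf lam s ≤ rowOf lam t := by
  rcases h.lt_or_eq with h | rfl
  · rcases rowBox_lt_iff.1 h with h | h
    · exact h.le
    · exact h.1.le
  · rfl

/-- The letters increase weakly along the rows. -/
def RowSorted (rk : ι → ℕ) (T : Fin lam.card → ι) : Prop :=
  ∀ s t, rowOf lam s = rowOf lam t → colOf lam s < colOf lam t → rk (T s) ≤ rk (T t)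

/-- Semistandard words: even letters increase weakly along the rows and strictly down the
columns, odd letters increase strictly along the rows and weakly down the columns. -/
def IsStd (p : ι → ZMod 2) (rk : ι → ℕ) (T : Fin lam.card → ι) : Prop :=
  (∀ s t, rowOf lam s = rowOf lam t → colOf lam s < colOf lam t →
    rk (T s) ≤ rk (T t) ∧ (T s = T t → p (T s) = 0)) ∧
  ∀ s t, colOf lam s = colOf lam t → rowOf lam s < rowOf lam t →
    rk (T s) ≤ rk (T t) ∧ (T s = T t → p (T s) = 1)

/-- No odd letter is repeated in a row. -/
def RowGood (p : ι → ZMod 2) (T : Fin lam.card → ι) : Prop :=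
  ∀ s t, rowOf lam s = rowOf lam t → T s = T t → p (T s) = 1 → s = t

theorem IsStd.rowSorted {p : ι → ZMod 2} {rk : ι → ℕ} {T : Fin lam.card → ι} (h : IsStd p rk T) :
    RowSorted rk T := fun s t h1 h2 => (h.1 s t h1 h2).1

theorem IsStd.rowGood {p : ι → ZMod 2} {rk : ι → ℕ} {T : Fin lam.card → ι} (h : IsStd p rk T) :
    RowGood p T := by
  intro s t hst hT hp
  rcases lt_trichotomy (colOf lam s) (colOf lam t) with hc | hc | hc
  · exact absurd ((h.1 s t hst hc).2 hT) (by rw [hp]; decide)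
  · exact eq_of_rowOf_colOf hst hc
  · exact absurd ((h.1 t s hst.symm hc).2 hT.symm) (by rw [← hT, hp]; decide)

theorem IsStd.colGood {p : ι → ZMod 2} {rk : ι → ℕ} {T : Fin lam.card → ι} (h : IsStd p rk T)
    {s t : Fin lam.card} (hst : colOf lam s = colOf lam t) (hT : T s = T t) (hp : p (T s) = 0) :
    s = t := by
  rcases lt_trichotomy (rowOf lam s) (rowOf lam t) with hc | hc | hc
  · exact absurd ((h.2 s t hst hc).2 hT) (by rw [hp]; decide)
  · exact eq_of_rowOf_colOf hc hst
  · exact absurd ((h.2 t s hst.symm hc).2 hT.symm) (by rw [← hT, hp]; decide)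

theorem RowSorted.monotone {rk : ι → ℕ} {T : Fin lam.card → ι} (h : RowSorted rk T) :
    Monotone fun s => toLex (rowOf lam s, rk (T s)) := by
  intro s t hst
  rw [Prod.Lex.toLex_le_toLex]
  rcases hst.lt_or_eq with hst | rfl
  · rcases rowBox_lt_iff.1 hst with h' | h'
    · exact Or.inl h'
    · exact Or.inr ⟨h'.1, h s t h'.1 h'.2⟩
  · exact Or.inr ⟨rfl, le_rfl⟩

/-- Both words arrange the same pairs (row, rank) monotonically in the row numbering, and the
monotone rearrangement of a tuple is unique. So a row class contains at most one sorted word. -/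
theorem RowSorted.unique {rk : ι → ℕ} (hrk : Function.Injective rk) {T : Fin lam.card → ι}
    {ρ : Equiv.Perm (Fin lam.card)} (hρ : ρ ∈ fiberPerms (rowOf lam)) (h : RowSorted rk T)
    (h' : RowSorted rk (T ∘ ρ)) : T ∘ ρ = T := by
  have h1 := Tuple.unique_monotone (f := fun s => toLex (rowOf lam s, rk (T s))) (σ := 1) (τ := ρ)
    h.monotone (by
      have e : (fun s => toLex (rowOf lam s, rk (T s))) ∘ ρ =
          fun s => toLex (rowOf lam s, rk ((T ∘ ρ) s)) :=
        funext fun s => by rw [Function.comp_apply, hρ s]; rfl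
      rw [e]
      exact h'.monotone)
  funext s
  have := congrFun h1 s
  exact hrk (Prod.ext_iff.1 (toLex.injective this)).2.symm

/-- Sort the positions lexicographically by (row, rank). Row numbers are already monotone in the row
numbering, so this sorting does not change the row of any position. -/
theorem exists_rowSorted (rk : ι → ℕ) (w : Fin lam.card → ι) :
    ∃ ρ ∈ fiberPerms (rowOf lam), RowSorted rk (w ∘ ρ) := by
  set F : Fin lam.card → ℕ ×ₗ ℕ := fun s => toLex (rowOf lam s, rk (w s)) with hF
  have hm := Tuple.monotone_sort F
  set ρ := Tuple.sort F
  have hrow : rowOf lam ∘ ρ = rowOf lam ∘ (1 : Equiv.Perm (Fin lam.card)) := by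
    refine Tuple.unique_monotone ?_ fun s t h => rowOf_mono h
    intro s t h
    rcases (Prod.Lex.toLex_le_toLex.1 (hm h)) with h' | h'
    · exact h'.le
    · exact h'.1.le
  refine ⟨ρ, fun s => congrFun hrow s, fun s t h1 h2 => ?_⟩
  have hst : s < t := rowBox_lt_iff.2 (Or.inr ⟨h1, h2⟩)
  rcases (Prod.Lex.toLex_le_toLex.1 (hm hst.le)) with h' | h'
  · have e1 := congrFun hrow s
    have e2 := congrFun hrow t
    simp only [Function.comp_apply, Equiv.Perm.coe_one, id_eq] at e1 e2
    simp only [e1, e2, h1, lt_irrefl] at h'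
  · exact h'.2

/-- The sum of the products of the rank of a letter and the number of its row. -/
def energy (rk : ι → ℕ) (w : Fin lam.card → ι) : ℕ := ∑ s, rk (w s) * rowOf lam s

theorem energy_comp (rk : ι → ℕ) (w : Fin lam.card → ι) {ρ : Equiv.Perm (Fin lam.card)}
    (hρ : ρ ∈ fiberPerms (rowOf lam)) : energy rk (w ∘ ρ) = energy rk w := by
  rw [energy, energy, ← Equiv.sum_comp ρ fun s => rk (w s) * rowOf lam s]
  exact Finset.sum_congr rfl fun s _ => by rw [hρ s, Function.comp_apply]

/-- The rearrangement inequality in each column, done for all columns at once: going down a column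
of a semistandard word, row numbers and ranks increase together, so no permutation of the column
raises the sum of their products. -/
theorem IsStd.energy_comp_le {p : ι → ZMod 2} {rk : ι → ℕ}
    (hrk : Function.Injective rk) {T : Fin lam.card → ι}
    (h : IsStd p rk T) {σ : Equiv.Perm (Fin lam.card)} (hσ : σ ∈ fiberPerms (colOf lam)) :
    energy rk (T ∘ σ) ≤ energy rk T ∧ (energy rk (T ∘ σ) = energy rk T → T ∘ σ = T) := by
  obtain ⟨L, hL⟩ : ∃ L, ∀ s, rk (T s) < L :=
    ⟨∑ s, rk (T s) + 1, fun s => Nat.lt_succ_of_le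
      (Finset.single_le_sum (f := fun s => rk (T s)) (fun _ _ => Nat.zero_le _)
        (Finset.mem_univ s))⟩
  obtain ⟨D, hD⟩ : ∃ D, ∀ s, rowOf lam s < D :=
    ⟨∑ s, rowOf lam s + 1, fun s => Nat.lt_succ_of_le
      (Finset.single_le_sum (f := fun s => rowOf lam s) (fun _ _ => Nat.zero_le _)
        (Finset.mem_univ s))⟩
  -- With `L` above all ranks and `D` above all row numbers, both functions compare columns first,
  -- then rank or row respectively. Hence they vary together on the whole diagram, not merely inside
  -- one column.
  set F : Fin lam.card → ℕ := fun s => L * colOf lam s + rk (T s) with hF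
  set G : Fin lam.card → ℕ := fun s => D * colOf lam s + rowOf lam s with hG
  have lex : ∀ {L a b a' b' : ℕ}, b < L → b' < L →
      (L * a + b < L * a' + b' ↔ a < a' ∨ a = a' ∧ b < b') := by
    intro L a b a' b' hb hb'
    rcases lt_trichotomy a a' with h | rfl | h
    · have := Nat.mul_le_mul_left L h
      rw [Nat.mul_succ] at this
      simp only [h, true_or, iff_true]; omega
    · simp
    · have := Nat.mul_le_mul_left L h
      rw [Nat.mul_succ] at this
      simp only [h.not_gt, h.ne', false_and, or_self, iff_false]; omega
  have hFG : Monovary F G := by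
    intro s t hst
    rcases (lex (hD s) (hD t)).1 hst with h' | h'
    · exact ((lex (hL s) (hL t)).2 (Or.inl h')).le
    · simp only [hF, h'.1]
      have := (h.2 s t h'.1 h'.2).1
      omega
  -- A column permutation changes no column number, so after expansion the energy is the only term
  -- of the product sum that depends on `τ`.
  have hsum : ∀ τ ∈ fiberPerms (colOf lam), ∑ s, F (τ s) * G s =
      ∑ s, L * colOf lam s * G s + ∑ s, rk (T s) * (D * colOf lam s) + energy rk (T ∘ τ) := by
    intro τ hτ
    rw [energy, ← Equiv.sum_comp τ fun s => rk (T s) * (D * colOf lam s), ← Finset.sum_add_distrib,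
      ← Finset.sum_add_distrib]
    refine Finset.sum_congr rfl fun s _ => ?_
    simp only [hF, hG, hτ s, Function.comp_apply]
    ring
  have h1 := hsum 1 (fiberPerms (colOf lam)).one_mem
  have h2 := hsum σ hσ
  have h3 := hFG.sum_comp_perm_mul_le_sum_mul (σ := σ)
  have h4 : energy rk (T ∘ (1 : Equiv.Perm (Fin lam.card))) = energy rk T := rfl
  rw [h4] at h1
  simp only [Equiv.Perm.coe_one, id_eq] at h1
  refine ⟨by omega, fun heq => ?_⟩
  have h5 := (hFG.sum_comp_perm_mul_eq_sum_mul_iff (σ := σ)).1 (by omega)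
  have hGi : Function.Injective G := by
    intro s t hst
    by_contra hne
    have n1 : ¬ G s < G t := hst.not_lt
    have n2 : ¬ G t < G s := hst.not_gt
    rw [lex (hD _) (hD _)] at n1 n2
    exact hne (eq_of_rowOf_colOf (by omega) (by omega))
  have hs : StrictMono (G ∘ Tuple.sort G) :=
    (Tuple.monotone_sort G).strictMono_of_injective (hGi.comp (Tuple.sort G).injective)
  -- In the case of equality, `F` and `F ∘ σ` are both monotone when read in increasing order of the
  -- injective function `G`; uniqueness of the monotone arrangement forces them to agree.
  have h6 : F ∘ Tuple.sort G = F ∘ (σ * Tuple.sort G : Equiv.Perm _) := by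
    refine Tuple.unique_monotone ?_ ?_
    · intro s t hst
      rcases hst.lt_or_eq with hst | rfl
      · exact hFG (hs hst)
      · rfl
    · intro s t hst
      rcases hst.lt_or_eq with hst | rfl
      · exact h5 (hs hst)
      · rfl
  funext s
  have h7 := congrFun h6 ((Tuple.sort G).symm s)
  simp only [Function.comp_apply, Equiv.apply_symm_apply, Equiv.Perm.mul_apply, hF, hσ s] at h7
  exact hrk (by rw [Function.comp_apply]; omega)

end Words

/-! ### Stabilizers of words and coefficients of their symmetrizations. -/

section Stabilizer

variable {k : Type u} [Field k] {d : ℕ} {ι : Type} {p : ι → ZMod 2}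

/-- A block permutation that stabilizes the word must fix every odd position, because no odd letter
occurs twice in a block; moving even vectors only produces no sign. -/
theorem koszul_invCharge_of_comp_eq {α : Type*} {b : Fin d → α} {T : Fin d → ι}
    (hT : ∀ s t, b s = b t → T s = T t → p (T s) = 1 → s = t) {σ : Equiv.Perm (Fin d)}
    (hσ : σ ∈ fiberPerms b) (h : T ∘ σ = T) : koszul k (invCharge (p ∘ T) σ) = 1 := by
  rw [invCharge_eq_zero, koszul_zero]
  intro s hs
  have hs' : p (T s) = 1 := (zmod2_cases _).resolve_left hs
  exact (hT s (σ s) (hσ s).symm (congrFun h s).symm hs').symm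

/-- Twisting by the sign character exchanges even and odd letters: by `charge_perm` the product of
signs is the sign for the reversed parities, the two charges being equal since `σ` stabilizes the
word. With no even letter repeated in a block, the positions that are odd after the reversal are all
fixed. -/
theorem psign_mul_koszul_of_comp_eq {α : Type*} {b : Fin d → α} {T : Fin d → ι}
    (hT : ∀ s t, b s = b t → T s = T t → p (T s) = 0 → s = t) {σ : Equiv.Perm (Fin d)}
    (hσ : σ ∈ fiberPerms b) (h : T ∘ σ = T) :
    psign k σ * koszul k (invCharge (p ∘ T) σ) = 1 := by
  have h1 := charge_perm (fun _ => 1) (p ∘ T) σ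
  have h2 : (p ∘ T) ∘ σ = p ∘ T := by rw [Function.comp_assoc, h]
  have h3 : (fun _ : Fin d => (1 : ZMod 2)) ∘ σ = fun _ => 1 := rfl
  rw [h2, h3, add_comm, add_right_cancel_iff] at h1
  rw [psign, ← koszul_add, ← h1, invCharge_eq_zero, koszul_zero]
  intro s hs
  have hs' : p (T s) = 0 := by
    refine (zmod2_cases _).resolve_right fun h' => hs ?_
    simp only [Pi.add_apply, Function.comp_apply, h']
    decide
  exact (hT s (σ s) (hσ s).symm (congrFun h s).symm hs').symm

variable {M : Type u} [AddCommGroup M] [Module k M] [SuperSpace k M] (e : Module.Basis ι k M)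

theorem coord_self (T : Fin d → ι) : (wordBasis e d).coord T (wordBasis e d T) = 1 := by
  rw [Module.Basis.coord_apply, Module.Basis.repr_self, Finsupp.single_eq_same]

variable (he : ∀ i, pr k (p i) (e i) = e i)
include he

theorem comp_eq_of_coord_ne_zero {σ : Equiv.Perm (Fin d)} {v w : Fin d → ι}
    (h : (wordBasis e d).coord w (tperm σ (wordBasis e d v)) ≠ 0) : v ∘ σ = w := by
  classical
  by_contra hne
  refine h ?_
  rw [tperm_wordBasis e he, map_smul, Module.Basis.coord_apply, Module.Basis.repr_self,
    Finsupp.single_eq_of_ne (Ne.symm hne), smul_zero]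

theorem coord_comp_tperm {σ : Equiv.Perm (Fin d)} {T : Fin d → ι} (h : T ∘ σ = T)
    (h' : koszul k (invCharge (p ∘ T) σ) = 1) :
    (wordBasis e d).coord T ∘ₗ tperm σ = (wordBasis e d).coord T := by
  refine (wordBasis e d).ext fun w => ?_
  rw [LinearMap.comp_apply]
  by_cases hw : w = T
  · rw [hw, tperm_wordBasis e he, h, h', one_smul]
  · have h0 : (wordBasis e d).coord T (wordBasis e d w) = 0 := by
      rw [Module.Basis.coord_apply, Module.Basis.repr_self, Finsupp.single_eq_of_ne (Ne.symm hw)]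
    rw [h0]
    by_contra hne
    have := comp_eq_of_coord_ne_zero e he hne
    rw [← h] at this
    exact hw (σ.surjective.injective_comp_right this)

/-- A translate of the coordinate that is nonzero on the word comes from a permutation stabilizing
the word. Its sign is 1 by hypothesis, so the translate is the coordinate itself and is counted
once. -/
theorem avg_coord_self {α : Type*} {b : Fin d → α} {T : Fin d → ι}
    (hT : ∀ s t, b s = b t → T s = T t → p (T s) = 1 → s = t) :
    avg (fiberPerms b) ((wordBasis e d).coord T) (wordBasis e d T) = 1 := by
  rw [avg_apply_eq, coord_self e]
  intro σ hσ h
  have h1 := comp_eq_of_coord_ne_zero e he h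
  exact coord_comp_tperm e he h1 (koszul_invCharge_of_comp_eq hT hσ h1)

theorem exists_of_avg_coord_ne_zero {H : Subgroup (Equiv.Perm (Fin d))} {T w : Fin d → ι}
    (h : avg H ((wordBasis e d).coord T) (wordBasis e d w) ≠ 0) : ∃ σ ∈ H, w ∘ σ = T := by
  obtain ⟨σ, hσ, h'⟩ := exists_of_avg_ne_zero h
  exact ⟨σ, hσ, comp_eq_of_coord_ne_zero e he h'⟩

end Stabilizer

/-! ### Garnir sets and the straightening functionals. -/

section Garnir

variable {lam : YoungDiagram} {ι : Type} {p : ι → ZMod 2} {rk : ι → ℕ}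

theorem exists_position {i j : ℕ} (h : (i, j) ∈ lam) :
    ∃ s, rowOf lam s = i ∧ colOf lam s = j := by
  refine ⟨(rowBox lam).symm ⟨(i, j), h⟩, ?_, ?_⟩ <;> simp [rowOf, colOf]

theorem rowOf_colOf_mem (s : Fin lam.card) : (rowOf lam s, colOf lam s) ∈ lam :=
  (rowBox lam s).2

/-- If two words agree, up to a permutation `g`, and `g` moves only positions of one letter to
other rows, then the words have the same rows. -/
theorem exists_fiberPerms_comp_eq {d : ℕ} {r : Fin d → ℕ} {T : Fin d → ι}
    {g : Equiv.Perm (Fin d)} {u : ι} (h : ∀ t, T t ≠ u → r (g t) = r t) :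
    ∃ ρ ∈ fiberPerms r, T ∘ ρ = T ∘ g.symm := by
  classical
  have hcard : ∀ c : ℕ × ι, Fintype.card {s // (r s, T (g.symm s)) = c} =
      Fintype.card {s // (r s, T s) = c} := by
    rintro ⟨i, v⟩
    have h1 : ∀ v, Fintype.card {s // (r s, T (g.symm s)) = (i, v)} =
        (Finset.univ.filter fun t => r (g t) = i ∧ T t = v).card := by
      intro v
      rw [Fintype.card_subtype]
      exact Finset.card_equiv g.symm fun s => by simp [Prod.ext_iff]
    have h2 : ∀ v, Fintype.card {s // (r s, T s) = (i, v)} =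
        (Finset.univ.filter fun t => r t = i ∧ T t = v).card := by
      intro v
      rw [Fintype.card_subtype]
      simp [Prod.ext_iff]
    rw [h1, h2]
    -- Letters other than `u` keep their rows, which settles their counts. The copies of `u` fill
    -- whatever is left of each row, and `g` does not change the total size of a row.
    by_cases hv : v = u
    · subst hv
      have e1 : (Finset.univ.filter fun t => r (g t) = i).card =
          (Finset.univ.filter fun t => r t = i).card :=
        Finset.card_equiv g fun s => by simp
      have e2 := Finset.card_filter_add_card_filter_not
        (s := Finset.univ.filter fun t => r (g t) = i) (fun t => T t = v)
      have e3 := Finset.card_filter_add_card_filter_not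
        (s := Finset.univ.filter fun t => r t = i) (fun t => T t = v)
      have e4 : (Finset.univ.filter fun t => r (g t) = i).filter (fun t => ¬ T t = v) =
          (Finset.univ.filter fun t => r t = i).filter (fun t => ¬ T t = v) := by
        ext t
        simp only [Finset.mem_filter, Finset.mem_univ, true_and]
        refine and_congr_left fun ht => ?_
        rw [h t ht]
      rw [Finset.filter_filter] at e2 e3
      rw [e4] at e2
      omega
    · congr 1
      ext t
      simp only [Finset.mem_filter, Finset.mem_univ, true_and]
      refine and_congr_left fun ht => ?_
      rw [h t (ht ▸ hv)]
  let E := Equiv.ofFiberEquiv fun c => Fintype.equivOfCardEq (hcard c)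
  have hE : ∀ s, (r (E s), T (E s)) = (r s, T (g.symm s)) := fun s =>
    Equiv.ofFiberEquiv_map (f := fun s => (r s, T (g.symm s))) (g := fun s => (r s, T s)) _ s
  exact ⟨E, fun s => (Prod.ext_iff.1 (hE s)).1, funext fun s => (Prod.ext_iff.1 (hE s)).2⟩

/-- A word which is semistandard along the rows, but not semistandard, has two consecutive boxes in
a column which are not in order. -/
theorem exists_violation (hrk : Function.Injective rk) {T : Fin lam.card → ι}
    (h1 : RowSorted rk T) (h2 : RowGood p T) (h3 : ¬ IsStd p rk T) :
    ∃ a b, colOf lam a = colOf lam b ∧ rowOf lam b = rowOf lam a + 1 ∧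
      (rk (T b) < rk (T a) ∨ T b = T a ∧ p (T a) = 0) := by
  by_contra hcon
  push Not at hcon
  refine h3 ⟨fun s t hr hc => ⟨h1 s t hr hc, fun hT => ?_⟩, ?_⟩
  · refine (zmod2_cases _).resolve_right fun hp => ?_
    rw [h2 s t hr hT hp] at hc
    exact lt_irrefl _ hc
  -- Induction on the vertical distance through an intermediate box, which exists because a diagram
  -- is a lower set. Equal letters at the ends squeeze the rank of the intermediate letter, so that
  -- letter is the same too.
  have key : ∀ n s t, colOf lam s = colOf lam t → rowOf lam t = rowOf lam s + n + 1 →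
      rk (T s) ≤ rk (T t) ∧ (T s = T t → p (T s) = 1) := by
    intro n
    induction n with
    | zero =>
      intro s t hc hr
      have h := hcon s t hc hr
      exact ⟨h.1, fun hT => (zmod2_cases _).resolve_left (h.2 hT.symm)⟩
    | succ n ih =>
      intro s t hc hr
      obtain ⟨m, hm, hm'⟩ := exists_position (lam := lam)
        (lam.isLowerSet (Prod.mk_le_mk.2 ⟨show rowOf lam s + n + 1 ≤ rowOf lam t by omega,
          le_refl (colOf lam t)⟩) (rowOf_colOf_mem t))
      have e1 := ih s m (hc.trans hm'.symm) hm
      have e2 := hcon m t hm' (by omega)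
      refine ⟨e1.1.trans e2.1, fun hT => e1.2 (hrk (le_antisymm e1.1 ?_))⟩
      rw [hT]
      exact e2.1
  intro s t hc hr
  exact key (rowOf lam t - rowOf lam s - 1) s t hc (by omega)

/-- The boxes of the row of `a` with a letter not less than that of `a`, and those of the row of `b`
with a letter not greater than that of `b`. -/
def InGarnir (rk : ι → ℕ) (T : Fin lam.card → ι) (a b s : Fin lam.card) : Prop :=
  (rowOf lam s = rowOf lam a ∧ rk (T a) ≤ rk (T s)) ∨
    (rowOf lam s = rowOf lam b ∧ rk (T s) ≤ rk (T b))

open scoped Classical in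
/-- The partition of the boxes into the Garnir set and the remaining parts of the rows. -/
def garnirBlock (rk : ι → ℕ) (T : Fin lam.card → ι) (a b s : Fin lam.card) : Option ℕ :=
  if InGarnir rk T a b s then none else some (rowOf lam s)

theorem garnirBlock_eq_none {T : Fin lam.card → ι} {a b s : Fin lam.card} :
    garnirBlock rk T a b s = none ↔ InGarnir rk T a b s := by
  rw [garnirBlock]
  split_ifs with h <;> simp [h]

theorem garnirBlock_eq_some {T : Fin lam.card → ι} {a b s : Fin lam.card} {i : ℕ} :
    garnirBlock rk T a b s = some i ↔ ¬ InGarnir rk T a b s ∧ rowOf lam s = i := by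
  rw [garnirBlock]
  split_ifs with h <;> simp [h]

theorem inGarnir_iff_of_mem {T : Fin lam.card → ι} {a b : Fin lam.card}
    {σ : Equiv.Perm (Fin lam.card)} (hσ : σ ∈ fiberPerms (garnirBlock rk T a b))
    (s : Fin lam.card) : InGarnir rk T a b (σ s) ↔ InGarnir rk T a b s := by
  rw [← garnirBlock_eq_none, hσ s, garnirBlock_eq_none]

theorem rowOf_eq_of_mem {T : Fin lam.card → ι} {a b : Fin lam.card}
    {σ : Equiv.Perm (Fin lam.card)} (hσ : σ ∈ fiberPerms (garnirBlock rk T a b))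
    {s : Fin lam.card} (hs : ¬ InGarnir rk T a b s) : rowOf lam (σ s) = rowOf lam s := by
  have h1 := hσ s
  rw [garnirBlock_eq_some.2 ⟨hs, rfl⟩, garnirBlock_eq_some] at h1
  exact h1.2

variable {T : Fin lam.card → ι} {a b : Fin lam.card}

/-- Inside the Garnir set, ranks from the upper row are at least that of `T a` and ranks from the
lower row at most that of `T b`. The two rows can share a letter only if `T a = T b`, and then that
letter is even; within one row odd letters are distinct by `RowGood`. -/
theorem garnirBlock_good (hrk : Function.Injective rk) (h2 : RowGood p T)
    (hv : rk (T b) < rk (T a) ∨ T b = T a ∧ p (T a) = 0) (s t : Fin lam.card)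
    (hst : garnirBlock rk T a b s = garnirBlock rk T a b t) (hT : T s = T t) (hp : p (T s) = 1) :
    s = t := by
  refine h2 s t ?_ hT hp
  by_cases hs : InGarnir rk T a b s
  · have ht : InGarnir rk T a b t := by
      rw [← garnirBlock_eq_none, ← hst, garnirBlock_eq_none]; exact hs
    have key : ∀ c, T c = T s → rk (T a) ≤ rk (T c) → rk (T c) ≤ rk (T b) → False := by
      intro c hc h3 h4
      rcases hv with hv | ⟨hv, hp'⟩
      · omega
      · rw [hv] at h4
        have : T a = T c := hrk (le_antisymm h3 h4)
        rw [← hc, ← this, hp'] at hp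
        exact absurd hp (by decide)
    rcases hs with ⟨hs, hs'⟩ | ⟨hs, hs'⟩ <;> rcases ht with ⟨ht, ht'⟩ | ⟨ht, ht'⟩
    · rw [hs, ht]
    · exact (key s rfl hs' (hT ▸ ht')).elim
    · exact (key s rfl (hT ▸ ht') hs').elim
    · rw [hs, ht]
  · have h := garnirBlock_eq_some.2 ⟨hs, rfl⟩
    rw [hst, garnirBlock_eq_some] at h
    exact h.2.symm

/-- The Garnir set has more boxes than there are columns meeting it. -/
theorem exists_inGarnir_col (h1 : RowSorted rk T) (hcol : colOf lam a = colOf lam b)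
    (hrow : rowOf lam b = rowOf lam a + 1) {ρ : Equiv.Perm (Fin lam.card)}
    (hρ : ρ ∈ fiberPerms (rowOf lam)) :
    ∃ s t, s ≠ t ∧ InGarnir rk T a b s ∧ InGarnir rk T a b t ∧
      colOf lam (ρ s) = colOf lam (ρ t) := by
  set N := lam.rowLen (rowOf lam a) with hN
  have hlen : ∀ s, rowOf lam s = rowOf lam a ∨ rowOf lam s = rowOf lam b → colOf lam s < N := by
    intro s hs
    have h := YoungDiagram.mem_iff_lt_rowLen.1 (rowOf_colOf_mem s)
    rcases hs with hs | hs
    · rwa [hs] at h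
    · rw [hs] at h
      exact h.trans_le (lam.rowLen_anti _ _ (by omega))
  have ha := hlen a (Or.inl rfl)
  -- The `N + 1` boxes are those of the lower row up to the column of `b`, and those of the upper
  -- row from the column of `a` on. That column is used twice, hence the shift by one in the upper
  -- row. Any row permutation leaves these boxes in rows of length at most `N`.
  have hg : ∀ c : Fin (N + 1), ∃ s, InGarnir rk T a b s ∧
      ((c.1 ≤ colOf lam a ∧ rowOf lam s = rowOf lam b ∧ colOf lam s = c.1) ∨
        (colOf lam a < c.1 ∧ rowOf lam s = rowOf lam a ∧ colOf lam s + 1 = c.1)) := by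
    intro c
    by_cases hc : c.1 ≤ colOf lam a
    · obtain ⟨s, hs, hs'⟩ := exists_position (lam := lam) (lam.isLowerSet
        (Prod.mk_le_mk.2 ⟨le_refl (rowOf lam b), hcol ▸ hc⟩) (rowOf_colOf_mem b))
      refine ⟨s, Or.inr ⟨hs, ?_⟩, Or.inl ⟨hc, hs, hs'⟩⟩
      rcases (hcol ▸ hc : c.1 ≤ colOf lam b).lt_or_eq with hlt | heq
      · exact h1 s b hs (by omega)
      · rw [eq_of_rowOf_colOf hs (hs'.trans heq)]
    · have hm : (rowOf lam a, c.1 - 1) ∈ lam :=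
        YoungDiagram.mem_iff_lt_rowLen.2 (by have := c.2; omega)
      obtain ⟨s, hs, hs'⟩ := exists_position hm
      refine ⟨s, Or.inl ⟨hs, ?_⟩, Or.inr ⟨by omega, hs, by omega⟩⟩
      by_cases hlt : colOf lam a < colOf lam s
      · exact h1 a s hs.symm hlt
      · rw [eq_of_rowOf_colOf hs (by omega : colOf lam s = colOf lam a)]
  choose g hg1 hg2 using hg
  have hgi : Function.Injective g := by
    intro c c' h
    have e1 := hg2 c
    have e2 := hg2 c'
    rw [h] at e1
    exact Fin.ext (by omega)
  have hrow' : ∀ c, rowOf lam (ρ (g c)) = rowOf lam a ∨ rowOf lam (ρ (g c)) = rowOf lam b := by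
    intro c
    rw [hρ]
    rcases hg2 c with h | h
    · exact Or.inr h.2.1
    · exact Or.inl h.2.1
  obtain ⟨c, c', hne, heq⟩ := Fintype.exists_ne_map_eq_of_card_lt
    (fun c => (⟨colOf lam (ρ (g c)), hlen _ (hrow' c)⟩ : Fin N)) (by simp)
  exact ⟨g c, g c', fun h => hne (hgi h), hg1 c, hg1 c', congrArg Fin.val heq⟩

/-- Membership in the Garnir set depends only on the row and the letter of a box. For `s` outside
the set, `h⁻¹ s` is also outside, and it has the same row and letter as `ρ s`; so `ρ` preserves the
complement and, by finiteness, the Garnir set. -/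
theorem mem_fiberPerms_garnirBlock
    {ρ h : Equiv.Perm (Fin lam.card)}
    (hρ : ρ ∈ fiberPerms (rowOf lam)) (hh : h ∈ fiberPerms (garnirBlock rk T a b))
    (hT : (T ∘ ρ) ∘ h = T) : ρ ∈ fiberPerms (garnirBlock rk T a b) := by
  classical
  have hinv := (fiberPerms (garnirBlock rk T a b)).inv_mem hh
  have hT' : ∀ s, T (ρ s) = T (h⁻¹ s) := fun s => by
    have := congrFun hT (h⁻¹ s)
    simpa [Function.comp_apply, show h (h⁻¹ s) = s from h.apply_symm_apply s] using this
  have h1 : ∀ s, ¬ InGarnir rk T a b s → ¬ InGarnir rk T a b (ρ s) := by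
    intro s hs
    have e1 : ¬ InGarnir rk T a b (h⁻¹ s) := fun h' => hs ((inGarnir_iff_of_mem hinv s).1 h')
    have e2 := rowOf_eq_of_mem hinv hs
    simp only [InGarnir, hρ s, hT' s]
    simpa only [InGarnir, e2] using e1
  have h2 : ∀ s, InGarnir rk T a b s → InGarnir rk T a b (ρ s) := by
    set N : Finset (Fin lam.card) := Finset.univ.filter fun s => ¬ InGarnir rk T a b s
    have hmap : N.image ρ = N := by
      refine Finset.eq_of_subset_of_card_le ?_ (Finset.card_image_of_injective _ ρ.injective).ge
      intro s hs
      obtain ⟨t, ht, rfl⟩ := Finset.mem_image.1 hs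
      simp only [N, Finset.mem_filter, Finset.mem_univ, true_and] at ht ⊢
      exact h1 t ht
    intro s hs
    by_contra hcon
    have : ρ s ∈ N.image ρ := by
      rw [hmap]
      simpa [N] using hcon
    obtain ⟨t, ht, hts⟩ := Finset.mem_image.1 this
    rw [ρ.injective hts] at ht
    simp only [N, Finset.mem_filter, Finset.mem_univ, true_and] at ht
    exact ht hs
  intro s
  by_cases hs : InGarnir rk T a b s
  · rw [garnirBlock_eq_none.2 hs, garnirBlock_eq_none]
    exact h2 s hs
  · rw [garnirBlock_eq_some.2 ⟨hs, rfl⟩, garnirBlock_eq_some]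
    exact ⟨h1 s hs, hρ s⟩

/-- A Garnir permutation can only move letters of rank at least that of `T a` down and letters of
rank at most that of `T a` up, so undoing `T` to `w` cannot lower the energy. In the case of
equality only copies of `T a` change rows; then both words have the same rows, and sortedness makes
them equal. -/
theorem energy_lt_or_eq_of_garnir (hrk : Function.Injective rk) (h1 : RowSorted rk T)
    (hrow : rowOf lam b = rowOf lam a + 1) (hv : rk (T b) ≤ rk (T a))
    {ρ h : Equiv.Perm (Fin lam.card)}
    (hρ : ρ ∈ fiberPerms (rowOf lam)) (hh : h ∈ fiberPerms (garnirBlock rk T a b))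
    {w : Fin lam.card → ι} (hw : RowSorted rk w) (hT : (w ∘ ρ) ∘ h = T) :
    energy rk T < energy rk w ∨ w = T := by
  have hT' : w ∘ ρ = T ∘ h.symm := by
    rw [← hT]
    funext s
    simp
  have hterm : ∀ s, 0 ≤ ((rk (T s) : ℤ) - rk (T a)) * ((rowOf lam (h s) : ℤ) - rowOf lam s) := by
    intro s
    by_cases hs : InGarnir rk T a b s
    · have hs' := (inGarnir_iff_of_mem hh s).2 hs
      have hr : rowOf lam (h s) = rowOf lam a ∨ rowOf lam (h s) = rowOf lam b :=
        hs'.imp And.left And.left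
      rcases hs with ⟨e1, e2⟩ | ⟨e1, e2⟩
      · exact mul_nonneg (by omega) (by omega)
      · exact mul_nonneg_of_nonpos_of_nonpos (by omega) (by omega)
    · rw [rowOf_eq_of_mem hh hs, sub_self, mul_zero]
  -- Subtracting the constant rank of `T a` costs nothing, as the total change of row numbers under
  -- `h` is zero; it makes every summand nonnegative.
  have hsum : (energy rk w : ℤ) - energy rk T =
      ∑ s, ((rk (T s) : ℤ) - rk (T a)) * ((rowOf lam (h s) : ℤ) - rowOf lam s) := by
    rw [← energy_comp rk w hρ, hT', energy, energy,
      ← Equiv.sum_comp h fun s => rk ((T ∘ h.symm) s) * rowOf lam s]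
    have e : ∑ s, (rowOf lam (h s) : ℤ) = ∑ s, (rowOf lam s : ℤ) :=
      Equiv.sum_comp h fun s => (rowOf lam s : ℤ)
    simp only [sub_mul, mul_sub, Finset.sum_sub_distrib, ← Finset.mul_sum, e, Function.comp_apply,
      Equiv.symm_apply_apply]
    push_cast
    ring
  have hnonneg := Finset.sum_nonneg fun s (_ : s ∈ Finset.univ) => hterm s
  rw [← hsum] at hnonneg
  by_cases hlt : energy rk T < energy rk w
  · exact Or.inl hlt
  refine Or.inr ?_
  have h0 : ∑ s, ((rk (T s) : ℤ) - rk (T a)) * ((rowOf lam (h s) : ℤ) - rowOf lam s) = 0 := by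
    rw [← hsum]; omega
  have hfix : ∀ s, T s ≠ T a → rowOf lam (h s) = rowOf lam s := by
    intro s hs
    have := (Finset.sum_eq_zero_iff_of_nonneg fun s _ => hterm s).1 h0 s (Finset.mem_univ s)
    rcases mul_eq_zero.1 this with h' | h'
    · exact absurd (hrk (by omega)) hs
    · omega
  obtain ⟨ρ', hρ', e'⟩ := exists_fiberPerms_comp_eq hfix
  have e1 : w = T ∘ (ρ' * ρ⁻¹ : Equiv.Perm (Fin lam.card)) := by
    have : w ∘ ρ = T ∘ ρ' := hT'.trans e'.symm
    funext s
    have h2 := congrFun this (ρ.symm s)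
    simpa using h2
  rw [e1] at hw ⊢
  exact h1.unique hrk ((fiberPerms (rowOf lam)).mul_mem hρ' ((fiberPerms (rowOf lam)).inv_mem hρ))
    hw

variable {k : Type u} [Field k] {M : Type u} [AddCommGroup M] [Module k M] [SuperSpace k M]
  (e : Module.Basis ι k M) (he : ∀ i, pr k (p i) (e i) = e i)
include he

/-- The straightening functional attached to a word which is semistandard along the rows only. -/
theorem exists_garnir (hk : (2 : k) ≠ 0) (hrk : Function.Injective rk) (h1 : RowSorted rk T)
    (h2 : RowGood p T) (h3 : ¬ IsStd p rk T) :
    ∃ f : TPow k M lam.card →ₗ[k] k,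
      (∀ ρ ∈ fiberPerms (rowOf lam), ∀ x, f (tperm ρ x) = f x) ∧
      (∀ z ∈ altSub k M (colOf lam), f z = 0) ∧ f (wordBasis e _ T) = 1 ∧
      ∀ w, RowSorted rk w → f (wordBasis e _ w) ≠ 0 → energy rk T < energy rk w ∨ w = T := by
  obtain ⟨a, b, hcol, hrow, hv⟩ := exists_violation hrk h1 h2 h3
  set f₀ : TPow k M lam.card →ₗ[k] k :=
    avg (fiberPerms (garnirBlock rk T a b)) ((wordBasis e _).coord T) with hf₀
  refine ⟨avg (fiberPerms (rowOf lam)) f₀, fun ρ hρ x => avg_tperm _ hρ x, fun z hz => ?_, ?_, ?_⟩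
  · by_contra hne
    obtain ⟨ρ, hρ, hne⟩ := exists_of_avg_ne_zero hne
    obtain ⟨s, t, hst, hs, ht, hc⟩ := exists_inGarnir_col h1 hcol hrow hρ
    -- After applying `ρ` the two Garnir boxes lie in one column, so their transposition negates
    -- `tperm ρ z`. But `f₀` is invariant under it, hence twice the value of `f₀` is zero.
    have e1 : tperm (Equiv.swap s t) (tperm ρ z) = -tperm ρ z := by
      have e2 : ρ * Equiv.swap s t = Equiv.swap (ρ s) (ρ t) * ρ := by
        rw [Equiv.swap_apply_apply]
        group
      rw [tperm_tperm, e2, ← tperm_tperm ρ, hz _ (swap_mem_fiberPerms hc),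
        psign_swap (ρ.injective.ne hst), neg_one_smul, map_neg]
    have e2 := avg_tperm ((wordBasis e _).coord T) (swap_mem_fiberPerms
      (f := garnirBlock rk T a b) (a := s) (b := t)
      (by rw [garnirBlock_eq_none.2 hs, garnirBlock_eq_none.2 ht])) (tperm ρ z)
    rw [e1, map_neg, ← hf₀] at e2
    have e3 : (2 : k) * f₀ (tperm ρ z) = 0 := by linear_combination -e2
    exact hne ((mul_eq_zero.1 e3).resolve_left hk)
  · have h4 : f₀ (wordBasis e _ T) = 1 :=
      avg_coord_self e he (garnirBlock_good hrk h2 hv)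
    -- A row translate of `f₀` that is nonzero on `T` comes from a row permutation preserving the
    -- Garnir blocks, under which `f₀` is invariant; so the translate is `f₀` and is counted once.
    rw [avg_apply_eq, h4]
    intro ρ hρ hne
    rw [tperm_wordBasis e he, map_smul] at hne
    obtain ⟨σ, hσ, hT⟩ := exists_of_avg_coord_ne_zero e he (right_ne_zero_of_mul hne)
    exact LinearMap.ext fun x => avg_tperm _ (mem_fiberPerms_garnirBlock hρ hσ hT) x
  · intro w hw hne
    obtain ⟨ρ, hρ, hne⟩ := exists_of_avg_ne_zero hne
    rw [tperm_wordBasis e he, map_smul] at hne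
    obtain ⟨σ, hσ, hT⟩ := exists_of_avg_coord_ne_zero e he (right_ne_zero_of_mul hne)
    refine energy_lt_or_eq_of_garnir hrk h1 hrow ?_ hρ hσ hw hT
    rcases hv with hv | hv
    · exact hv.le
    · rw [hv.1]

end Garnir

/-! ### Weight space dimensions from the two triangular systems. -/

/-- Each image `F (y T)` is a standard basis vector plus terms of smaller `en`; induction on `en`
puts all basis vectors in the range. -/
theorem surjective_of_triangular {k : Type*} [Field k] {N : Type*} [AddCommGroup N] [Module k N]
    {S : Type*} [Fintype S] (en : S → ℕ) (F : N →ₗ[k] S → k) (y : S → N)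
    (h1 : ∀ T, F (y T) T = 1) (h2 : ∀ T T', F (y T) T' ≠ 0 → en T' < en T ∨ T' = T) :
    Function.Surjective F := by
  classical
  have key : ∀ n, ∀ T, en T < n → (Pi.single T 1 : S → k) ∈ LinearMap.range F := by
    intro n
    induction n with
    | zero => intro T hT; omega
    | succ n ih =>
      intro T hT
      have hsum : (Pi.single T 1 : S → k) = F (y T) -
          ∑ T' ∈ Finset.univ.erase T, F (y T) T' • (Pi.single T' 1 : S → k) := by
        have := pi_eq_sum_univ' (F (y T))
        rw [← Finset.add_sum_erase _ _ (Finset.mem_univ T), h1, one_smul] at this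
        rw [eq_sub_iff_add_eq]
        convert this.symm using 3 with T' _
      rw [hsum]
      refine sub_mem ⟨y T, rfl⟩ (Submodule.sum_mem _ fun T' hT' => ?_)
      by_cases h0 : F (y T) T' = 0
      · rw [h0, zero_smul]; exact zero_mem _
      · refine Submodule.smul_mem _ _ (ih T' ?_)
        have := (h2 T T' h0).resolve_right (Finset.ne_of_mem_erase hT')
        omega
  rw [← LinearMap.range_eq_top, eq_top_iff, ← (Pi.basisFun k S).span_eq, Submodule.span_le]
  rintro _ ⟨T, rfl⟩
  rw [Pi.basisFun_apply]
  exact key _ T (Nat.lt_succ_self _)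

section Rank

variable {lam : YoungDiagram} {ι : Type} {p : ι → ZMod 2} {rk : ι → ℕ}
  {k : Type u} [Field k] {M : Type u} [AddCommGroup M] [Module k M] [SuperSpace k M]
  (e : Module.Basis ι k M)

/-- The coefficient of the class of a word in `S^λ M`, as a functional on `M^{⊗d}`. -/
def rowCoeff (T : Fin lam.card → ι) : TPow k M lam.card →ₗ[k] k :=
  avg (fiberPerms (rowOf lam)) ((wordBasis e _).coord T)

theorem symKer_le_ker_of_invariant {f : TPow k M lam.card →ₗ[k] k}
    (hf : ∀ ρ ∈ fiberPerms (rowOf lam), ∀ x, f (tperm ρ x) = f x) :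
    symKer k lam M ≤ LinearMap.ker f := by
  rw [symKer, Submodule.span_le]
  rintro _ ⟨σ, x, hσ, rfl⟩
  exact LinearMap.mem_ker.2 (by rw [map_sub, hf σ hσ, sub_self])

variable (he : ∀ i, pr k (p i) (e i) = e i)
include he

/-- Exchanging two equal odd letters of a row leaves the word unchanged but produces a minus sign,
so the value equals its own negative. -/
theorem invariant_eq_zero_of_not_rowGood (hk : (2 : k) ≠ 0) {f : TPow k M lam.card →ₗ[k] k}
    (hf : ∀ ρ ∈ fiberPerms (rowOf lam), ∀ x, f (tperm ρ x) = f x) {w : Fin lam.card → ι}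
    (hw : ¬ RowGood p w) : f (wordBasis e _ w) = 0 := by
  simp only [RowGood] at hw
  push Not at hw
  obtain ⟨s, t, hr, hT, hp, hst⟩ := hw
  have h1 := hf _ (swap_mem_fiberPerms hr) (wordBasis e _ w)
  have h2 : w ∘ Equiv.swap s t = w := by
    funext x
    rw [Function.comp_apply, Equiv.swap_apply_def]
    split_ifs with e1 e2
    · rw [e1, hT]
    · rw [e2, hT]
    · rfl
  rw [tperm_wordBasis e he, h2, invCharge_swap hst hp (by rw [← hp, Function.comp_apply, hT]),
    map_smul] at h1
  simp only [koszul, one_ne_zero, if_false, neg_smul, one_smul] at h1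
  have h3 : (2 : k) * f (wordBasis e _ w) = 0 := by linear_combination -h1
  exact (mul_eq_zero.1 h3).resolve_left hk

/-- The spanning half of the basis theorem, in dual form. For every sorted word without repeated odd
letters in a row there is an invariant functional killing `z`: `rowCoeff` if the word is
semistandard, a Garnir functional otherwise. Elimination by increasing energy subtracts combinations
of these from `f` until nothing remains. -/
theorem invariant_apply_eq_zero [Finite ι] (hk : (2 : k) ≠ 0) (hrk : Function.Injective rk)
    {z : TPow k M lam.card} (hz : z ∈ altSub k M (colOf lam))
    (hz0 : ∀ T, IsStd p rk T → rowCoeff e T z = 0) {f : TPow k M lam.card →ₗ[k] k}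
    (hf : ∀ ρ ∈ fiberPerms (rowOf lam), ∀ x, f (tperm ρ x) = f x) : f z = 0 := by
  classical
  have : Fintype ι := Fintype.ofFinite ι
  have hΘ : ∀ T : Fin lam.card → ι, ∃ g : TPow k M lam.card →ₗ[k] k,
      RowSorted rk T → RowGood p T →
      (∀ ρ ∈ fiberPerms (rowOf lam), ∀ x, g (tperm ρ x) = g x) ∧ g z = 0 ∧
        g (wordBasis e _ T) = 1 ∧
        ∀ w, RowSorted rk w → g (wordBasis e _ w) ≠ 0 → energy rk T < energy rk w ∨ w = T := by
    intro T
    by_cases h1 : RowSorted rk T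
    · by_cases h2 : RowGood p T
      · by_cases h3 : IsStd p rk T
        · refine ⟨rowCoeff e T, fun _ _ => ⟨fun ρ hρ x => avg_tperm _ hρ x, hz0 T h3,
            avg_coord_self e he h2, fun w hw hne => Or.inr ?_⟩⟩
          obtain ⟨σ, hσ, hT⟩ := exists_of_avg_coord_ne_zero e he hne
          rw [← hw.unique hrk hσ (hT ▸ h1), hT]
        · obtain ⟨g, h4, h5, h6, h7⟩ := exists_garnir e he hk hrk h1 h2 h3
          exact ⟨g, fun _ _ => ⟨h4, h5 z hz, h6, h7⟩⟩
      · exact ⟨0, fun _ h => absurd h h2⟩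
    · exact ⟨0, fun h => absurd h h1⟩
  choose Θ hΘ using hΘ
  obtain ⟨K, hK⟩ : ∃ K, ∀ w : Fin lam.card → ι, energy rk w < K :=
    ⟨∑ w : Fin lam.card → ι, energy rk w + 1, fun w => Nat.lt_succ_of_le
      (Finset.single_le_sum (f := fun w : Fin lam.card → ι => energy rk w)
        (fun _ _ => Nat.zero_le _) (Finset.mem_univ w))⟩
  -- Here `f` is assumed to vanish on words of energy below `K - n`. Each step clears the lowest
  -- remaining energy, at `n = 0` the functional is zero, and at `n = K` the assumption is vacuous.
  have key : ∀ n, ∀ f : TPow k M lam.card →ₗ[k] k,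
      (∀ ρ ∈ fiberPerms (rowOf lam), ∀ x, f (tperm ρ x) = f x) →
      (∀ w, energy rk w + n < K → f (wordBasis e _ w) = 0) → f z = 0 := by
    intro n
    induction n with
    | zero =>
      intro f _ h0
      have : f = 0 := (wordBasis e _).ext fun w => h0 w (hK w)
      rw [this, LinearMap.zero_apply]
    | succ n ih =>
      intro f hf h0
      set A : Finset (Fin lam.card → ι) := Finset.univ.filter fun T =>
        RowSorted rk T ∧ RowGood p T ∧ energy rk T + n + 1 = K with hA
      have hmem : ∀ T ∈ A, RowSorted rk T ∧ RowGood p T ∧ energy rk T + n + 1 = K := by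
        intro T hT
        simpa [hA] using hT
      set g := f - ∑ T ∈ A, f (wordBasis e _ T) • Θ T with hg
      have hgx : ∀ x, g x = f x - ∑ T ∈ A, f (wordBasis e _ T) * Θ T x := by
        intro x
        rw [hg, LinearMap.sub_apply, LinearMap.sum_apply]
        rfl
      have hginv : ∀ ρ ∈ fiberPerms (rowOf lam), ∀ x, g (tperm ρ x) = g x := by
        intro ρ hρ x
        rw [hgx, hgx, hf ρ hρ]
        congr 1
        refine Finset.sum_congr rfl fun T hT => ?_
        rw [(hΘ T (hmem T hT).1 (hmem T hT).2.1).1 ρ hρ]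
      have hgz : g z = f z := by
        rw [hgx, Finset.sum_eq_zero, sub_zero]
        intro T hT
        rw [(hΘ T (hmem T hT).1 (hmem T hT).2.1).2.1, mul_zero]
      rw [← hgz]
      have hsorted : ∀ w, RowSorted rk w → energy rk w + n < K → g (wordBasis e _ w) = 0 := by
        intro w hw hwn
        have hoff : ∀ T ∈ A, T ≠ w → f (wordBasis e _ T) * Θ T (wordBasis e _ w) = 0 := by
          intro T hT hne
          by_contra hcon
          have hT' := hmem T hT
          rcases (hΘ T hT'.1 hT'.2.1).2.2.2 w hw (right_ne_zero_of_mul hcon) with h' | h'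
          · have := hT'.2.2
            omega
          · exact hne h'.symm
        rw [hgx]
        by_cases hwA : w ∈ A
        · rw [Finset.sum_eq_single w hoff (fun h => absurd hwA h),
            (hΘ w (hmem w hwA).1 (hmem w hwA).2.1).2.2.1, mul_one, sub_self]
        · rw [Finset.sum_eq_zero fun T hT => hoff T hT fun h => hwA (h ▸ hT), sub_zero]
          by_cases hgood : RowGood p w
          · refine h0 w ?_
            have : energy rk w + n + 1 ≠ K := fun h => hwA (by simp [hA, hw, hgood, h])
            omega
          · exact invariant_eq_zero_of_not_rowGood e he hk hf hgood
      -- Sorting the rows changes a word by a sign only and keeps its energy, so sorted words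
      -- suffice.
      refine ih g hginv fun w hw => ?_
      obtain ⟨ρ, hρ, hs⟩ := exists_rowSorted rk w
      have h1 := hginv ρ hρ (wordBasis e _ w)
      rw [tperm_wordBasis e he, map_smul, hsorted _ hs (by rwa [energy_comp rk w hρ]),
        smul_zero] at h1
      exact h1.symm
  exact key K f hf fun w hw => by omega

/-- Functionals separate the points of the quotient, and each pulls back to a row-invariant
functional on tensors. -/
theorem mkQ_eq_zero_of_rowCoeff [Finite ι] (hk : (2 : k) ≠ 0) (hrk : Function.Injective rk)
    {z : TPow k M lam.card} (hz : z ∈ altSub k M (colOf lam))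
    (hz0 : ∀ T, IsStd p rk T → rowCoeff e T z = 0) : (symKer k lam M).mkQ z = 0 := by
  refine (Module.forall_dual_apply_eq_zero_iff k _).1 fun φ => ?_
  refine invariant_apply_eq_zero e he hk hrk hz hz0 (f := φ ∘ₗ (symKer k lam M).mkQ)
    fun ρ hρ x => ?_
  rw [LinearMap.comp_apply, LinearMap.comp_apply, ← sub_eq_zero, ← map_sub, ← map_sub]
  have : (symKer k lam M).mkQ (tperm ρ x - x) = 0 :=
    (Submodule.Quotient.mk_eq_zero _).2 (Submodule.subset_span ⟨ρ, x, hρ, rfl⟩)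
  rw [this, map_zero]

/-- A contributing column permutation turns the word into one of the same row class, hence of the
same energy. By the equality case of the rearrangement inequality it stabilizes the word, and its
signed translate is the word itself. -/
theorem rowCoeff_altSum_self (hrk : Function.Injective rk) {T : Fin lam.card → ι}
    (hT : IsStd p rk T) :
    rowCoeff e T (altSum (colOf lam) (wordBasis e _ T)) = 1 := by
  rw [altSum_apply_eq, rowCoeff, avg_coord_self e he hT.rowGood]
  intro σ hσ hne
  rw [tperm_wordBasis e he, map_smul] at hne
  obtain ⟨ρ, hρ, h'⟩ := exists_of_avg_coord_ne_zero e he (right_ne_zero_of_mul hne)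
  have h1 : energy rk (T ∘ σ) = energy rk T := by rw [← energy_comp rk (T ∘ σ) hρ, h']
  have h2 := (hT.energy_comp_le hrk hσ).2 h1
  rw [tperm_wordBasis e he, smul_smul, h2,
    psign_mul_koszul_of_comp_eq (fun s t => hT.colGood) hσ h2, one_smul]

/-- A nonzero entry means that `T'` is a row permutation of some column permutation of `T`, whose
energy is at most that of `T`; equality brings back `T`, and a row class has only one sorted word.
-/
theorem of_rowCoeff_altSum_ne_zero (hrk : Function.Injective rk) {T T' : Fin lam.card → ι}
    (hT : IsStd p rk T) (hT' : IsStd p rk T')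
    (hne : rowCoeff e T' (altSum (colOf lam) (wordBasis e _ T)) ≠ 0) :
    energy rk T' < energy rk T ∨ T' = T := by
  obtain ⟨σ, hσ, hne⟩ := exists_of_altSum_ne_zero _ hne
  rw [tperm_wordBasis e he, map_smul] at hne
  obtain ⟨ρ, hρ, h'⟩ := exists_of_avg_coord_ne_zero e he (right_ne_zero_of_mul hne)
  have h1 : energy rk T' = energy rk (T ∘ σ) := by rw [← energy_comp rk (T ∘ σ) hρ, h']
  have h2 := hT.energy_comp_le hrk hσ
  rcases h2.1.lt_or_eq with h3 | h3
  · exact Or.inl (h1 ▸ h3)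
  · rw [h2.2 h3] at h'
    exact Or.inr (h' ▸ hT.rowSorted.unique hrk hρ (h' ▸ hT'.rowSorted))

/-- The dimension of a sum of weight spaces of `Ŝ_λ(M)` is the number of semistandard words of these
weights. -/
theorem finrank_map_schurSub [Fintype ι] (hk : (2 : k) ≠ 0) (hrk : Function.Injective rk)
    (W : (Fin lam.card → ι) → Prop) (hW : ∀ w (σ : Equiv.Perm (Fin lam.card)), W (w ∘ σ) ↔ W w)
    (P : TPow k M lam.card →ₗ[k] TPow k M lam.card)
    (hP1 : ∀ w, W w → P (wordBasis e _ w) = wordBasis e _ w)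
    (hP0 : ∀ w, ¬ W w → P (wordBasis e _ w) = 0) :
    Module.finrank k
      (((altSub k M (colOf lam)).map P).map (symKer k lam M).mkQ : Submodule k (SymPow k lam M)) =
      Nat.card {T : Fin lam.card → ι // IsStd p rk T ∧ W T} := by
  classical
  have hcomm : ∀ σ x, P (tperm σ x) = tperm σ (P x) := by
    intro σ x
    refine LinearMap.congr_fun (f := P ∘ₗ tperm σ) (g := tperm σ ∘ₗ P)
      ((wordBasis e _).ext fun w => ?_) x
    rw [LinearMap.comp_apply, LinearMap.comp_apply, tperm_wordBasis e he, map_smul]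
    by_cases hw : W w
    · rw [hP1 _ ((hW w σ).2 hw), hP1 _ hw, tperm_wordBasis e he]
    · rw [hP0 _ (fun h => hw ((hW w σ).1 h)), hP0 _ hw, smul_zero, map_zero]
  have hcoeff : ∀ T x, rowCoeff e T (P x) = if W T then rowCoeff e T x else 0 := by
    intro T x
    refine LinearMap.congr_fun (f := rowCoeff e T ∘ₗ P)
      (g := if W T then rowCoeff e T else 0) ((wordBasis e _).ext fun w => ?_) x |>.trans ?_
    · rw [LinearMap.comp_apply]
      by_cases h0 : rowCoeff e T (wordBasis e _ w) = 0
      · by_cases hw : W w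
        · rw [hP1 _ hw, h0]; split_ifs <;> simp [h0]
        · rw [hP0 _ hw, map_zero]; split_ifs <;> simp [h0]
      · obtain ⟨σ, _, hσ⟩ := exists_of_avg_coord_ne_zero e he h0
        have : W w ↔ W T := by rw [← hσ, hW]
        by_cases hw : W w
        · rw [hP1 _ hw, if_pos (this.1 hw)]
        · rw [hP0 _ hw, map_zero, if_neg fun h => hw (this.2 h), LinearMap.zero_apply]
    · split_ifs <;> rfl
  set N : Submodule k (SymPow k lam M) :=
    ((altSub k M (colOf lam)).map P).map (symKer k lam M).mkQ with hN
  let F : N →ₗ[k] {T : Fin lam.card → ι // IsStd p rk T ∧ W T} → k :=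
    LinearMap.pi fun T => (symKer k lam M).liftQ (rowCoeff e T.1)
      (symKer_le_ker_of_invariant fun ρ hρ x => avg_tperm _ hρ x) ∘ₗ N.subtype
  have hF : ∀ z (hz : (symKer k lam M).mkQ z ∈ N) T, F ⟨(symKer k lam M).mkQ z, hz⟩ T =
      rowCoeff e T.1 z := fun _ _ _ => rfl
  -- Since `P` commutes with permutations, `P z` still alternates along columns; its row
  -- coefficients outside `W` vanish automatically, those inside by assumption.
  have hinj : Function.Injective F := by
    rw [← LinearMap.ker_eq_bot, LinearMap.ker_eq_bot']
    rintro ⟨y, hy⟩ h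
    obtain ⟨_, ⟨z, hz, rfl⟩, rfl⟩ := hy
    refine Subtype.ext (mkQ_eq_zero_of_rowCoeff e he hk hrk (fun σ hσ => ?_) fun T hT => ?_)
    · rw [← hcomm, hz σ hσ, map_smul]
    · by_cases hWT : W T
      · exact congrFun h ⟨T, hT, hWT⟩
      · rw [hcoeff, if_neg hWT]
  have hsurj : Function.Surjective F := by
    refine surjective_of_triangular (fun T => energy rk T.1) F (fun T =>
      ⟨(symKer k lam M).mkQ (P (altSum (colOf lam) (wordBasis e _ T.1))),
        Submodule.mem_map_of_mem (Submodule.mem_map_of_mem (altSum_mem _ _))⟩) ?_ ?_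
    · intro T
      rw [hF, hcoeff, if_pos T.2.2, rowCoeff_altSum_self e he hrk T.2.1]
    · intro T T' hne
      rw [hF, hcoeff, if_pos T'.2.2] at hne
      exact (of_rowCoeff_altSum_ne_zero e he hrk T.2.1 T'.2.1 hne).imp_right Subtype.ext
  rw [(LinearEquiv.ofBijective F ⟨hinj, hsurj⟩).finrank_eq, Module.finrank_fintype_fun_eq_card,
    Nat.card_eq_fintype_card]

end Rank

/-! ### Hook Schur functions as generating functions of semistandard words. -/

section Combinatorics

/-- The rank of the letters `x_1 < ⋯ < x_m < y_1 < ⋯ < y_n`. -/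
def letterRank (m n : ℕ) : Fin m ⊕ Fin n → ℕ := Sum.elim (fun i => i) fun j => m + j

theorem letterRank_injective (m n : ℕ) : Function.Injective (letterRank m n) := by
  rintro (i | i) (j | j) h <;> simp only [letterRank, Sum.elim_inl, Sum.elim_inr] at h
  · rw [Fin.ext h]
  · have := i.2; omega
  · have := j.2; omega
  · rw [Fin.ext (by omega : i.1 = j.1)]

variable {lam mu : YoungDiagram}

/-- The boxes of `μ ⊆ λ` and their numbers in `λ`. -/
def innerEquiv (h : mu ≤ lam) :
    ↥(mu.cells \ (⊥ : YoungDiagram).cells) ≃ {s : Fin lam.card // (rowBox lam s).1 ∈ mu} where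
  toFun b := ⟨(rowBox lam).symm ⟨b.1, h (Finset.mem_sdiff.1 b.2).1⟩, by
    rw [Equiv.apply_symm_apply]; exact (Finset.mem_sdiff.1 b.2).1⟩
  invFun s := ⟨(rowBox lam s.1).1, Finset.mem_sdiff.2 ⟨s.2, by simp⟩⟩
  left_inv b := by simp
  right_inv s := by simp

/-- The boxes of `λ'/μ'` and the numbers in `λ` of the transposed boxes. -/
def outerEquiv (lam mu : YoungDiagram) : ↥(lam.transpose.cells \ mu.transpose.cells) ≃
    {s : Fin lam.card // ¬ (rowBox lam s).1 ∈ mu} where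
  toFun b := ⟨(rowBox lam).symm ⟨b.1.swap, by
    have := (Finset.mem_sdiff.1 b.2).1
    rwa [YoungDiagram.mem_cells, YoungDiagram.mem_transpose] at this⟩, by
    have := (Finset.mem_sdiff.1 b.2).2
    rw [YoungDiagram.mem_cells, YoungDiagram.mem_transpose] at this
    rwa [Equiv.apply_symm_apply]⟩
  invFun s := ⟨(rowBox lam s.1).1.swap, by
    rw [Finset.mem_sdiff, YoungDiagram.mem_cells, YoungDiagram.mem_cells,
      YoungDiagram.mem_transpose, YoungDiagram.mem_transpose, Prod.swap_swap]
    exact ⟨(rowBox lam s.1).2, s.2⟩⟩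
  left_inv b := by simp
  right_inv s := by simp

open scoped Classical in
/-- The word with letters `x` in the boxes of `μ` and letters `y` in the other boxes. -/
def glue (h : mu ≤ lam) {m n : ℕ} (T₁ : ↥(mu.cells \ (⊥ : YoungDiagram).cells) → Fin m)
    (T₂ : ↥(lam.transpose.cells \ mu.transpose.cells) → Fin n) (s : Fin lam.card) :
    Fin m ⊕ Fin n :=
  if hs : (rowBox lam s).1 ∈ mu then Sum.inl (T₁ ((innerEquiv h).symm ⟨s, hs⟩))
  else Sum.inr (T₂ ((outerEquiv lam mu).symm ⟨s, hs⟩))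

variable {m n : ℕ}

theorem glue_of_mem (h : mu ≤ lam) (T₁ : ↥(mu.cells \ (⊥ : YoungDiagram).cells) → Fin m)
    (T₂ : ↥(lam.transpose.cells \ mu.transpose.cells) → Fin n) {s : Fin lam.card}
    (hs : (rowBox lam s).1 ∈ mu) :
    glue h T₁ T₂ s = Sum.inl (T₁ ((innerEquiv h).symm ⟨s, hs⟩)) := dif_pos hs

theorem glue_of_notMem (h : mu ≤ lam) (T₁ : ↥(mu.cells \ (⊥ : YoungDiagram).cells) → Fin m)
    (T₂ : ↥(lam.transpose.cells \ mu.transpose.cells) → Fin n) {s : Fin lam.card}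
    (hs : ¬ (rowBox lam s).1 ∈ mu) :
    glue h T₁ T₂ s = Sum.inr (T₂ ((outerEquiv lam mu).symm ⟨s, hs⟩)) := dif_neg hs

theorem glue_isLeft_iff (h : mu ≤ lam) (T₁ : ↥(mu.cells \ (⊥ : YoungDiagram).cells) → Fin m)
    (T₂ : ↥(lam.transpose.cells \ mu.transpose.cells) → Fin n) (s : Fin lam.card) :
    (glue h T₁ T₂ s).isLeft ↔ (rowBox lam s).1 ∈ mu := by
  by_cases hs : (rowBox lam s).1 ∈ mu
  · simp [glue_of_mem h T₁ T₂ hs, hs]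
  · simp [glue_of_notMem h T₁ T₂ hs, hs]

/-- Transposition turns the conditions on odd letters into those of an ordinary semistandard filling
of the transposed skew shape. Mixed pairs impose nothing: the x-letters have smaller ranks and
occupy a lower set. -/
theorem isStd_glue_iff (h : mu ≤ lam) (T₁ : ↥(mu.cells \ (⊥ : YoungDiagram).cells) → Fin m)
    (T₂ : ↥(lam.transpose.cells \ mu.transpose.cells) → Fin n) :
    IsStd (parity m n) (letterRank m n) (glue h T₁ T₂) ↔
      IsSemistandard mu ⊥ T₁ ∧ IsSemistandard lam.transpose mu.transpose T₂ := by
  have hlow : ∀ s t, rowOf lam s ≤ rowOf lam t → colOf lam s ≤ colOf lam t →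
      (rowBox lam t).1 ∈ mu → (rowBox lam s).1 ∈ mu := fun s t h1 h2 ht =>
    mu.isLowerSet (Prod.mk_le_mk.2 ⟨h1, h2⟩) ht
  constructor
  · intro hstd
    have key₁ : ∀ b, ∃ s : Fin lam.card, rowOf lam s = b.1.1 ∧ colOf lam s = b.1.2 ∧
        glue h T₁ T₂ s = Sum.inl (T₁ b) := by
      intro b
      obtain ⟨⟨s, hs⟩, rfl⟩ := (innerEquiv h).symm.surjective b
      exact ⟨s, rfl, rfl, glue_of_mem h T₁ T₂ hs⟩
    have key₂ : ∀ b, ∃ s : Fin lam.card, colOf lam s = b.1.1 ∧ rowOf lam s = b.1.2 ∧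
        glue h T₁ T₂ s = Sum.inr (T₂ b) := by
      intro b
      obtain ⟨⟨s, hs⟩, rfl⟩ := (outerEquiv lam mu).symm.surjective b
      exact ⟨s, rfl, rfl, glue_of_notMem h T₁ T₂ hs⟩
    refine ⟨⟨fun b c h1 h2 => ?_, fun b c h1 h2 => ?_⟩, fun b c h1 h2 => ?_, fun b c h1 h2 => ?_⟩
    · obtain ⟨s, hs1, hs2, hs⟩ := key₁ b
      obtain ⟨t, ht1, ht2, ht⟩ := key₁ c
      have := hstd.1 s t (by omega) (by omega)
      rw [hs, ht] at this
      exact this.1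
    · obtain ⟨s, hs1, hs2, hs⟩ := key₁ b
      obtain ⟨t, ht1, ht2, ht⟩ := key₁ c
      have := hstd.2 s t (by omega) (by omega)
      rw [hs, ht] at this
      refine lt_of_le_of_ne this.1 fun heq => ?_
      exact absurd (this.2 (congrArg _ heq)) (by simp [parity])
    · obtain ⟨s, hs1, hs2, hs⟩ := key₂ b
      obtain ⟨t, ht1, ht2, ht⟩ := key₂ c
      have := hstd.2 s t (by omega) (by omega)
      rw [hs, ht] at this
      exact Nat.le_of_add_le_add_left this.1
    · obtain ⟨s, hs1, hs2, hs⟩ := key₂ b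
      obtain ⟨t, ht1, ht2, ht⟩ := key₂ c
      have := hstd.1 s t (by omega) (by omega)
      rw [hs, ht] at this
      refine lt_of_le_of_ne (Nat.le_of_add_le_add_left this.1) fun heq => ?_
      exact absurd (this.2 (congrArg _ heq)) (by simp [parity])
  · rintro ⟨⟨a1, a2⟩, b1, b2⟩
    constructor
    · intro s t h1 h2
      by_cases ht : (rowBox lam t).1 ∈ mu
      · have hs := hlow s t h1.le h2.le ht
        rw [glue_of_mem h T₁ T₂ hs, glue_of_mem h T₁ T₂ ht]
        exact ⟨a1 _ _ h1 h2, fun _ => rfl⟩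
      · by_cases hs : (rowBox lam s).1 ∈ mu
        · rw [glue_of_mem h T₁ T₂ hs, glue_of_notMem h T₁ T₂ ht]
          refine ⟨?_, fun h' => absurd h' (by simp)⟩
          simp only [letterRank, Sum.elim_inl, Sum.elim_inr]
          omega
        · rw [glue_of_notMem h T₁ T₂ hs, glue_of_notMem h T₁ T₂ ht]
          have := b2 ((outerEquiv lam mu).symm ⟨s, hs⟩) ((outerEquiv lam mu).symm ⟨t, ht⟩) h1 h2
          exact ⟨Nat.add_le_add_left this.le _, fun h' => absurd (Sum.inr_injective h') this.ne⟩
    · intro s t h1 h2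
      by_cases ht : (rowBox lam t).1 ∈ mu
      · have hs := hlow s t h2.le h1.le ht
        rw [glue_of_mem h T₁ T₂ hs, glue_of_mem h T₁ T₂ ht]
        have := a2 ((innerEquiv h).symm ⟨s, hs⟩) ((innerEquiv h).symm ⟨t, ht⟩) h1 h2
        exact ⟨this.le, fun h' => absurd (Sum.inl_injective h') this.ne⟩
      · by_cases hs : (rowBox lam s).1 ∈ mu
        · rw [glue_of_mem h T₁ T₂ hs, glue_of_notMem h T₁ T₂ ht]
          refine ⟨?_, fun h' => absurd h' (by simp)⟩
          simp only [letterRank, Sum.elim_inl, Sum.elim_inr]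
          omega
        · rw [glue_of_notMem h T₁ T₂ hs, glue_of_notMem h T₁ T₂ ht]
          have := b1 ((outerEquiv lam mu).symm ⟨s, hs⟩) ((outerEquiv lam mu).symm ⟨t, ht⟩) h1 h2
          exact ⟨Nat.add_le_add_left this _, fun _ => rfl⟩

theorem exists_glue_eq (h : mu ≤ lam) {w : Fin lam.card → Fin m ⊕ Fin n}
    (hw : ∀ s, (w s).isLeft ↔ (rowBox lam s).1 ∈ mu) :
    ∃ T₁ T₂, glue h T₁ T₂ = w := by
  have h1 : ∀ b, ∃ i, w (innerEquiv h b).1 = Sum.inl i := fun b =>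
    Sum.isLeft_iff.1 ((hw _).2 (innerEquiv h b).2)
  have h2 : ∀ b, ∃ j, w (outerEquiv lam mu b).1 = Sum.inr j := fun b =>
    Sum.isRight_iff.1 (by
      rw [← Sum.not_isLeft, hw]
      exact (outerEquiv lam mu b).2)
  choose T₁ hT₁ using h1
  choose T₂ hT₂ using h2
  refine ⟨T₁, T₂, funext fun s => ?_⟩
  by_cases hs : (rowBox lam s).1 ∈ mu
  · rw [glue_of_mem h T₁ T₂ hs, ← hT₁, Equiv.apply_symm_apply]
  · rw [glue_of_notMem h T₁ T₂ hs, ← hT₂, Equiv.apply_symm_apply]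

theorem glue_injective (h : mu ≤ lam)
    {T₁ T₁' : ↥(mu.cells \ (⊥ : YoungDiagram).cells) → Fin m}
    {T₂ T₂' : ↥(lam.transpose.cells \ mu.transpose.cells) → Fin n}
    (heq : glue h T₁ T₂ = glue h T₁' T₂') : T₁ = T₁' ∧ T₂ = T₂' := by
  constructor
  · funext b
    obtain ⟨⟨s, hs⟩, rfl⟩ := (innerEquiv h).symm.surjective b
    have := congrFun heq s
    rw [glue_of_mem h _ _ hs, glue_of_mem h _ _ hs] at this
    exact Sum.inl_injective this
  · funext b
    obtain ⟨⟨s, hs⟩, rfl⟩ := (outerEquiv lam mu).symm.surjective b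
    have := congrFun heq s
    rw [glue_of_notMem h _ _ hs, glue_of_notMem h _ _ hs] at this
    exact Sum.inr_injective this

/-- The boxes of a semistandard word with letters `x` form a Young diagram. -/
theorem exists_inner_shape {w : Fin lam.card → Fin m ⊕ Fin n}
    (hw : IsStd (parity m n) (letterRank m n) w) :
    ∃ mu ≤ lam, ∀ s, (w s).isLeft ↔ (rowBox lam s).1 ∈ mu := by
  classical
  have hleft : ∀ a : Fin m ⊕ Fin n, a.isLeft ↔ letterRank m n a < m := by
    rintro (i | i) <;> simp [letterRank]
  have hmem : ∀ s, (rowBox lam s).1 ∈ (Finset.univ.filter fun s => (w s).isLeft).image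
      (fun s => (rowBox lam s).1) ↔ (w s).isLeft := by
    intro s
    simp only [Finset.mem_image, Finset.mem_filter, Finset.mem_univ, true_and]
    constructor
    · rintro ⟨t, ht, hts⟩
      rwa [← (rowBox lam).injective (Subtype.ext hts)]
    · exact fun h => ⟨s, h, rfl⟩
  refine ⟨⟨(Finset.univ.filter fun s => (w s).isLeft).image fun s => (rowBox lam s).1, ?_⟩, ?_,
    fun s => (hmem s).symm⟩
  · rintro ⟨i, j⟩ ⟨i', j'⟩ hle hij
    rw [Finset.mem_coe, Finset.mem_image] at hij
    obtain ⟨s, hs, hsij⟩ := hij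
    have hrow : rowOf lam s = i := congrArg Prod.fst hsij
    have hcol : colOf lam s = j := congrArg Prod.snd hsij
    obtain ⟨hi, hj⟩ := Prod.mk_le_mk.1 hle
    obtain ⟨t, ht1, ht2⟩ := exists_position (lam := lam) (lam.isLowerSet
      (Prod.mk_le_mk.2 ⟨hrow ▸ hi, hcol ▸ hj⟩ : (i', j') ≤ _) (rowOf_colOf_mem s))
    -- The corner box in the row of `t` and the column of `s`: ranks increase weakly along the row
    -- from `t` to `q`, then down the column from `q` to `s`, so the letter at `t` is also an x.
    obtain ⟨q, hq1, hq2⟩ := exists_position (lam := lam) (lam.isLowerSet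
      (Prod.mk_le_mk.2 ⟨hrow ▸ hi, le_refl (colOf lam s)⟩ : (i', _) ≤ _) (rowOf_colOf_mem s))
    have e1 : letterRank m n (w t) ≤ letterRank m n (w q) := by
      rcases lt_or_ge (colOf lam t) (colOf lam q) with hlt | hge
      · exact (hw.1 t q (by omega) hlt).1
      · rw [eq_of_rowOf_colOf (by omega : rowOf lam t = rowOf lam q) (by omega)]
    have e2 : letterRank m n (w q) ≤ letterRank m n (w s) := by
      rcases lt_or_ge (rowOf lam q) (rowOf lam s) with hlt | hge
      · exact (hw.2 q s hq2 hlt).1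
      · rw [eq_of_rowOf_colOf (by omega : rowOf lam q = rowOf lam s) hq2]
    have e3 := (hleft _).1 (Finset.mem_filter.1 hs).2
    have e4 : (rowBox lam t).1 = (i', j') := Prod.ext ht1 ht2
    rw [Finset.mem_coe, ← e4, hmem, hleft]
    omega
  · intro b hb
    obtain ⟨s, _, rfl⟩ := Finset.mem_image.1 hb
    exact (rowBox lam s).2

theorem prod_X_eq_monomial {ι : Type} {d : ℕ} (w : Fin d → ι) :
    ∏ s, MvPolynomial.X (R := ℤ) (w s) = MvPolynomial.monomial (wordWeight w) 1 := by
  rw [wordWeight, MvPolynomial.monomial_sum_one]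
  rfl

open scoped Classical in
/-- The hook Schur function as a sum over semistandard words in two kinds of letters. -/
theorem hookSchur_eq_sum (lam : YoungDiagram) (m n : ℕ) :
    hookSchur lam m n = ∑ w : Fin lam.card → Fin m ⊕ Fin n with
      IsStd (parity m n) (letterRank m n) w, MvPolynomial.monomial (wordWeight w) 1 := by
  have hsub : ∀ mu, mu ∈ subdiagrams lam ↔ mu ≤ lam := fun mu => by simp [subdiagrams]
  have hfib : ∀ mu ∈ subdiagrams lam, MvPolynomial.rename Sum.inl (schur mu m) *
      MvPolynomial.rename Sum.inr (skewSchur lam.transpose mu.transpose n) =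
      ∑ w : Fin lam.card → Fin m ⊕ Fin n with IsStd (parity m n) (letterRank m n) w,
        if ∀ s, (w s).isLeft ↔ (rowBox lam s).1 ∈ mu then
          MvPolynomial.monomial (R := ℤ) (wordWeight w) 1 else 0 := by
    intro mu hmu
    have h := (hsub mu).1 hmu
    rw [schur, skewSchur, skewSchur, map_sum, map_sum, Finset.sum_mul_sum, ← Finset.sum_product',
      ← Finset.sum_filter]
    refine Finset.sum_bij (fun T _ => glue h T.1 T.2) ?_ ?_ ?_ ?_
    · intro T hT
      simp only [Finset.mem_product, Finset.mem_filter, Finset.mem_univ, true_and] at hT ⊢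
      exact ⟨(isStd_glue_iff h _ _).2 hT, glue_isLeft_iff h _ _⟩
    · intro T _ T' _ heq
      have := glue_injective h heq
      exact Prod.ext this.1 this.2
    · intro w hw
      simp only [Finset.mem_filter, Finset.mem_univ, true_and] at hw
      obtain ⟨T₁, T₂, rfl⟩ := exists_glue_eq h hw.2
      refine ⟨(T₁, T₂), ?_, rfl⟩
      simp only [Finset.mem_product, Finset.mem_filter, Finset.mem_univ, true_and]
      exact (isStd_glue_iff h _ _).1 hw.1
    · intro T _
      rw [← prod_X_eq_monomial, map_prod, map_prod,
        ← Fintype.prod_subtype_mul_prod_subtype (fun s => (rowBox lam s).1 ∈ mu)]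
      simp only [MvPolynomial.rename_X]
      congr 1
      · refine Fintype.prod_equiv (innerEquiv h) _ _ fun b => ?_
        rw [glue_of_mem h _ _ (innerEquiv h b).2, Subtype.coe_eta, Equiv.symm_apply_apply]
      · refine Fintype.prod_equiv (outerEquiv lam mu) _ _ fun b => ?_
        rw [glue_of_notMem h _ _ (outerEquiv lam mu b).2, Subtype.coe_eta, Equiv.symm_apply_apply]
  rw [hookSchur, Finset.sum_congr rfl hfib, Finset.sum_comm]
  refine Finset.sum_congr rfl fun w hw => ?_
  -- The shape formed by the x-letters is the only `μ` for which the word contributes.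
  obtain ⟨mu, hmu, hw'⟩ := exists_inner_shape (Finset.mem_filter.1 hw).2
  rw [Finset.sum_eq_single mu, if_pos hw']
  · intro nu hnu hne
    refine if_neg fun hcon => hne (YoungDiagram.ext ?_)
    have key : ∀ α β : YoungDiagram, α ≤ lam →
        (∀ s, (rowBox lam s).1 ∈ α → (rowBox lam s).1 ∈ β) → α.cells ⊆ β.cells := by
      intro α β hα h b hb
      have := h ((rowBox lam).symm ⟨b, hα hb⟩)
      rw [Equiv.apply_symm_apply] at this
      exact this hb
    exact Finset.Subset.antisymm
      (key nu mu ((hsub nu).1 hnu) fun s hs => (hw' s).1 ((hcon s).2 hs))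
      (key mu nu hmu fun s hs => (hcon s).1 ((hw' s).2 hs))
  · exact fun h => absurd ((hsub mu).2 hmu) h

open scoped Classical in
theorem rename_hookSchur {κ : Type} (lam : YoungDiagram) (m n : ℕ) (g : Fin m ⊕ Fin n → κ) :
    MvPolynomial.rename g (hookSchur lam m n) = ∑ w : Fin lam.card → Fin m ⊕ Fin n with
      IsStd (parity m n) (letterRank m n) w, MvPolynomial.monomial (wordWeight (g ∘ w)) 1 := by
  rw [hookSchur_eq_sum, map_sum]
  exact Finset.sum_congr rfl fun w _ => by rw [MvPolynomial.rename_monomial, wordWeight_comp]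

/-- The map `g` treats both characters at once: the identity for type I, and the identification of
the x with the y variables for type II. -/
theorem coeff_rename_hookSchur {κ : Type} (lam : YoungDiagram) (m n : ℕ)
    (g : Fin m ⊕ Fin n → κ) (μ : κ →₀ ℕ) :
    (MvPolynomial.rename g (hookSchur lam m n)).coeff μ =
      Nat.card {w : Fin lam.card → Fin m ⊕ Fin n //
        IsStd (parity m n) (letterRank m n) w ∧ wordWeight (g ∘ w) = μ} := by
  classical
  rw [rename_hookSchur, MvPolynomial.coeff_sum]
  simp only [MvPolynomial.coeff_monomial]
  rw [Finset.sum_boole, Finset.filter_filter, Nat.card_eq_fintype_card, Fintype.card_subtype]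

end Combinatorics

/-! ### From weight idempotents to formal characters. -/

section Character

variable {k : Type u} [Field k] {lam : YoungDiagram}

/-- The action of `Γ^d End(V)` on `Ŝ_λ(V)`. -/
theorem finrank_range_schurI (V : CliffMod k 0) (f : Gam k (CHom V V) lam.card) :
    Module.finrank k (LinearMap.range ((schurI k lam).map V V f)) =
      Module.finrank k (((altSub k V.carrier (colOf lam)).map (gamAct lam.card f)).map
        (symKer k lam V.carrier).mkQ : Submodule k (SymPow k lam V.carrier)) := by
  have h : (LinearMap.range ((schurI k lam).map V V f)).map (schurSub k lam V.carrier).subtype =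
      ((altSub k V.carrier (colOf lam)).map (gamAct lam.card f)).map
        (symKer k lam V.carrier).mkQ := by
    ext y
    constructor
    · rintro ⟨_, ⟨⟨x, hx⟩, rfl⟩, rfl⟩
      rw [schurSub_eq_map] at hx
      obtain ⟨z, hz, rfl⟩ := hx
      exact ⟨_, ⟨z, hz, rfl⟩, rfl⟩
    · rintro ⟨_, ⟨z, hz, rfl⟩, rfl⟩
      have hz' : (symKer k lam V.carrier).mkQ z ∈ schurSub k lam V.carrier := by
        rw [schurSub_eq_map]
        exact ⟨z, hz, rfl⟩
      exact ⟨_, ⟨⟨_, hz'⟩, rfl⟩, rfl⟩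
  rw [← h]
  exact (Submodule.equivMapOfInjective (schurSub k lam V.carrier).subtype
    (Submodule.injective_subtype _)
    (LinearMap.range ((symAct lam f).restrict (symAct_schurSub f)))).finrank_eq

/-- Reduces type II to type I: the restricted functor lets a weight idempotent act through its image
in the endomorphisms of the underlying superspace, again a weight idempotent of even endomorphisms.
-/
theorem forgetGam_weightIdem {r : ℕ} {V : CliffMod k r} {κ : Type} [Fintype κ] {d : ℕ}
    (E : κ → CHom V V) (hE : ∀ a, pr k 0 (E a) = E a) (μ : κ →₀ ℕ) :
    forgetGam V V d (weightIdem E hE d μ) = weightIdem (fun a => forgetHom V V (E a))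
      (fun a => by rw [pr_forgetHom, hE]) d μ := by
  refine Subtype.ext ?_
  change tmap (forgetHom V V) d (weightIdem E hE d μ).1 = _
  simp only [weightIdem, map_sum]
  exact Finset.sum_congr rfl fun i _ => PiTensorProduct.map_tprod _ _

/-- A weight idempotent of endomorphisms acting diagonally is a projection onto a span of words. -/
theorem gamAct_weightIdem {V : CliffMod k 0} {ι κ : Type} [Fintype κ] {p : ι → ZMod 2} {d : ℕ}
    (e : Module.Basis ι k V.carrier) (he : ∀ i, pr k (p i) (e i) = e i) (E : κ → CHom V V)
    (hE : ∀ a, pr k 0 (E a) = E a) (g : ι → κ)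
    (hE₁ : ∀ i, (E (g i)).1 (e i) = e i) (hE₀ : ∀ a i, g i ≠ a → (E a).1 (e i) = 0)
    (μ : κ →₀ ℕ) (w : Fin d → ι) :
    (wordWeight (g ∘ w) = μ →
      gamAct d (weightIdem E hE d μ) (wordBasis e d w) = wordBasis e d w) ∧
    (wordWeight (g ∘ w) ≠ μ → gamAct d (weightIdem E hE d μ) (wordBasis e d w) = 0) := by
  classical
  -- All the `E (i s)` are even, so no sign occurs and the tensor acts letter by letter; only the
  -- word `g ∘ w` in the definition of the idempotent fixes `w`.
  have key : ∀ i : Fin d → κ, tbilin (cliffEval V V) d (PiTensorProduct.tprod k fun s => E (i s))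
      (wordBasis e d w) = if g ∘ w = i then wordBasis e d w else 0 := by
    intro i
    rw [wordBasis_apply, tbilin_tprod _ (φ := fun _ => 0) (ε := p ∘ w) (fun s => hE (i s))
      fun s => he (w s)]
    have hc : charge (fun _ => 0) (p ∘ w) = 0 := by simp [charge]
    rw [hc, koszul_zero, one_smul]
    change (PiTensorProduct.tprod k fun s => (E (i s)).1 (e (w s))) = _
    split_ifs with hi
    · simp only [← hi, Function.comp_apply, hE₁]
    · obtain ⟨s, hs⟩ := Function.ne_iff.1 hi
      exact MultilinearMap.map_coord_zero _ s (hE₀ _ _ hs)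
  simp only [gamAct, weightIdem, map_sum, LinearMap.sum_apply, key, Finset.sum_ite_eq,
    Finset.mem_filter, Finset.mem_univ, true_and]
  exact ⟨fun h => if_pos h, fun h => if_neg h⟩

theorem degree_wordWeight {κ : Type} {d : ℕ} (w : Fin d → κ) : (wordWeight w).degree = d := by
  simp [wordWeight, map_sum]

/-- The dimensions of the weight spaces of `Ŝ_λ`, for endomorphisms of a superspace acting
diagonally on a basis. -/
theorem finrank_range_weight (hk : (2 : k) ≠ 0) {V : CliffMod k 0} {ι κ : Type} [Fintype ι]
    [Fintype κ] {p : ι → ZMod 2} {rk : ι → ℕ} (hrk : Function.Injective rk)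
    (e : Module.Basis ι k V.carrier) (he : ∀ i, pr k (p i) (e i) = e i) (g : ι → κ) (μ : κ →₀ ℕ)
    (E : κ → CHom V V) (hE : ∀ a, pr k 0 (E a) = E a)
    (hE₁ : ∀ i, (E (g i)).1 (e i) = e i) (hE₀ : ∀ a i, g i ≠ a → (E a).1 (e i) = 0) :
    Module.finrank k
      (LinearMap.range ((schurI k lam).map V V (weightIdem E hE lam.card μ))) =
      Nat.card {w : Fin lam.card → ι // IsStd p rk w ∧ wordWeight (g ∘ w) = μ} := by
  rw [finrank_range_schurI]
  refine finrank_map_schurSub e he hk hrk (fun w => wordWeight (g ∘ w) = μ) (fun w σ => ?_) _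
    (fun w => (gamAct_weightIdem e he E hE g hE₁ hE₀ μ w).1)
    fun w => (gamAct_weightIdem e he E hE g hE₁ hE₀ μ w).2
  rw [← Function.comp_assoc, wordWeight_perm]

/-- Coefficients are compared weight by weight; outside degree `lam.card` both vanish, because a
word has as many letters as there are boxes. -/
theorem formalCh_eq_of_finrank {r : ℕ} {V : CliffMod k r} {κ : Type} [Fintype κ] [DecidableEq κ]
    (E : κ → CHom V V) (hE : ∀ a, pr k 0 (E a) = E a) (W : SchurMod V lam.card) {m n : ℕ}
    (g : Fin m ⊕ Fin n → κ)
    (h : ∀ μ, Module.finrank k (LinearMap.range (W.act (weightIdem E hE lam.card μ))) =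
      Nat.card {w : Fin lam.card → Fin m ⊕ Fin n //
        IsStd (parity m n) (letterRank m n) w ∧ wordWeight (g ∘ w) = μ}) :
    formalCh E hE W = MvPolynomial.rename g (hookSchur lam m n) := by
  ext μ
  rw [coeff_formalCh, coeff_rename_hookSchur, h]
  split_ifs with hμ
  · rfl
  · rw [eq_comm, Nat.cast_eq_zero, Nat.card_eq_zero]
    refine Or.inl ⟨fun w => hμ ?_⟩
    rw [← w.2.2, degree_wordWeight]

theorem pr_piSuperSpace_single {ι : Type} [DecidableEq ι] (p : ι → ZMod 2) (i : ι) :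
    (piSuperSpace k p).proj (p i) (Pi.single i 1) = Pi.single i 1 := by
  funext j
  rw [piSuperSpace_apply]
  by_cases h : j = i
  · subst h; simp
  · simp [h]

theorem matUnit_single {ι : Type} [DecidableEq ι] (i j : ι) :
    matUnit k i (Pi.single j 1) = if j = i then Pi.single j 1 else 0 := by
  by_cases h : j = i
  · subst h; simp [matUnit]
  · simp [matUnit, h, Ne.symm h]

/-- The formal character of the `S(m|n,d)`-supermodule `Ŝ_λ(k^(m|n))`. -/
theorem chS_schurI (hk : (2 : k) ≠ 0) (lam : YoungDiagram) (m n : ℕ) :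
    chS ((schurI k lam).ev (kmn k m n)) = hookSchur lam m n := by
  classical
  have hmain : chS ((schurI k lam).ev (kmn k m n)) =
      MvPolynomial.rename id (hookSchur lam m n) := by
    refine formalCh_eq_of_finrank (unitS k) pr_unitS _ id fun μ => ?_
    let e : Module.Basis (Fin m ⊕ Fin n) k (kmn k m n).carrier := Pi.basisFun k _
    have he0 : ∀ i, e i = (Pi.single i 1 : Fin m ⊕ Fin n → k) := fun i => Pi.basisFun_apply k _ i
    refine finrank_range_weight hk (letterRank_injective m n) e (fun i => ?_) id μ (unitS k) pr_unitS
      (fun i => ?_) fun a i hne => ?_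
    · rw [he0]
      exact pr_piSuperSpace_single (parity m n) i
    · rw [he0]
      exact (matUnit_single i i).trans (if_pos rfl)
    · rw [he0]
      exact (matUnit_single a i).trans (if_neg hne)
  rw [hmain, MvPolynomial.rename_id_apply]

/-- The formal character of the `Q(n,d)`-supermodule `Ŝ_λ(V_n)`. -/
theorem chQ_schurII (hk : (2 : k) ≠ 0) (lam : YoungDiagram) (n : ℕ) :
    chQ ((schurII k lam).ev (Vn k n)) = hallLittlewood lam n := by
  classical
  refine formalCh_eq_of_finrank (unitQ k) pr_unitQ _ (Sum.elim id id) fun μ => ?_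
  let e : Module.Basis (Fin n ⊕ Fin n) k (Vn k n).forget.carrier := Pi.basisFun k _
  have he0 : ∀ i, e i = (Pi.single i 1 : Fin n ⊕ Fin n → k) := fun i => Pi.basisFun_apply k _ i
  -- Each `unitQ k a` fixes both the even and the odd basis vector of index `a`, so a weight of
  -- `Q(n,d)` counts the letters x_a and y_a together, whence `Sum.elim id id`.
  have hE : ∀ a i, (forgetHom (Vn k n) (Vn k n) (unitQ k a)).1 (e i) =
      if Sum.elim id id i = a then e i else 0 := by
    intro a i
    rw [he0]
    change (matUnit k (Sum.inl a) + matUnit k (Sum.inr a) :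
      (Fin n ⊕ Fin n → k) →ₗ[k] Fin n ⊕ Fin n → k) (Pi.single i 1) = _
    rw [LinearMap.add_apply, matUnit_single, matUnit_single]
    rcases i with i | i <;> simp <;> rfl
  change Module.finrank k (LinearMap.range ((schurI k lam).map (Vn k n).forget (Vn k n).forget
    (forgetGam (Vn k n) (Vn k n) lam.card (weightIdem (unitQ k) pr_unitQ lam.card μ)))) = _
  rw [forgetGam_weightIdem]
  refine finrank_range_weight hk (letterRank_injective n n) e (fun i => ?_) (Sum.elim id id) μ _ _
    (fun i => ?_) fun a i hne => ?_
  · rw [he0]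
    exact pr_piSuperSpace_single (parity n n) i
  · exact (hE _ i).trans (if_pos rfl)
  · exact (hE a i).trans (if_neg hne)

end Character

end SchurSuper

end

theorem mainTheorem6 {k : Type*} [Field k] (hk : (2 : k) ≠ 0) (lam : YoungDiagram) :
    (∀ n : ℕ, SchurSuper.chQ ((SchurSuper.schurII k lam).ev (SchurSuper.Vn k n)) =
      SchurSuper.hallLittlewood lam n) ∧
    SchurSuper.chI (SchurSuper.schurI k lam) = SchurSuper.hsLim lam ∧
    SchurSuper.chII (SchurSuper.schurII k lam) = SchurSuper.hallLittlewoodLim lam :=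
  ⟨SchurSuper.chQ_schurII hk lam,
    Subtype.ext (funext fun m => funext fun n => SchurSuper.chS_schurI hk lam m n),
    Subtype.ext (funext fun n => SchurSuper.chQ_schurII hk lam n)⟩
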